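/- There is an absolute constant $m_0$ such that the following holds for every field $\mathbb F$ and every integer $m\ge m_0$. Put $k=m^{0.05}$. **Variables.** Let $X^{(0)}=\{x_{p,q}: p\in[4],q\in[2]\}$, $Y^{(0)}=\{y_1,y_2\}$, $Z^{(0)}=\{z_1,z_2\}$. For $\Delta\ge 0$, $X^{(\Delta+1)}$ is the disjoint union of copies $X^{(\Delta+1)}_{i,j}$ of $X^{(\Delta)}$ ($i\in[m],j\in[2]$), and $Y^{(\Delta+1)}$ (resp. $Z^{(\Delta+1)}$) is the disjoint union of copies $Y^{(\Delta+1)}_{i,j}$ of $Y^{(\Delta)}$ (resp. $Z^{(\Delta+1)}_{i,j}$ of $Z^{(\Delta)}$) and of fresh variables $y_i$ (resp. $z_i$), $i\in[m]$. The $i$-th segment of $X^{(\Delta+1)}$ is $X^{(\Delta+1)}_{i,1}\cup X^{(\Delta+1)}_{i,2}$, and the corresponding segments of $Y^{(\Delta+1)}$, $Z^{(\Delta+1)}$ are $Y^{(\Delta+1)}_{i,1}\cup Y^{(\Delta+1)}_{i,2}\cup\{y_i\}$ and $Z^{(\Delta+1)}_{i,1}\cup Z^{(\Delta+1)}_{i,2}\cup\{z_i\}$.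 For $\Delta'\ge\Delta\geq 1$, $X^{(\Delta')}$ contains $(2m)^{\Delta'-\Delta}$ copies of $X^{(\Delta)}$; the segments of these copies are called the $X^{(\Delta)}$-segments of $X^{(\Delta')}$. **Branching programs.** $G^{(0)}$ has a source, a middle vertex and a sink; two parallel paths of length 2, with edges labelled $x_{1,1},x_{1,2}$ and $x_{2,1},x_{2,2}$, lead from the source to the middle vertex, and two, labelled $x_{3,1},x_{3,2}$ and $x_{4,1},x_{4,2}$, lead from there to the sink. $G^{(\Delta+1)}$ is the series composition over $i=1,\dots,m$ of the parallel compositions of the two copies of $G^{(\Delta)}$ on $X^{(\Delta+1)}_{i,1}$ and $X^{(\Delta+1)}_{i,2}$. **Random restrictions.** $\rho^{(0)}$ is deterministic: $x_{1,1}\mapsto y_1$, $x_{2,1}\mapsto z_1$, $x_{3,1}\mapsto y_2$, $x_{4,1}\mapsto z_2$, and $x_{p,2}\mapsto 1$ for $p\in[4]$. The random restriction $\rho^{(\Delta+1)}$ is obtained by restricting the $m$ segments independently, each by the following algorithm $\mathcal A$. Let $X_1,X_2$ be the two halves of the segment, which are copies of $X^{(\Delta)}$, and let $y,z$ be its fresh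 variables. Choose one of $E_1,E_2,E_3$, each with probability $1/3$. * $E_1$: set $X_2$ to $0$ and restrict $X_1$ by an independent sample of $\rho^{(\Delta)}$ (with the corresponding copies of $Y^{(\Delta)},Z^{(\Delta)}$). * $E_2$: the same with $X_1$ and $X_2$ exchanged. * $E_3$: choose $x_1\in X_1$ and $x_2\in X_2$ independently and uniformly; let $\pi_j$ be the lexicographically smallest source-to-sink path, in the copy of $G^{(\Delta)}$ on $X_j$, that contains the edge labelled $x_j$. Set $x_1\mapsto y$, $x_2\mapsto z$, all other labels of edges of $\pi_1,\pi_2$ to $1$, and all remaining variables of the segment to $0$. **Formulas.** Formulas have unbounded fan-in; a sum gate computes an $\mathbb F$-linear combination of its children; the size is the number of gates, including input gates. A $\Sigma$-gate all of whose children are inputs is a $(\Sigma\Pi)^0\Sigma$ formula; a $(\Sigma\Pi)^{\Delta+1}\Sigma$ formula has a sum gate as output, whose children are product gates, whose children are $(\Sigma\Pi)^{\Delta}\Sigma$ formulas. A formula is syntactic multilinear if the children of every product gate have pairwise disjoint sets of occurring variables. It is variable-labelled if every gate $\Phi$ has a finite set of variables $\mathrm{Vars}(\Phi)$ that contains all variables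 occurring below $\Phi$, such that the children of a sum gate $\Phi$ have the label $\mathrm{Vars}(\Phi)$, and the labels of the children of a product gate $\Phi$ are pairwise disjoint with union $\mathrm{Vars}(\Phi)$. $\mathrm{Vars}(F)$ is the label of the output gate of $F$. **Relative rank.** For disjoint finite sets $Y,Z$ of variables and a multilinear polynomial $g\in\mathbb F[Y\cup Z]$, $\mathrm{relrk}_{(Y,Z)}(g)=\mathrm{rank}(M_{(Y,Z)}(g))/2^{(|Y|+|Z|)/2}$, where $M_{(Y,Z)}(g)$ is the $2^{|Y|}\times2^{|Z|}$ matrix, indexed by the multilinear monomials in $Y$ and in $Z$, whose $(m_1,m_2)$ entry is the coefficient of $m_1m_2$ in $g$. **Theorem.** Let $\Delta',\Delta,M$ be integers with $1\le\Delta\le\Delta'\le m^{0.001}$ and $M\ge m/10$, and let $\varepsilon>0$ be a real number with $\varepsilon\ge M^{-0.25}$. Let $X_1,\dots,X_M$ be distinct $X^{(\Delta)}$-segments of $X^{(\Delta')}$, with corresponding segments $Y_1,\dots,Y_M$ and $Z_1,\dots,Z_M$ of $Y$- and $Z$-variables; let $Y=\bigcup_a Y_a$ and $Z=\bigcup_a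 Z_a$. Let $X'=\bigcup_{a}X'_a$ with $X'_a\subseteq X_a$ and $|X'_a|\ge\varepsilon|X_a|$ for each $a\in[M]$. Let $Y',Z'$ be arbitrary disjoint finite sets of variables that are disjoint from $X'$, $Y$ and $Z$. Let $F$ be a variable-labelled syntactic multilinear $(\Sigma\Pi)^\Delta\Sigma$ formula over $\mathbb F$ of size at most $\exp(k^{0.1}/\Delta^2)$ with $\mathrm{Vars}(F)=X'\cup Y'\cup Z'$. For each $a\in[M]$ let $\rho_a$ be a restriction of $X_a$ sampled by the algorithm $\mathcal A$, independently for different $a$, and let $\rho$ be the composition of $\rho_1,\dots,\rho_M$. Let $\tilde Y'=\rho(X')\cap Y$ and $\tilde Z'=\rho(X')\cap Z$, and let $F|_\rho$ be the polynomial obtained from the polynomial computed by $F$ by substituting $\rho(x)$ for each $x\in X'$. Then $$\Pr_\rho\Big[\mathrm{relrk}_{(Y'\cup\tilde Y',\,Z'\cup\tilde Z')}(F|_\rho)\ \ge\ \exp(-k^{0.1}/\Delta)\Big]\ \le\ \Delta\cdot\exp(-k^{0.1}/\Delta).$$ -/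

import Mathlib

namespace DepthHierarchy

/-! ### Variables -/

/-- Addresses of clones: `ω = ((i₁,j₁),…,(i_t,j_t))` with `i_s ∈ [m]`, `j_s ∈ [2]`. -/
abbrev Addr (m : ℕ) := List (Fin m × Fin 2)

/-- The variable `x_{path+1, pos+1}^{(0)}` in the copy of `X^{(0)}` that has address `addr`;
`X^{(Δ')}` consists of those with `addr.length = Δ'`. -/
structure XVar (m : ℕ) where
  addr : Addr m
  path : Fin 4
  pos : Fin 2
deriving DecidableEq

/-- Names of the `y`-variables, and likewise of the `z`-variables.
`leaf ω b` is `y_{b+1}^{(0)}` in the copy of `Y^{(0)}` that has address `ω`;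
`seg ω i` is the fresh variable of the `i`-th segment of the clone that has address `ω`. -/
inductive AVar (m : ℕ) where
  | leaf (ω : Addr m) (b : Fin 2)
  | seg (ω : Addr m) (i : Fin m)
deriving DecidableEq

/-- All variables: the `x`-, `y`- and `z`-variables and an infinite supply of further ones. -/
inductive Var (m : ℕ) where
  | x (v : XVar m)
  | y (v : AVar m)
  | z (v : AVar m)
  | aux (n : ℕ)
deriving DecidableEq

/-- The natural order of the `x`-variables: by address, then by path, then by position. -/
instance XVar.instLinearOrder {m : ℕ} : LinearOrder (XVar m) :=
  LinearOrder.lift'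
    (fun v => (toLex (v.addr.map toLex, toLex (v.path, v.pos)) :
      List (Fin m ×ₗ Fin 2) ×ₗ (Fin 4 ×ₗ Fin 2)))
    (by
      rintro ⟨a, p, q⟩ ⟨a', p', q'⟩ h
      have h' := congrArg ofLex h
      simp only [ofLex_toLex, Prod.mk.injEq, EmbeddingLike.apply_eq_iff_eq] at h'
      obtain ⟨h1, h2, h3⟩ := h'
      rw [List.map_inj_right (fun _ _ h => toLex.injective h)] at h1
      subst h1 h2 h3
      rfl)

/-- Positions of the `8 (2m)^Δ` variables inside an `X^{(Δ)}`-clone. -/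
abbrev Leaf (m Δ : ℕ) := List.Vector (Fin m × Fin 2) Δ × Fin 4 × Fin 2

/-- The variable at position `l` of the `X^{(Δ)}`-clone that has address `ω`. -/
def Leaf.at {m Δ : ℕ} (ω : Addr m) (l : Leaf m Δ) : XVar m :=
  ⟨ω ++ l.1.toList, l.2.1, l.2.2⟩

/-- The `X^{(Δ)}`-clone that has address `ω`. -/
def cloneX {m : ℕ} (Δ : ℕ) (ω : Addr m) : Finset (XVar m) :=
  Finset.univ.image (fun l : Leaf m Δ => l.at ω)

/-- The `i`-th segment of the `X^{(Δ+1)}`-clone that has address `ω`: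
the union of its two half-segments, which are `X^{(Δ)}`-clones. -/
def segX {m : ℕ} (Δ : ℕ) (ω : Addr m) (i : Fin m) : Finset (XVar m) :=
  cloneX Δ (ω ++ [(i, 0)]) ∪ cloneX Δ (ω ++ [(i, 1)])

/-- The `Y^{(Δ)}`-clone (and likewise the `Z^{(Δ)}`-clone) that has address `ω`. -/
def cloneA {m : ℕ} : ℕ → Addr m → Finset (AVar m)
  | 0, ω => {.leaf ω 0, .leaf ω 1}
  | Δ + 1, ω => Finset.univ.biUnion fun i : Fin m =>
      cloneA Δ (ω ++ [(i, 0)]) ∪ cloneA Δ (ω ++ [(i, 1)]) ∪ {.seg ω i}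

/-- The `i`-th segment of the `Y^{(Δ+1)}`-clone (likewise `Z^{(Δ+1)}`-clone) that has
address `ω`. -/
def segA {m : ℕ} (Δ : ℕ) (ω : Addr m) (i : Fin m) : Finset (AVar m) :=
  cloneA Δ (ω ++ [(i, 0)]) ∪ cloneA Δ (ω ++ [(i, 1)]) ∪ {.seg ω i}

/-! ### Source-to-sink paths of the branching programs -/

/-- The source-to-sink paths of the branching program `G^{(Δ)}` on the clone that has address
`ω`, each given by its sequence of edge labels. `G^{(0)}` consists of two parallel paths of
length two from the source to a middle vertex, followed by two parallel paths of length two to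
the sink; `G^{(Δ+1)}` is the series composition over `i ∈ [m]` of the parallel compositions of
the copies of `G^{(Δ)}` at `(ω,(i,1))` and `(ω,(i,2))`. -/
def paths {m : ℕ} : ℕ → Addr m → Set (List (XVar m))
  | 0, ω => {π | ∃ p r : Fin 4, (p = 0 ∨ p = 1) ∧ (r = 2 ∨ r = 3) ∧
      π = [⟨ω, p, 0⟩, ⟨ω, p, 1⟩, ⟨ω, r, 0⟩, ⟨ω, r, 1⟩]}
  | Δ + 1, ω => {π | ∃ (j : Fin m → Fin 2) (σ : Fin m → List (XVar m)),
      (∀ i, σ i ∈ paths Δ (ω ++ [(i, j i)])) ∧ π = (List.ofFn σ).flatten}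

/-- `x` labels an edge of the lexicographically smallest source-to-sink path, in the copy of
`G^{(Δ)}` at `ω`, that contains the edge labelled `e`. -/
def OnLeastPath {m : ℕ} (Δ : ℕ) (ω : Addr m) (e x : XVar m) : Prop :=
  ∃ π : List (XVar m), IsLeast {π' | π' ∈ paths Δ ω ∧ e ∈ π'} π ∧ x ∈ π

/-! ### Random restrictions -/

/-- The values of a restriction: `0`, `1`, a `y`-variable or a `z`-variable. -/
inductive Value (m : ℕ) where
  | zero
  | one
  | y (v : AVar m)
  | z (v : AVar m)

/-- Restrictions, as total functions; only the values on the domain of a restriction matter. -/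
abbrev Restriction (m : ℕ) := XVar m → Value m

/-- Composition of restrictions `ρ a` with pairwise disjoint domains `S a`. -/
noncomputable def compose {m : ℕ} {ι : Type} (S : ι → Finset (XVar m))
    (ρ : ι → Restriction m) : Restriction m :=
  open Classical in fun x => if h : ∃ a, x ∈ S a then ρ h.choose x else .zero

/-- The random choices made in sampling the restriction `ρ^{(Δ)}` of an `X^{(Δ)}`-clone.
All choices are drawn independently and uniformly. For each segment there are drawn one of the
options `E₁, E₂, E₃` (as an element of `Fin 3`), the choices for restricting one half-segment
(used by `E₁` and `E₂`), and one variable in each half-segment (used by `E₃`); the choices which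
the selected option does not need are ignored. -/
def CloneSeed (m : ℕ) : ℕ → Type
  | 0 => Unit
  | Δ + 1 => Fin m → Fin 3 × CloneSeed m Δ × Leaf m Δ × Leaf m Δ

/-- The random choices made in sampling the restriction of an `X^{(Δ+1)}`-segment. -/
abbrev SegSeed (m Δ : ℕ) := Fin 3 × CloneSeed m Δ × Leaf m Δ × Leaf m Δ

instance CloneSeed.instFintype (m : ℕ) : (Δ : ℕ) → Fintype (CloneSeed m Δ)
  | 0 => inferInstanceAs (Fintype Unit)
  | Δ + 1 =>
      letI := CloneSeed.instFintype m Δ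
      inferInstanceAs (Fintype (Fin m → Fin 3 × CloneSeed m Δ × Leaf m Δ × Leaf m Δ))

/-- The deterministic restriction `ρ^{(0)}` of the `X^{(0)}`-clone that has address `ω`. -/
def baseRestr {m : ℕ} (ω : Addr m) : Restriction m := fun x =>
  if x.addr = ω then
    if x.pos = 0 then
      match x.path with
      | 0 => .y (.leaf ω 0)
      | 1 => .z (.leaf ω 0)
      | 2 => .y (.leaf ω 1)
      | 3 => .z (.leaf ω 1)
    else .one
  else .zero

/-- The sampling algorithm for the `i`-th segment of the `X^{(Δ+1)}`-clone that has address `ω`,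
given the procedure `half` that samples `ρ^{(Δ)}` on an `X^{(Δ)}`-clone. -/
noncomputable def segStep {m Δ : ℕ} (half : CloneSeed m Δ → Addr m → Restriction m)
    (s : SegSeed m Δ) (ω : Addr m) (i : Fin m) : Restriction m :=
  open Classical in fun x =>
    match s with
    | (0, c, _, _) =>
        if x ∈ cloneX Δ (ω ++ [(i, 0)]) then half c (ω ++ [(i, 0)]) x else .zero
    | (1, c, _, _) =>
        if x ∈ cloneX Δ (ω ++ [(i, 1)]) then half c (ω ++ [(i, 1)]) x else .zero
    | (2, _, l₁, l₂) =>
        let x₁ := l₁.at (ω ++ [(i, 0)])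
        let x₂ := l₂.at (ω ++ [(i, 1)])
        if x = x₁ then .y (.seg ω i)
        else if x = x₂ then .z (.seg ω i)
        else if OnLeastPath Δ (ω ++ [(i, 0)]) x₁ x ∨ OnLeastPath Δ (ω ++ [(i, 1)]) x₂ x then .one
        else .zero

/-- The restriction `ρ^{(Δ)}` of the `X^{(Δ)}`-clone that has address `ω`: the composition of
the independently sampled restrictions of its `m` segments. -/
noncomputable def cloneRestr {m : ℕ} : (Δ : ℕ) → CloneSeed m Δ → Addr m → Restriction m
  | 0, _, ω => baseRestr ω
  | Δ + 1, s, ω =>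
      compose (fun i : Fin m => segX Δ ω i) (fun i => segStep (cloneRestr Δ) (s i) ω i)

/-- The restriction sampled for the `i`-th segment of the `X^{(Δ+1)}`-clone that has
address `ω`. -/
noncomputable def segRestr {m : ℕ} (Δ : ℕ) (s : SegSeed m Δ) (ω : Addr m) (i : Fin m) :
    Restriction m :=
  segStep (cloneRestr Δ) s ω i

/-- The composition `ρ₁ ∘ ⋯ ∘ ρ_M` of the restrictions sampled for the segments
`(ω a, i a)`, `a ∈ [M]`, of `X^{(Δ+1)}`-clones. -/
noncomputable def jointRestr {m M : ℕ} (Δ : ℕ) (ω : Fin M → Addr m) (i : Fin M → Fin m)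
    (s : Fin M → SegSeed m Δ) : Restriction m :=
  compose (fun a => segX Δ (ω a) (i a)) (fun a => segRestr Δ (s a) (ω a) (i a))

/-- The probability of an event when the outcome is uniform in a finite non-empty set. -/
noncomputable def uniformProb {Ω : Type*} [Fintype Ω] (E : Set Ω) : ℝ :=
  (E.ncard : ℝ) / (Fintype.card Ω : ℝ)

/-- The value of a restriction at a variable, as a polynomial. -/
noncomputable def Value.toPoly (𝔽 : Type*) [Field 𝔽] {m : ℕ} : Value m → MvPolynomial (Var m) 𝔽
  | .zero => 0
  | .one => 1
  | .y v => MvPolynomial.X (.y v)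
  | .z v => MvPolynomial.X (.z v)

/-- The polynomial obtained from `f` by replacing each `x`-variable in `D` by its value
under `ρ`. -/
noncomputable def restrictPoly {𝔽 : Type*} [Field 𝔽] {m : ℕ} (D : Finset (XVar m))
    (ρ : Restriction m) (f : MvPolynomial (Var m) 𝔽) : MvPolynomial (Var m) 𝔽 :=
  MvPolynomial.bind₁
    (fun v => match v with
      | .x e => if e ∈ D then (ρ e).toPoly 𝔽 else MvPolynomial.X (.x e)
      | w => MvPolynomial.X w) f

/-- `ρ(D) ∩ Y`, for a set `Y` of `y`-variables. -/
noncomputable def imageY {m : ℕ} (ρ : Restriction m) (D : Finset (XVar m))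
    (Y : Finset (AVar m)) : Finset (Var m) :=
  open Classical in (Y.filter fun v => ∃ e ∈ D, ρ e = .y v).image Var.y

/-- `ρ(D) ∩ Z`, for a set `Z` of `z`-variables. -/
noncomputable def imageZ {m : ℕ} (ρ : Restriction m) (D : Finset (XVar m))
    (Z : Finset (AVar m)) : Finset (Var m) :=
  open Classical in (Z.filter fun v => ∃ e ∈ D, ρ e = .z v).image Var.z

/-! ### Relative rank -/

/-- The partial derivative matrix: rows and columns are labelled by the multilinear monomials in
`Y` and in `Z` (given as subsets), the entry at `(A, B)` is the coefficient of `∏ A · ∏ B`. -/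
noncomputable def pdMatrix {𝔽 V : Type*} [Field 𝔽] (Y Z : Finset V) (g : MvPolynomial V 𝔽) :
    Matrix Y.powerset Z.powerset 𝔽 :=
  Matrix.of fun A B =>
    g.coeff ((∑ v ∈ A.1, Finsupp.single v 1) + ∑ v ∈ B.1, Finsupp.single v 1)

/-- The relative rank of `g` with respect to `(Y, Z)`. -/
noncomputable def relrk {𝔽 V : Type*} [Field 𝔽] (Y Z : Finset V) (g : MvPolynomial V 𝔽) : ℝ :=
  ((pdMatrix Y Z g).rank : ℝ) / (2 : ℝ) ^ (((Y.card : ℝ) + (Z.card : ℝ)) / 2)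

/-! ### Variable-labelled formulas -/

/-- Algebraic formulas of unbounded fan-in over the field `𝔽` in variables from `V`, in which
every gate carries a finite set `S` of variables as a label. A sum gate computes a linear
combination, with coefficients `c`, of its children. -/
inductive LFormula (𝔽 V : Type*) where
  | var (S : Finset V) (v : V)
  | const (S : Finset V) (a : 𝔽)
  | sum (S : Finset V) {n : ℕ} (c : Fin n → 𝔽) (Ψ : Fin n → LFormula 𝔽 V)
  | prod (S : Finset V) {n : ℕ} (Ψ : Fin n → LFormula 𝔽 V)

namespace LFormula

variable {𝔽 V : Type*}

/-- The label of the output gate. -/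
def vars : LFormula 𝔽 V → Finset V
  | .var S _ => S
  | .const S _ => S
  | .sum S _ _ => S
  | .prod S _ => S

/-- The polynomial computed at the output gate. -/
noncomputable def eval [Field 𝔽] : LFormula 𝔽 V → MvPolynomial V 𝔽
  | .var _ v => MvPolynomial.X v
  | .const _ a => MvPolynomial.C a
  | .sum _ c Ψ => ∑ i, MvPolynomial.C (c i) * (Ψ i).eval
  | .prod _ Ψ => ∏ i, (Ψ i).eval

/-- The number of gates, input gates included. -/
def size : LFormula 𝔽 V → ℕ
  | .var _ _ => 1
  | .const _ _ => 1
  | .sum _ _ Ψ => 1 + ∑ i, (Ψ i).size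
  | .prod _ Ψ => 1 + ∑ i, (Ψ i).size

/-- The set of the variables that appear in the formula. -/
def supp [DecidableEq V] : LFormula 𝔽 V → Finset V
  | .var _ v => {v}
  | .const _ _ => ∅
  | .sum _ _ Ψ => Finset.univ.biUnion fun i => (Ψ i).supp
  | .prod _ Ψ => Finset.univ.biUnion fun i => (Ψ i).supp

/-- At each product gate, the children have pairwise disjoint supports. -/
def SyntacticMultilinear [DecidableEq V] : LFormula 𝔽 V → Prop
  | .var _ _ => True
  | .const _ _ => True
  | .sum _ _ Ψ => ∀ i, (Ψ i).SyntacticMultilinear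
  | .prod _ Ψ => (∀ i j, i ≠ j → Disjoint (Ψ i).supp (Ψ j).supp) ∧
      ∀ i, (Ψ i).SyntacticMultilinear

/-- The labels form a variable-set labelling: each label contains the support of its gate, the
children of a sum gate have the same label as the gate, and the labels of the children of a
product gate are pairwise disjoint with union the label of the gate. -/
def VariableLabelled [DecidableEq V] : LFormula 𝔽 V → Prop
  | .var S v => v ∈ S
  | .const _ _ => True
  | .sum S c Ψ => (LFormula.sum S c Ψ).supp ⊆ S ∧ (∀ i, (Ψ i).vars = S) ∧
      ∀ i, (Ψ i).VariableLabelled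
  | .prod S Ψ => (LFormula.prod S Ψ).supp ⊆ S ∧ (S = Finset.univ.biUnion fun i => (Ψ i).vars) ∧
      (∀ i j, i ≠ j → Disjoint (Ψ i).vars (Ψ j).vars) ∧ ∀ i, (Ψ i).VariableLabelled

/-- The gate is an input gate. -/
def IsInput : LFormula 𝔽 V → Prop
  | .var _ _ => True
  | .const _ _ => True
  | .sum _ _ _ => False
  | .prod _ _ => False

/-- `(ΣΠ)^Δ Σ` formulas. -/
def IsSigmaPiSigma : ℕ → LFormula 𝔽 V → Prop
  | 0, F => ∃ (S : Finset V) (n : ℕ) (c : Fin n → 𝔽) (Ψ : Fin n → LFormula 𝔽 V),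
      F = .sum S c Ψ ∧ ∀ i, (Ψ i).IsInput
  | Δ + 1, F => ∃ (S : Finset V) (n : ℕ) (c : Fin n → 𝔽) (Φ : Fin n → LFormula 𝔽 V),
      F = .sum S c Φ ∧ ∀ i, ∃ (S' : Finset V) (t : ℕ) (Ψ : Fin t → LFormula 𝔽 V),
        Φ i = .prod S' Ψ ∧ ∀ j, (Ψ j).IsSigmaPiSigma Δ

end LFormula

end DepthHierarchy

open DepthHierarchy

/-! Put κ = k^0.1 = m^0.005. The proof is by induction on Δ, in the form `RankBound`: only the kind
(0, 1, y or z) of each value is recorded, surviving variables keep their names, and every variable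
outside the given parts of segments has a fixed kind. In this form, fixing part of the randomness
leads to another instance of the same statement.

Relative rank is at most 1, subadditive, and submultiplicative over factors with disjoint labels. At
most exp(κ/Δ²) product gates feed the output gate, so by a union bound it suffices that each of them
rarely has relative rank at least η = exp(-κ/Δ - κ/Δ²). Given a product gate with factors Ψ_j, fix
in every segment a half in which the given variables have density at least ε. There are three cases
(`Admissible.uniformProb_prod_le`).

Dominated: in at least half of the segments a single factor owns 15/16 of the chosen half. Very
likely E₁ or E₂ keeps one such half. Its m subsegments are then restricted independently by the same
algorithm, and the induction hypothesis applies to the factor that owns it.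

Spread: let V_j be the density of Ψ_j summed over the other segments, and suppose that the sum of
min(V_j, 1) is at least L = m^0.01. Option E₃ randomizes the parity of the number of survivors in
many factors. An odd number of survivors cannot be split evenly between y and z, which costs a
factor √2 of relative rank. The joint law of the parities is controlled by characters
(`avg_prod_odd_le`).

Heavy: otherwise the total of the V_j, which is at least M^(3/4)/4, is concentrated enough that some
V_j is at least M^(3/4)/(4L). A constant fraction of this density very likely lies in halves kept by
E₁ or E₂, and the induction hypothesis applies to Ψ_j on their subsegments.

For Δ = 1 the factors are affine linear, their matrices have rank at most 2, and counting survivors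
replaces the induction hypothesis. The passage between kinds and actual values is
`relrk_restrictPoly_eq`: a restriction is injective on surviving variables, and renaming preserves
rank. -/

namespace DepthHierarchy

/-! ### Relative rank: sums, products, imbalance and degree one -/

section RelativeRank

variable {𝔽 V : Type*} [Field 𝔽]

theorem rank_le_of_eq_mul {m n ι : Type*} [Fintype n] [Fintype ι] {A : Matrix m n 𝔽}
    (B : Matrix m ι 𝔽) (C : Matrix ι n 𝔽) (h : A = B * C) : A.rank ≤ Fintype.card ι := by
  rw [h]
  exact (Matrix.rank_mul_le_left B C).trans (Matrix.rank_le_card_width B)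

/-- Together with `rank_le_of_eq_mul` this reduces rank bounds to writing down factorizations: they
are concatenated for a sum of matrices and tensored for a product of polynomials. -/
theorem exists_rank_factorization {m n : Type*} [Fintype m] [Fintype n] (A : Matrix m n 𝔽) :
    ∃ (B : Matrix m (Fin A.rank) 𝔽) (C : Matrix (Fin A.rank) n 𝔽), A = B * C := by
  classical
  let b := Module.finBasisOfFinrankEq 𝔽 (LinearMap.range A.mulVecLin) (n := A.rank) rfl
  refine ⟨Matrix.of fun i r => (b r : m → 𝔽) i,
    Matrix.of fun r j => b.repr ⟨A.mulVecLin (Pi.single j 1), LinearMap.mem_range_self _ _⟩ r, ?_⟩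
  ext i j
  have h := b.sum_repr ⟨A.mulVecLin (Pi.single j 1), LinearMap.mem_range_self _ _⟩
  have h2 := congrArg (fun v : LinearMap.range A.mulVecLin => (v : m → 𝔽) i) h
  simp only [Submodule.coe_sum, Submodule.coe_smul, Finset.sum_apply, Pi.smul_apply,
    smul_eq_mul, Matrix.mulVecLin_apply, Matrix.mulVec_single_one, Matrix.col_apply] at h2
  rw [← h2, Matrix.mul_apply]
  exact Finset.sum_congr rfl fun r _ => by simp [mul_comm]

theorem rank_add_le' {m n : Type*} [Fintype m] [Fintype n] (A B : Matrix m n 𝔽) :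
    (A + B).rank ≤ A.rank + B.rank := by
  obtain ⟨A₁, A₂, hA⟩ := exists_rank_factorization A
  obtain ⟨B₁, B₂, hB⟩ := exists_rank_factorization B
  have := rank_le_of_eq_mul (A := A + B) (Matrix.fromCols A₁ B₁) (Matrix.fromRows A₂ B₂)
    (by rw [Matrix.fromCols_mul_fromRows, ← hA, ← hB])
  simpa using this

theorem rank_smul_le {m n : Type*} [Fintype m] [Fintype n] (c : 𝔽) (A : Matrix m n 𝔽) :
    (c • A).rank ≤ A.rank := by
  obtain ⟨A₁, A₂, hA⟩ := exists_rank_factorization A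
  have := rank_le_of_eq_mul (A := c • A) (c • A₁) A₂ (by rw [Matrix.smul_mul, ← hA])
  simpa using this

theorem rank_sum_smul_le {m n ι : Type*} [Fintype m] [Fintype n] (s : Finset ι) (c : ι → 𝔽)
    (A : ι → Matrix m n 𝔽) : (∑ i ∈ s, c i • A i).rank ≤ ∑ i ∈ s, (A i).rank := by
  classical
  induction s using Finset.induction_on with
  | empty => simp
  | insert i s hi ih =>
    rw [Finset.sum_insert hi, Finset.sum_insert hi]
    exact (rank_add_le' _ _).trans (Nat.add_le_add (rank_smul_le _ _) ih)

/-- The exponent vector of the multilinear monomial `∏ v ∈ A, v`. -/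
noncomputable def monomialExp (A : Finset V) : V →₀ ℕ := ∑ v ∈ A, Finsupp.single v 1

theorem monomialExp_apply [DecidableEq V] (A : Finset V) (v : V) :
    monomialExp A v = if v ∈ A then 1 else 0 := by
  simp [monomialExp, Finsupp.finsetSum_apply, Finsupp.single_apply]

theorem pdMatrix_apply (Y Z : Finset V) (g : MvPolynomial V 𝔽) (A : Y.powerset)
    (B : Z.powerset) :
    pdMatrix Y Z g A B = g.coeff (monomialExp A.1 + monomialExp B.1) := rfl

theorem relrk_nonneg (Y Z : Finset V) (g : MvPolynomial V 𝔽) : 0 ≤ relrk Y Z g := by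
  unfold relrk; positivity

theorem relrk_sum_le {n : ℕ} (Y Z : Finset V) (c : Fin n → 𝔽) (g : Fin n → MvPolynomial V 𝔽) :
    relrk Y Z (∑ i, MvPolynomial.C (c i) * g i) ≤ ∑ i, relrk Y Z (g i) := by
  unfold relrk
  rw [← Finset.sum_div]
  gcongr
  have : pdMatrix Y Z (∑ i, MvPolynomial.C (c i) * g i) = ∑ i, c i • pdMatrix Y Z (g i) := by
    ext A B
    rw [pdMatrix_apply, Matrix.sum_apply, MvPolynomial.coeff_sum]
    simp [pdMatrix_apply]
  rw [this]
  exact_mod_cast rank_sum_smul_le _ _ _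

theorem relrk_le_of_rank_le {Y Z : Finset V} {g : MvPolynomial V 𝔽} {r : ℕ}
    (h : (pdMatrix Y Z g).rank ≤ r) :
    relrk Y Z g ≤ r * (2 : ℝ) ^ (-((Y.card : ℝ) + Z.card) / 2) := by
  unfold relrk
  rw [neg_div, Real.rpow_neg (by norm_num), ← div_eq_mul_inv]
  gcongr

/-- The rank is at most the smaller of 2^|Y| and 2^|Z|, while the normalization is their geometric
mean. -/
theorem relrk_le_two_rpow (Y Z : Finset V) (g : MvPolynomial V 𝔽) :
    relrk Y Z g ≤ (2 : ℝ) ^ (-|(Y.card : ℝ) - Z.card| / 2) := by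
  have key : ∀ c : ℕ, (pdMatrix Y Z g).rank ≤ 2 ^ c →
      relrk Y Z g ≤ (2 : ℝ) ^ ((c : ℝ) - ((Y.card : ℝ) + Z.card) / 2) := by
    intro c hc
    refine (relrk_le_of_rank_le hc).trans (le_of_eq ?_)
    rw [Nat.cast_pow, Nat.cast_ofNat, ← Real.rpow_natCast, ← Real.rpow_add (by norm_num)]
    congr 1; ring
  rcases le_total (Y.card : ℝ) Z.card with h | h
  · refine (key Y.card ((Matrix.rank_le_card_height _).trans (by simp))).trans (le_of_eq ?_)
    rw [abs_of_nonpos (by linarith)]; congr 1; ring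
  · refine (key Z.card ((Matrix.rank_le_card_width _).trans (by simp))).trans (le_of_eq ?_)
    rw [abs_of_nonneg (by linarith)]; congr 1; ring

theorem relrk_le_one (Y Z : Finset V) (g : MvPolynomial V 𝔽) : relrk Y Z g ≤ 1 := by
  refine (relrk_le_two_rpow Y Z g).trans (Real.rpow_le_one_of_one_le_of_nonpos (by norm_num) ?_)
  have := abs_nonneg ((Y.card : ℝ) - Z.card)
  linarith

/-- An odd total forces |Y| and |Z| to differ by at least 1. This is the only source of rank loss in
the spread case. -/
theorem relrk_sq_le_of_odd {Y Z : Finset V} (g : MvPolynomial V 𝔽) (h : Odd (Y.card + Z.card)) :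
    relrk Y Z g ^ 2 ≤ 1 / 2 := by
  have h1 : (1 : ℝ) ≤ |(Y.card : ℝ) - Z.card| := by
    have : (1 : ℤ) ≤ |(Y.card : ℤ) - Z.card| := by
      exact Int.one_le_abs (by grind)
    exact_mod_cast this
  have h2 : relrk Y Z g ≤ (2 : ℝ) ^ (-(1 : ℝ) / 2) :=
    (relrk_le_two_rpow Y Z g).trans (Real.rpow_le_rpow_of_exponent_le (by norm_num) (by linarith))
  calc relrk Y Z g ^ 2 ≤ ((2 : ℝ) ^ (-(1 : ℝ) / 2)) ^ 2 := by
        gcongr; exact relrk_nonneg _ _ _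
    _ = 1 / 2 := by
        rw [← Real.rpow_natCast, ← Real.rpow_mul (by norm_num)]; norm_num [Real.rpow_neg_one]

theorem coeff_mul_of_disjoint [DecidableEq V] {S₁ S₂ : Finset V} {f g : MvPolynomial V 𝔽}
    (hS : Disjoint S₁ S₂) (hf : f.vars ⊆ S₁) (hg : g.vars ⊆ S₂) {d₁ d₂ : V →₀ ℕ}
    (h₁ : d₁.support ⊆ S₁) (h₂ : d₂.support ⊆ S₂) :
    (f * g).coeff (d₁ + d₂) = f.coeff d₁ * g.coeff d₂ := by
  rw [MvPolynomial.coeff_mul, Finset.sum_eq_single (d₁, d₂)]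
  · rintro ⟨e₁, e₂⟩ he hne
    by_contra hc
    have hc1 : e₁ ∈ f.support := by
      rw [MvPolynomial.mem_support_iff]; exact left_ne_zero_of_mul hc
    have hc2 : e₂ ∈ g.support := by
      rw [MvPolynomial.mem_support_iff]; exact right_ne_zero_of_mul hc
    rw [Finset.HasAntidiagonal.mem_antidiagonal] at he
    have hz1 : ∀ v, v ∉ S₁ → e₁ v = 0 := fun v hv =>
      MvPolynomial.mem_support_notMem_vars_zero hc1 fun h => hv (hf h)
    have hz2 : ∀ v, v ∉ S₂ → e₂ v = 0 := fun v hv =>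
      MvPolynomial.mem_support_notMem_vars_zero hc2 fun h => hv (hg h)
    have hd1 : ∀ v, v ∉ S₁ → d₁ v = 0 := fun v hv =>
      Finsupp.notMem_support_iff.1 fun h => hv (h₁ h)
    have hd2 : ∀ v, v ∉ S₂ → d₂ v = 0 := fun v hv =>
      Finsupp.notMem_support_iff.1 fun h => hv (h₂ h)
    have hv : ∀ v, e₁ v + e₂ v = d₁ v + d₂ v := fun v => by
      have := DFunLike.congr_fun he v
      simpa using this
    have hdis : ∀ v, v ∉ S₁ ∨ v ∉ S₂ := fun v => by
      by_contra h
      push Not at h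
      exact Finset.disjoint_left.1 hS h.1 h.2
    apply hne
    have : ∀ v, e₁ v = d₁ v ∧ e₂ v = d₂ v := fun v => by
      have := hv v
      by_cases h1 : v ∈ S₁
      · have h2 := (hdis v).resolve_left (not_not.2 h1)
        have := hz2 v h2; have := hd2 v h2; omega
      · have := hz1 v h1; have := hd1 v h1; omega
    rw [Prod.mk.injEq]
    exact ⟨Finsupp.ext fun v => (this v).1, Finsupp.ext fun v => (this v).2⟩
  · intro h
    simp at h

theorem monomialExp_union [DecidableEq V] {A B : Finset V} (h : Disjoint A B) :
    monomialExp (A ∪ B) = monomialExp A + monomialExp B :=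
  Finset.sum_union h

theorem support_monomialExp [DecidableEq V] (A : Finset V) : (monomialExp A).support = A := by
  ext v; simp [monomialExp_apply]

/-- Since the variables are disjoint, the matrix of the product is the Kronecker product of the two
matrices, and the exponents in the normalization add up. -/
theorem relrk_mul_le [DecidableEq V] {S₁ S₂ Y₁ Y₂ Z₁ Z₂ : Finset V} {f g : MvPolynomial V 𝔽}
    (hS : Disjoint S₁ S₂) (hf : f.vars ⊆ S₁) (hg : g.vars ⊆ S₂) (hY₁ : Y₁ ⊆ S₁) (hY₂ : Y₂ ⊆ S₂)
    (hZ₁ : Z₁ ⊆ S₁) (hZ₂ : Z₂ ⊆ S₂) :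
    relrk (Y₁ ∪ Y₂) (Z₁ ∪ Z₂) (f * g) ≤ relrk Y₁ Z₁ f * relrk Y₂ Z₂ g := by
  have hdY : Disjoint Y₁ Y₂ := Finset.disjoint_of_subset_left hY₁ (hS.mono_right hY₂)
  have hdZ : Disjoint Z₁ Z₂ := Finset.disjoint_of_subset_left hZ₁ (hS.mono_right hZ₂)
  obtain ⟨B₁, C₁, h₁⟩ := exists_rank_factorization (pdMatrix Y₁ Z₁ f)
  obtain ⟨B₂, C₂, h₂⟩ := exists_rank_factorization (pdMatrix Y₂ Z₂ g)
  have hi : ∀ {U W : Finset V} (_ : W ⊆ U) (A : Finset V), A ∩ W ∈ W.powerset := fun _ A => by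
    simp
  have hr := rank_le_of_eq_mul (A := pdMatrix (Y₁ ∪ Y₂) (Z₁ ∪ Z₂) (f * g))
    (ι := Fin (pdMatrix Y₁ Z₁ f).rank × Fin (pdMatrix Y₂ Z₂ g).rank)
    (Matrix.of fun A r => B₁ ⟨A.1 ∩ Y₁, hi hY₁ _⟩ r.1 * B₂ ⟨A.1 ∩ Y₂, hi hY₂ _⟩ r.2)
    (Matrix.of fun r B => C₁ r.1 ⟨B.1 ∩ Z₁, hi hZ₁ _⟩ * C₂ r.2 ⟨B.1 ∩ Z₂, hi hZ₂ _⟩) (by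
      ext A B
      have e : ∀ {A U W : Finset V} (_ : Disjoint U W) (_ : A ∈ (U ∪ W).powerset),
          monomialExp A = monomialExp (A ∩ U) + monomialExp (A ∩ W) := by
        intro A U W hd hA
        rw [← monomialExp_union, ← Finset.inter_union_distrib_left,
          Finset.inter_eq_left.2 (Finset.mem_powerset.1 hA)]
        exact Finset.disjoint_of_subset_left Finset.inter_subset_right
          (hd.mono_right Finset.inter_subset_right)
      have hsup : ∀ {A B U W S : Finset V}, U ⊆ S → W ⊆ S →
          (monomialExp (A ∩ U) + monomialExp (B ∩ W)).support ⊆ S := by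
        intro A B U W S hU hW
        refine Finsupp.support_add.trans ?_
        rw [support_monomialExp, support_monomialExp]
        exact Finset.union_subset (Finset.inter_subset_right.trans hU)
          (Finset.inter_subset_right.trans hW)
      rw [pdMatrix_apply, e hdY A.2, e hdZ B.2, add_add_add_comm,
        coeff_mul_of_disjoint hS hf hg (hsup hY₁ hZ₁) (hsup hY₂ hZ₂)]
      have e1 := congrFun (congrFun h₁ ⟨A.1 ∩ Y₁, hi hY₁ _⟩) ⟨B.1 ∩ Z₁, hi hZ₁ _⟩
      have e2 := congrFun (congrFun h₂ ⟨A.1 ∩ Y₂, hi hY₂ _⟩) ⟨B.1 ∩ Z₂, hi hZ₂ _⟩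
      rw [pdMatrix_apply, Matrix.mul_apply] at e1 e2
      rw [e1, e2, Finset.sum_mul_sum, Matrix.mul_apply, Fintype.sum_prod_type]
      refine Finset.sum_congr rfl fun i _ => Finset.sum_congr rfl fun j _ => ?_
      simp only [Matrix.of_apply]; ring)
  rw [Fintype.card_prod, Fintype.card_fin, Fintype.card_fin] at hr
  unfold relrk
  rw [Finset.card_union_of_disjoint hdY, Finset.card_union_of_disjoint hdZ, div_mul_div_comm,
    ← Real.rpow_add (by norm_num)]
  have e3 : ((Y₁.card : ℝ) + Z₁.card) / 2 + ((Y₂.card : ℝ) + Z₂.card) / 2 =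
    (((Y₁.card + Y₂.card : ℕ) : ℝ) + ((Z₁.card + Z₂.card : ℕ) : ℝ)) / 2 := by push_cast; ring
  rw [e3]
  gcongr
  exact_mod_cast hr

theorem relrk_le_of_totalDegree_le_one {Y Z : Finset V} {g : MvPolynomial V 𝔽}
    (h : g.totalDegree ≤ 1) :
    relrk Y Z g ≤ 2 * (2 : ℝ) ^ (-((Y.card : ℝ) + Z.card) / 2) := by
  classical
  refine relrk_le_of_rank_le (r := 2) ?_
  -- In degree at most 1 only the row and the column of the empty monomial can be nonzero; the
  -- corner entry is counted in the row.
  have key : pdMatrix Y Z g =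
      Matrix.vecMulVec (fun A : Y.powerset => if A.1 = ∅ then (1 : 𝔽) else 0)
        (fun B => g.coeff (monomialExp B.1)) +
      Matrix.vecMulVec
        (fun A : Y.powerset => if A.1 = ∅ then (0 : 𝔽) else g.coeff (monomialExp A.1))
        (fun B : Z.powerset => if B.1 = ∅ then (1 : 𝔽) else 0) := by
    ext A B
    rw [pdMatrix_apply, Matrix.add_apply, Matrix.vecMulVec_apply, Matrix.vecMulVec_apply]
    by_cases hA : A.1 = ∅
    · simp [hA, monomialExp]
    · by_cases hB : B.1 = ∅
      · simp [hA, hB, monomialExp]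
      · simp only [hA, hB, if_false, zero_mul, mul_zero, add_zero]
        apply MvPolynomial.coeff_eq_zero_of_totalDegree_lt
        refine h.trans_lt ?_
        have e : ∀ C : Finset V, (monomialExp C).degree = C.card := fun C => by
          simp [monomialExp, map_sum]
        have := e A.1; have := e B.1
        have h3 : (monomialExp A.1 + monomialExp B.1).degree = A.1.card + B.1.card := by
          rw [map_add]; omega
        have : 0 < A.1.card := Finset.card_pos.2 (Finset.nonempty_iff_ne_empty.2 hA)
        have : 0 < B.1.card := Finset.card_pos.2 (Finset.nonempty_iff_ne_empty.2 hB)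
        have h4 : (monomialExp A.1 + monomialExp B.1).degree =
          ∑ i ∈ (monomialExp A.1 + monomialExp B.1).support,
            (monomialExp A.1 + monomialExp B.1) i := rfl
        omega
  rw [key]
  refine (rank_add_le' _ _).trans ?_
  have h1 := Matrix.rank_vecMulVec_le
    (fun A : Y.powerset => if A.1 = ∅ then (1 : 𝔽) else 0)
    (fun B : Z.powerset => g.coeff (monomialExp B.1))
  have h2 := Matrix.rank_vecMulVec_le
    (fun A : Y.powerset => if A.1 = ∅ then (0 : 𝔽) else g.coeff (monomialExp A.1))
    (fun B : Z.powerset => if B.1 = ∅ then (1 : 𝔽) else 0)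
  omega

theorem relrk_rename {W : Type*} [DecidableEq W] {φ : V → W} (hφ : Function.Injective φ)
    (Y Z : Finset V) (g : MvPolynomial V 𝔽) :
    relrk (Y.image φ) (Z.image φ) (MvPolynomial.rename φ g) = relrk Y Z g := by
  classical
  have e : ∀ T : Finset V, Function.Bijective
      (fun A : T.powerset => (⟨A.1.image φ, Finset.mem_powerset.2
        (Finset.image_subset_image (Finset.mem_powerset.1 A.2))⟩ : (T.image φ).powerset)) := by
    intro T
    constructor
    · intro A B h
      exact Subtype.ext (Finset.image_injective hφ (congrArg Subtype.val h))
    · rintro ⟨B, hB⟩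
      obtain ⟨A, hA, rfl⟩ := Finset.subset_image_iff.1 (Finset.mem_powerset.1 hB)
      exact ⟨⟨A, Finset.mem_powerset.2 (by exact_mod_cast hA)⟩, rfl⟩
  have hm : pdMatrix Y Z g = (pdMatrix (Y.image φ) (Z.image φ) (MvPolynomial.rename φ g)).submatrix
      (Equiv.ofBijective _ (e Y)) (Equiv.ofBijective _ (e Z)) := by
    ext A B
    have h1 : ∀ A : Finset V, monomialExp (A.image φ) = (monomialExp A).mapDomain φ := by
      intro A
      rw [monomialExp, monomialExp, Finset.sum_image (fun _ _ _ _ h => hφ h),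
        Finsupp.mapDomain_finsetSum]
      simp
    rw [Matrix.submatrix_apply, pdMatrix_apply, pdMatrix_apply]
    simp only [Equiv.ofBijective_apply]
    rw [h1, h1, ← Finsupp.mapDomain_add, MvPolynomial.coeff_rename_mapDomain φ hφ]
  unfold relrk
  rw [Finset.card_image_of_injective _ hφ, Finset.card_image_of_injective _ hφ, hm,
    Matrix.rank_submatrix]

end RelativeRank

end DepthHierarchy

/-! ### Relative rank under a colouring of the variables by kinds of values -/

namespace DepthHierarchy

/-- The kinds of values of a restriction, the identity of `y`- and `z`-variables forgotten. -/
inductive Col where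
  | zero
  | one
  | y
  | z
deriving DecidableEq

/-- The kind of a value. -/
def Value.col {m : ℕ} : Value m → Col
  | .zero => .zero
  | .one => .one
  | .y _ => .y
  | .z _ => .z

/-- A variable survives if it is set to a `y`- or a `z`-variable. -/
def Col.Alive (c : Col) : Prop := c = .y ∨ c = .z

instance : DecidablePred Col.Alive := fun c => inferInstanceAs (Decidable (c = .y ∨ c = .z))

section Colouring

variable {𝔽 V : Type*} [Field 𝔽]

/-- Substitution of `0` and `1` according to `θ`; surviving variables keep their names. -/
noncomputable def substCol (𝔽 : Type*) [Field 𝔽] (θ : V → Col) :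
    MvPolynomial V 𝔽 →ₐ[𝔽] MvPolynomial V 𝔽 :=
  MvPolynomial.bind₁ fun e => match θ e with
    | .zero => 0
    | .one => 1
    | .y => MvPolynomial.X e
    | .z => MvPolynomial.X e

/-- The relative rank after the substitution `θ`, with the variables of `S` coloured by `θ`. -/
noncomputable def colRelrk (θ : V → Col) (S : Finset V) (g : MvPolynomial V 𝔽) : ℝ :=
  relrk (S.filter fun e => θ e = .y) (S.filter fun e => θ e = .z) (substCol 𝔽 θ g)

/-- The number of surviving variables. -/
def aliveCard (θ : V → Col) (S : Finset V) : ℕ := (S.filter fun e => (θ e).Alive).card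

theorem card_filter_y_add_card_filter_z (θ : V → Col) (S : Finset V) :
    (S.filter fun e => θ e = .y).card + (S.filter fun e => θ e = .z).card = aliveCard θ S := by
  classical
  rw [aliveCard, ← Finset.card_union_of_disjoint]
  · congr 1; ext e
    rw [Finset.mem_union, Finset.mem_filter, Finset.mem_filter, Finset.mem_filter, Col.Alive]
    tauto
  · refine Finset.disjoint_left.2 fun e h1 h2 => ?_
    rw [Finset.mem_filter] at h1 h2
    rw [h1.2] at h2
    exact absurd h2.2 (by decide)

theorem colRelrk_nonneg (θ : V → Col) (S : Finset V) (g : MvPolynomial V 𝔽) :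
    0 ≤ colRelrk θ S g := relrk_nonneg _ _ _

theorem colRelrk_le_one (θ : V → Col) (S : Finset V) (g : MvPolynomial V 𝔽) :
    colRelrk θ S g ≤ 1 := relrk_le_one _ _ _

theorem colRelrk_sq_le_of_odd {θ : V → Col} {S : Finset V} (g : MvPolynomial V 𝔽)
    (h : Odd (aliveCard θ S)) : colRelrk θ S g ^ 2 ≤ 1 / 2 :=
  relrk_sq_le_of_odd _ (by rwa [card_filter_y_add_card_filter_z])

theorem colRelrk_sum_le {n : ℕ} (θ : V → Col) (S : Finset V) (c : Fin n → 𝔽)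
    (g : Fin n → MvPolynomial V 𝔽) :
    colRelrk θ S (∑ i, MvPolynomial.C (c i) * g i) ≤ ∑ i, colRelrk θ S (g i) := by
  unfold colRelrk
  have : substCol 𝔽 θ (∑ i, MvPolynomial.C (c i) * g i) =
      ∑ i, MvPolynomial.C (c i) * substCol 𝔽 θ (g i) := by
    simp [map_sum, map_mul, substCol]
  rw [this]
  exact relrk_sum_le _ _ _ _

theorem vars_substCol_subset [DecidableEq V] (θ : V → Col) (g : MvPolynomial V 𝔽) :
    (substCol 𝔽 θ g).vars ⊆ g.vars := by
  unfold substCol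
  refine (MvPolynomial.vars_bind₁ _ _).trans (Finset.biUnion_subset.2 fun e he => ?_)
  have : ∀ c : Col, (match c with
    | .zero => (0 : MvPolynomial V 𝔽)
    | .one => 1
    | .y => MvPolynomial.X e
    | .z => MvPolynomial.X e).vars ⊆ {e} := by
    intro c; cases c <;> simp
  exact (this _).trans (Finset.singleton_subset_iff.2 he)

theorem colRelrk_mul_le [DecidableEq V] (θ : V → Col) {S₁ S₂ : Finset V}
    {f g : MvPolynomial V 𝔽} (hS : Disjoint S₁ S₂) (hf : f.vars ⊆ S₁) (hg : g.vars ⊆ S₂) :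
    colRelrk θ (S₁ ∪ S₂) (f * g) ≤ colRelrk θ S₁ f * colRelrk θ S₂ g := by
  unfold colRelrk
  rw [Finset.filter_union, Finset.filter_union, map_mul]
  exact relrk_mul_le hS ((vars_substCol_subset θ f).trans hf) ((vars_substCol_subset θ g).trans hg)
    (Finset.filter_subset _ _) (Finset.filter_subset _ _) (Finset.filter_subset _ _)
    (Finset.filter_subset _ _)

theorem colRelrk_prod_le [DecidableEq V] {ι : Type*} [DecidableEq ι] (θ : V → Col)
    (s : Finset ι) {S : ι → Finset V} {g : ι → MvPolynomial V 𝔽}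
    (hS : ∀ i j, i ≠ j → Disjoint (S i) (S j)) (hg : ∀ i, (g i).vars ⊆ S i) :
    colRelrk θ (s.biUnion S) (∏ i ∈ s, g i) ≤ ∏ i ∈ s, colRelrk θ (S i) (g i) := by
  induction s using Finset.induction_on with
  | empty => simpa using colRelrk_le_one _ _ _
  | insert i s hi ih =>
    rw [Finset.biUnion_insert, Finset.prod_insert hi, Finset.prod_insert hi]
    refine (colRelrk_mul_le θ ?_ (hg i) ?_).trans
      (mul_le_mul_of_nonneg_left ih (colRelrk_nonneg _ _ _))
    · rw [Finset.disjoint_biUnion_right]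
      exact fun j hj => hS i j fun h => hi (h ▸ hj)
    · exact (MvPolynomial.vars_prod _).trans (Finset.biUnion_mono fun j _ => hg j)

theorem totalDegree_substCol_le {θ : V → Col} {g : MvPolynomial V 𝔽} :
    (substCol 𝔽 θ g).totalDegree ≤ g.totalDegree := by
  classical
  have hX : ∀ e, (match θ e with
      | .zero => (0 : MvPolynomial V 𝔽)
      | .one => 1
      | .y => MvPolynomial.X e
      | .z => MvPolynomial.X e).totalDegree ≤ 1 := by
    intro e; cases θ e <;> simp
  conv_lhs => rw [g.as_sum]
  rw [map_sum]
  refine MvPolynomial.totalDegree_finsetSum_le fun d hd => ?_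
  unfold substCol
  rw [MvPolynomial.bind₁_monomial]
  refine (MvPolynomial.totalDegree_mul _ _).trans ?_
  rw [MvPolynomial.totalDegree_C, zero_add]
  refine (MvPolynomial.totalDegree_finsetProd _ _).trans ?_
  refine le_trans (Finset.sum_le_sum fun e _ => ?_) (MvPolynomial.le_totalDegree hd)
  refine (MvPolynomial.totalDegree_pow _ _).trans ?_
  calc d e * _ ≤ d e * 1 := Nat.mul_le_mul_left _ (hX e)
    _ = _ := mul_one _

theorem colRelrk_le_of_totalDegree_le_one (θ : V → Col) (S : Finset V) {g : MvPolynomial V 𝔽}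
    (h : g.totalDegree ≤ 1) :
    colRelrk θ S g ≤ 2 * (2 : ℝ) ^ (-(aliveCard θ S : ℝ) / 2) := by
  rw [← card_filter_y_add_card_filter_z, Nat.cast_add]
  exact relrk_le_of_totalDegree_le_one (totalDegree_substCol_le.trans h)

end Colouring

/-! ### Polynomials computed by labelled formulas -/

namespace LFormula

variable {𝔽 V : Type*}

theorem vars_eval_subset_supp [Field 𝔽] [DecidableEq V] (F : LFormula 𝔽 V) :
    F.eval.vars ⊆ F.supp := by
  induction F with
  | var S v => simp [eval, supp]
  | const S a => simp [eval, supp]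
  | sum S c Ψ ih =>
    simp only [eval, supp]
    refine (MvPolynomial.vars_sum_subset _ _).trans (Finset.biUnion_mono fun i _ => ?_)
    refine (MvPolynomial.vars_mul _ _).trans ?_
    simpa using ih i
  | prod S Ψ ih =>
    simp only [eval, supp]
    exact (MvPolynomial.vars_prod _).trans (Finset.biUnion_mono fun i _ => ih i)

theorem VariableLabelled.supp_subset_vars [DecidableEq V] {F : LFormula 𝔽 V}
    (h : F.VariableLabelled) : F.supp ⊆ F.vars := by
  cases F with
  | var S v => simpa [supp, vars, VariableLabelled] using h
  | const S a => simp [supp]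
  | sum S c Ψ => exact h.1
  | prod S Ψ => exact h.1

theorem VariableLabelled.vars_eval_subset [Field 𝔽] [DecidableEq V] {F : LFormula 𝔽 V}
    (h : F.VariableLabelled) : F.eval.vars ⊆ F.vars :=
  (vars_eval_subset_supp F).trans h.supp_subset_vars

theorem IsSigmaPiSigma.totalDegree_eval_le_one [Field 𝔽] {F : LFormula 𝔽 V}
    (h : F.IsSigmaPiSigma 0) : F.eval.totalDegree ≤ 1 := by
  obtain ⟨S, n, c, Ψ, rfl, hΨ⟩ := h
  simp only [eval]
  refine MvPolynomial.totalDegree_finsetSum_le fun i _ => ?_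
  refine (MvPolynomial.totalDegree_mul _ _).trans ?_
  rw [MvPolynomial.totalDegree_C, zero_add]
  have := hΨ i
  cases hi : Ψ i with
  | var S v => simp [eval]
  | const S a => simp [eval]
  | sum S c Ψ => rw [hi] at this; exact this.elim
  | prod S Ψ => rw [hi] at this; exact this.elim

end LFormula

end DepthHierarchy

namespace DepthHierarchy

/-! ### Uniform averages, Markov's inequality and a Chernoff bound -/

section Averages

/-- The expectation of `f` at a uniformly random point. -/
noncomputable def avg {Ω : Type*} [Fintype Ω] (f : Ω → ℝ) : ℝ := (∑ s, f s) / Fintype.card Ω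

variable {Ω Ω' : Type*} [Fintype Ω] [Fintype Ω']

theorem avg_mono {f g : Ω → ℝ} (h : ∀ s, f s ≤ g s) : avg f ≤ avg g := by
  unfold avg; gcongr with s; exact h s

theorem avg_const [Nonempty Ω] (c : ℝ) : avg (fun _ : Ω => c) = c := by
  simp [avg]

theorem avg_sum {κ : Type*} (s : Finset κ) (f : κ → Ω → ℝ) :
    avg (fun x => ∑ i ∈ s, f i x) = ∑ i ∈ s, avg (f i) := by
  unfold avg; rw [Finset.sum_comm, Finset.sum_div]

theorem avg_const_mul (c : ℝ) (f : Ω → ℝ) : avg (fun x => c * f x) = c * avg f := by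
  unfold avg; rw [← Finset.mul_sum, mul_div_assoc]

theorem avg_add (f g : Ω → ℝ) : avg (fun x => f x + g x) = avg f + avg g := by
  unfold avg; rw [Finset.sum_add_distrib, add_div]

theorem abs_avg_le (f : Ω → ℝ) : |avg f| ≤ avg fun x => |f x| := by
  unfold avg
  rw [abs_div, Nat.abs_cast]
  gcongr
  exact Finset.abs_sum_le_sum_abs _ _

theorem avg_equiv (e : Ω ≃ Ω') (f : Ω' → ℝ) : avg (fun x => f (e x)) = avg f := by
  unfold avg; rw [Equiv.sum_comp e f, Fintype.card_congr e]

theorem avg_prod_type (f : Ω × Ω' → ℝ) : avg f = avg fun x => avg fun y => f (x, y) := by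
  unfold avg
  rw [Fintype.sum_prod_type, Fintype.card_prod, ← Finset.sum_div, Nat.cast_mul, div_div,
    mul_comm (Fintype.card Ω : ℝ)]

/-- Independence of the coordinates of a uniform point. -/
theorem avg_pi_prod {ι : Type*} [Fintype ι] [DecidableEq ι] (f : ι → Ω → ℝ) :
    avg (fun s : ι → Ω => ∏ a, f a (s a)) = ∏ a, avg (f a) := by
  unfold avg
  rw [Finset.prod_div_distrib, Finset.prod_univ_sum, Fintype.piFinset_univ]
  simp

theorem uniformProb_eq_avg (E : Set Ω) : uniformProb E = avg (E.indicator fun _ => 1) := by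
  classical
  unfold uniformProb avg
  simp only [Set.indicator_apply, Finset.sum_boole]
  rw [Set.ncard_eq_toFinset_card']
  congr 3
  ext s; simp

theorem uniformProb_mono {E E' : Set Ω} (h : E ⊆ E') : uniformProb E ≤ uniformProb E' := by
  unfold uniformProb
  gcongr
  exact Set.toFinite _

theorem uniformProb_union_le (E E' : Set Ω) :
    uniformProb (E ∪ E') ≤ uniformProb E + uniformProb E' := by
  unfold uniformProb
  rw [← add_div]
  gcongr
  exact_mod_cast Set.ncard_union_le E E'

theorem uniformProb_iUnion_le {n : ℕ} (E : Fin n → Set Ω) :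
    uniformProb (⋃ i, E i) ≤ ∑ i, uniformProb (E i) := by
  rw [uniformProb_eq_avg]
  simp_rw [uniformProb_eq_avg]
  rw [← avg_sum]
  refine avg_mono fun s => ?_
  have h0 : ∀ i, 0 ≤ (E i).indicator (fun _ => (1 : ℝ)) s := fun i =>
    Set.indicator_nonneg (fun _ _ => zero_le_one) s
  by_cases hs : s ∈ ⋃ i, E i
  · rw [Set.indicator_of_mem hs]
    obtain ⟨i, hi⟩ := Set.mem_iUnion.1 hs
    calc (1 : ℝ) = (E i).indicator (fun _ => (1 : ℝ)) s := by rw [Set.indicator_of_mem hi]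
      _ ≤ _ := Finset.single_le_sum (f := fun i => (E i).indicator (fun _ => (1 : ℝ)) s)
          (fun i _ => h0 i) (Finset.mem_univ i)
  · rw [Set.indicator_of_notMem hs]
    exact Finset.sum_nonneg fun i _ => h0 i

theorem uniformProb_ge_le_avg_div {f : Ω → ℝ} (hf : ∀ s, 0 ≤ f s) {η : ℝ} (hη : 0 < η) :
    uniformProb {s | η ≤ f s} ≤ avg f / η := by
  rw [uniformProb_eq_avg, div_eq_inv_mul, ← avg_const_mul]
  refine avg_mono fun s => ?_
  rw [Set.indicator_apply]
  split_ifs with h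
  · rw [← div_eq_inv_mul, le_div_iff₀ hη, one_mul]; exact h
  · exact mul_nonneg (inv_nonneg.2 hη.le) (hf s)

theorem exp_neg_le_one_sub_half {x : ℝ} (h0 : 0 ≤ x) (h1 : x ≤ 1) : Real.exp (-x) ≤ 1 - x / 2 := by
  rw [Real.exp_neg]
  have h := Real.add_one_le_exp x
  rw [inv_le_comm₀ (Real.exp_pos x) (by linarith)]
  refine le_trans ?_ h
  rw [inv_le_comm₀ (by linarith) (by linarith)]
  rw [← one_div, div_le_iff₀ (by linarith)]
  nlinarith

/-- Exponential moments: each selected weight contributes a factor `exp (-w a)`. The mean of the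
product is at most exp(-W/6), and Markov's inequality at exp(-W/10) leaves exp(-W/6 + W/10) =
exp(-W/15). -/
theorem uniformProb_selected_lt_le {ι : Type*} [Fintype ι] [DecidableEq ι] [Nonempty Ω]
    (sel : ι → Ω → Prop) [∀ a, DecidablePred (sel a)]
    (hsel : ∀ a, (1 : ℝ) / 3 ≤ avg fun x => if sel a x then (1 : ℝ) else 0)
    (D : Finset ι) (w : ι → ℝ) (h0 : ∀ a, 0 ≤ w a) (h1 : ∀ a, w a ≤ 1) {W : ℝ}
    (hW : W ≤ ∑ a ∈ D, w a) :
    uniformProb {s : ι → Ω | ∑ a ∈ D with sel a (s a), w a < W / 10} ≤ Real.exp (-W / 15) := by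
  have hsub : {s : ι → Ω | ∑ a ∈ D with sel a (s a), w a < W / 10} ⊆
      {s | Real.exp (-W / 10) ≤
        ∏ a, (if a ∈ D ∧ sel a (s a) then Real.exp (-w a) else 1)} := by
    intro s hs
    rw [Set.mem_ofPred_eq] at hs ⊢
    rw [← Finset.prod_filter, ← Real.exp_sum, Real.exp_le_exp, Finset.sum_neg_distrib]
    have : (Finset.univ.filter fun a => a ∈ D ∧ sel a (s a)) = D.filter fun a => sel a (s a) := by
      ext a; simp
    rw [this]; linarith
  refine (uniformProb_mono hsub).trans ((uniformProb_ge_le_avg_div (fun s => ?_)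
    (Real.exp_pos _)).trans ?_)
  · exact Finset.prod_nonneg fun a _ => by split_ifs <;> positivity
  rw [div_le_iff₀ (Real.exp_pos _), ← Real.exp_add,
    avg_pi_prod fun a x => if a ∈ D ∧ sel a x then Real.exp (-w a) else 1]
  have hb : ∀ a, avg (fun x => if a ∈ D ∧ sel a x then Real.exp (-w a) else 1) ≤
      if a ∈ D then Real.exp (-w a / 6) else 1 := by
    intro a
    by_cases ha : a ∈ D
    · have e : (fun x => if a ∈ D ∧ sel a x then Real.exp (-w a) else 1) =
          fun x => 1 + (Real.exp (-w a) - 1) * (if sel a x then (1 : ℝ) else 0) := by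
        funext x; by_cases hx : sel a x <;> simp [ha, hx]
      rw [e, avg_add, avg_const, avg_const_mul, if_pos ha]
      have h2 := exp_neg_le_one_sub_half (h0 a) (h1 a)
      have h3 := Real.add_one_le_exp (-w a / 6)
      have h4 := hsel a
      have h5 := h0 a
      nlinarith
    · simp [ha, avg_const]
  refine (Finset.prod_le_prod (fun a _ => ?_) fun a _ => hb a).trans ?_
  · exact div_nonneg (Finset.sum_nonneg fun x _ => by split_ifs <;> positivity) (by positivity)
  rw [← Finset.prod_filter, Finset.filter_mem_eq_inter, Finset.univ_inter, ← Real.exp_sum,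
    Real.exp_le_exp, ← Finset.sum_div, Finset.sum_neg_distrib]
  linarith

end Averages

/-! ### Joint parities of sums of independent contributions -/

section Parity

variable {ι J : Type*} [Fintype J] [DecidableEq J]

/-- Complementation and toggling j act on the subsets. For T containing j, the sums over T and over
{j} ∪ Tᶜ add up to at most 1 + p j ≤ 31/16, so one of the two is at most 31/32. Hence a quarter of
all T contain j and are balanced. -/
theorem card_finset_le_four_mul_sum (p : J → ℝ)
    (hp1 : ∑ j, p j ≤ 1) (j : J) (hj : p j ≤ 15 / 16) :
    (Fintype.card (Finset J) : ℝ) ≤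
      4 * ∑ T : Finset J, if j ∈ T ∧ ∑ i ∈ T, p i ≤ 31 / 32 then (1 : ℝ) else 0 := by
  set f : Finset J → ℝ := fun T => if j ∈ T ∧ ∑ i ∈ T, p i ≤ 31 / 32 then (1 : ℝ) else 0 with hf
  have hf0 : ∀ T, 0 ≤ f T := fun T => by simp only [hf]; split_ifs <;> norm_num
  have core : ∀ T : Finset J, j ∈ T → 1 ≤ f T + f (insert j Tᶜ) := by
    intro T hT
    by_cases h1 : ∑ i ∈ T, p i ≤ 31 / 32
    · have : f T = 1 := by simp [hf, hT, h1]
      linarith [hf0 (insert j Tᶜ)]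
    · have h2 : ∑ i ∈ insert j Tᶜ, p i ≤ 31 / 32 := by
        rw [Finset.sum_insert (by simpa using hT)]
        have := Finset.sum_add_sum_compl T p
        linarith [not_le.1 h1]
      have : f (insert j Tᶜ) = 1 := by simp [hf, h2]
      linarith [hf0 T]
  have key : ∀ T : Finset J, 1 ≤ f T + f Tᶜ + f (symmDiff T {j}) + f (symmDiff T {j})ᶜ := by
    intro T
    by_cases hT : j ∈ T
    · have e : (symmDiff T {j})ᶜ = insert j Tᶜ := by
        ext i
        simp only [Finset.mem_compl, Finset.mem_symmDiff, Finset.mem_singleton, Finset.mem_insert]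
        by_cases hi : i = j
        · simp [hi, hT]
        · simp [hi]
      rw [e]
      linarith [core T hT, hf0 Tᶜ, hf0 (symmDiff T {j})]
    · have e : symmDiff T {j} = insert j (Tᶜ)ᶜ := by
        ext i
        simp only [Finset.mem_symmDiff, Finset.mem_singleton, Finset.mem_insert, compl_compl]
        by_cases hi : i = j
        · simp [hi, hT]
        · simp [hi]
      have := core Tᶜ (by simpa using hT)
      rw [← e] at this
      linarith [hf0 T, hf0 (symmDiff T {j})ᶜ]
  have hc : ∑ T, f Tᶜ = ∑ T, f T :=
    Equiv.sum_comp (Function.Involutive.toPerm (fun T : Finset J => Tᶜ) compl_involutive) f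
  have hs : ∀ g : Finset J → ℝ, ∑ T, g (symmDiff T {j}) = ∑ T, g T := fun g =>
    Equiv.sum_comp (Function.Involutive.toPerm (fun T : Finset J => symmDiff T {j})
      (fun T => symmDiff_symmDiff_cancel_right {j} T)) g
  have := Finset.sum_le_sum fun T (_ : T ∈ (Finset.univ : Finset (Finset J))) => key T
  rw [Finset.sum_add_distrib, Finset.sum_add_distrib, Finset.sum_add_distrib, hc, hs f,
    hs (fun T => f Tᶜ), hc] at this
  simp only [Finset.sum_const, Finset.card_univ, nsmul_eq_mul, mul_one] at this
  linarith

/-- A character over a union of factors is useless if the union nearly fills a half. Averaging over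
a random T keeps a quarter of the truncated mass while discarding the rows that T nearly fills. -/
theorem exists_balanced_subset (D : Finset ι) (p : ι → J → ℝ) (hp0 : ∀ a j, 0 ≤ p a j)
    (hp1 : ∀ a ∈ D, ∑ j, p a j ≤ 1) (hp2 : ∀ a ∈ D, ∀ j, p a j ≤ 15 / 16) :
    ∃ T : Finset J, (∑ j, min (∑ a ∈ D, p a j) 1) / 4 ≤
      ∑ j ∈ T, min (∑ a ∈ D with ∑ i ∈ T, p a i ≤ 31 / 32, p a j) 1 := by
  set V : J → ℝ := fun j => ∑ a ∈ D, p a j with hV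
  set G : Finset J → J → ℝ := fun T j =>
    if j ∈ T then min (∑ a ∈ D with ∑ i ∈ T, p a i ≤ 31 / 32, p a j) 1 else 0 with hG
  have hV0 : ∀ j, 0 ≤ V j := fun j => Finset.sum_nonneg fun a _ => hp0 a j
  have step : ∀ j, (Fintype.card (Finset J) : ℝ) * min (V j) 1 ≤ 4 * ∑ T, G T j := by
    intro j
    -- Scaling by c makes the truncation at 1 linear in the rows, so that the average over T can be
    -- taken row by row.
    obtain ⟨c, hc0, hc1, hcV⟩ : ∃ c : ℝ, 0 ≤ c ∧ c ≤ 1 ∧ c * V j = min (V j) 1 := by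
      rcases le_total (V j) 1 with h | h
      · exact ⟨1, zero_le_one, le_rfl, by rw [one_mul, min_eq_left h]⟩
      · exact ⟨(V j)⁻¹, inv_nonneg.2 (hV0 j), inv_le_one_of_one_le₀ h,
          by rw [inv_mul_cancel₀ (by linarith), min_eq_right h]⟩
    have hlow : ∀ T, c * ∑ a ∈ D, p a j *
        (if j ∈ T ∧ ∑ i ∈ T, p a i ≤ 31 / 32 then (1 : ℝ) else 0) ≤ G T j := by
      intro T
      by_cases hT : j ∈ T
      · simp only [hG, hT, true_and, if_true, mul_ite, mul_one, mul_zero, ← Finset.sum_filter]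
        have h0 : 0 ≤ ∑ a ∈ D with ∑ i ∈ T, p a i ≤ 31 / 32, p a j :=
          Finset.sum_nonneg fun a _ => hp0 a j
        have h1 : ∑ a ∈ D with ∑ i ∈ T, p a i ≤ 31 / 32, p a j ≤ V j :=
          Finset.sum_le_sum_of_subset_of_nonneg (Finset.filter_subset _ _) fun a _ _ => hp0 a j
        refine le_min (mul_le_of_le_one_left h0 hc1) ?_
        calc _ ≤ c * V j := mul_le_mul_of_nonneg_left h1 hc0
          _ ≤ 1 := hcV ▸ min_le_right _ _
      · simp [hG, hT]
    calc (Fintype.card (Finset J) : ℝ) * min (V j) 1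
        = c * ∑ a ∈ D, p a j * Fintype.card (Finset J) := by
          rw [← hcV, ← Finset.sum_mul]; ring
      _ ≤ c * ∑ a ∈ D, p a j * (4 * ∑ T : Finset J,
            if j ∈ T ∧ ∑ i ∈ T, p a i ≤ 31 / 32 then (1 : ℝ) else 0) := by
          gcongr with a ha
          · exact hp0 a j
          · exact card_finset_le_four_mul_sum (p a) (hp1 a ha) j (hp2 a ha j)
      _ = 4 * ∑ T : Finset J, c * ∑ a ∈ D, p a j *
            (if j ∈ T ∧ ∑ i ∈ T, p a i ≤ 31 / 32 then (1 : ℝ) else 0) := by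
          rw [← Finset.mul_sum, Finset.sum_comm, Finset.mul_sum, Finset.mul_sum, Finset.mul_sum]
          refine Finset.sum_congr rfl fun a _ => ?_
          rw [← Finset.mul_sum]; ring
      _ ≤ _ := by gcongr with T; exact hlow T
  have htot : ∑ _T : Finset J, (∑ j, min (V j) 1) / 4 ≤ ∑ T : Finset J, ∑ j, G T j := by
    rw [Finset.sum_comm, Finset.sum_const, Finset.card_univ, nsmul_eq_mul]
    have := Finset.sum_le_sum fun j (_ : j ∈ (Finset.univ : Finset J)) => step j
    rw [← Finset.mul_sum, ← Finset.mul_sum] at this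
    linarith
  obtain ⟨T, -, hT⟩ := Finset.exists_le_of_sum_le Finset.univ_nonempty htot
  refine ⟨T, hT.trans (le_of_eq ?_)⟩
  simp only [hG]
  rw [← Finset.sum_filter, Finset.filter_mem_eq_inter, Finset.univ_inter]

/-- If every summand has a parity character that is bounded away from `1`, then many of the sums
`b j + ∑ a, n a (s a) j` are odd. -/
theorem avg_prod_odd_le [Fintype ι] [DecidableEq ι] {Ω : Type*} [Fintype Ω] [Nonempty Ω]
    (n : ι → Ω → J → ℕ) (b : J → ℕ)
    (D : Finset ι) (p : ι → J → ℝ) (hp0 : ∀ a j, 0 ≤ p a j)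
    (hp1 : ∀ a ∈ D, ∑ j, p a j ≤ 1) (hp2 : ∀ a ∈ D, ∀ j, p a j ≤ 15 / 16)
    (hn : ∀ a ∈ D, ∀ T : Finset J, |avg fun x => ∏ j ∈ T, (-1 : ℝ) ^ n a x j| ≤
      1 - (1 - |1 - 2 * ∑ j ∈ T, p a j|) / 3) :
    avg (fun s : ι → Ω => ∏ j, if Odd (b j + ∑ a, n a (s a) j) then (1 : ℝ) / 2 else 1) ≤
      Real.exp (-(∑ j, min (∑ a ∈ D, p a j) 1) / 1536) := by
  -- Only the factors in T are used below; the others are bounded by 1. Every U ⊆ T inherits the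
  -- bound 31/32 on the rows in D'.
  obtain ⟨T, hT⟩ := exists_balanced_subset D p hp0 hp1 hp2
  set D' := D.filter fun a => ∑ i ∈ T, p a i ≤ 31 / 32 with hD'
  set V : J → ℝ := fun j => ∑ a ∈ D', p a j with hV
  have hV0 : ∀ j, 0 ≤ V j := fun j => Finset.sum_nonneg fun a _ => hp0 a j
  have habs : ∀ (a : ι) (U : Finset J), |avg fun x => ∏ j ∈ U, (-1 : ℝ) ^ n a x j| ≤ 1 := by
    intro a U
    refine (abs_avg_le _).trans (le_of_eq ?_)
    simp only [Finset.abs_prod, abs_pow, abs_neg, abs_one, one_pow, Finset.prod_const_one,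
      avg_const]
  have hchar : ∀ U : Finset J, U ⊆ T → ∀ a ∈ D',
      |avg fun x => ∏ j ∈ U, (-1 : ℝ) ^ n a x j| ≤ Real.exp (-(∑ j ∈ U, p a j) / 48) := by
    intro U hU a ha
    rw [hD', Finset.mem_filter] at ha
    have h1 : ∑ j ∈ U, p a j ≤ 31 / 32 :=
      (Finset.sum_le_sum_of_subset_of_nonneg hU fun j _ _ => hp0 a j).trans ha.2
    have h0 : 0 ≤ ∑ j ∈ U, p a j := Finset.sum_nonneg fun j _ => hp0 a j
    refine (hn a ha.1 U).trans ?_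
    have h2 := Real.add_one_le_exp (-(∑ j ∈ U, p a j) / 48)
    -- The upper end needs the sum to be at most 32/33, which 31/32 satisfies. Division by 3 then
    -- gives the rate 1/48.
    have h3 : |1 - 2 * ∑ j ∈ U, p a j| ≤ 1 - (∑ j ∈ U, p a j) / 16 :=
      abs_le.2 ⟨by linarith, by linarith⟩
    linarith
  have hterm : ∀ U ∈ T.powerset,
      avg (fun s : ι → Ω => ∏ j ∈ U, ((-1 : ℝ) ^ (b j + ∑ a, n a (s a) j))) ≤
        ∏ j ∈ U, Real.exp (-V j / 48) := by
    intro U hU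
    have e : (fun s : ι → Ω => ∏ j ∈ U, ((-1 : ℝ) ^ (b j + ∑ a, n a (s a) j))) = fun s =>
        (∏ j ∈ U, (-1 : ℝ) ^ b j) * ∏ a, ∏ j ∈ U, (-1 : ℝ) ^ n a (s a) j := by
      funext s
      rw [Finset.prod_comm, ← Finset.prod_mul_distrib]
      refine Finset.prod_congr rfl fun j _ => ?_
      rw [pow_add, Finset.prod_pow_eq_pow_sum]
    rw [e, avg_const_mul, avg_pi_prod fun a x => ∏ j ∈ U, (-1 : ℝ) ^ n a x j]
    refine (le_abs_self _).trans ?_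
    rw [abs_mul, Finset.abs_prod, Finset.abs_prod]
    simp only [abs_pow, abs_neg, abs_one, one_pow, Finset.prod_const_one, one_mul]
    calc ∏ a, |avg fun x => ∏ j ∈ U, (-1 : ℝ) ^ n a x j|
        ≤ ∏ a, if a ∈ D' then Real.exp (-(∑ j ∈ U, p a j) / 48) else 1 :=
          Finset.prod_le_prod (fun _ _ => abs_nonneg _) fun a _ => by
            split_ifs with ha
            · exact hchar U (Finset.mem_powerset.1 hU) a ha
            · exact habs a U
      _ = ∏ j ∈ U, Real.exp (-V j / 48) := by
          rw [← Finset.prod_filter, Finset.filter_mem_eq_inter, Finset.univ_inter, ← Real.exp_sum,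
            ← Real.exp_sum, ← Finset.sum_div, ← Finset.sum_div, Finset.sum_neg_distrib,
            Finset.sum_neg_distrib, Finset.sum_comm]
  calc avg (fun s : ι → Ω => ∏ j, if Odd (b j + ∑ a, n a (s a) j) then (1 : ℝ) / 2 else 1)
      -- The value is 1/2 for odd and 1 for even sums, as an affine function of the sign. Expanding
      -- the product over T yields a combination of characters with nonnegative coefficients, so
      -- each character can be replaced by its upper bound and the product folded back.
      ≤ avg (fun s : ι → Ω => ∏ j ∈ T, (1 / 4 * (-1 : ℝ) ^ (b j + ∑ a, n a (s a) j) + 3 / 4)) := by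
        refine avg_mono fun s => ?_
        rw [← Finset.prod_mul_prod_compl T]
        refine (mul_le_of_le_one_right (Finset.prod_nonneg fun j _ => ?_)
          (Finset.prod_le_one (fun j _ => ?_) fun j _ => ?_)).trans
            (Finset.prod_le_prod (fun j _ => ?_) fun j _ => ?_)
        · split_ifs <;> norm_num
        · split_ifs <;> norm_num
        · split_ifs <;> norm_num
        · split_ifs <;> norm_num
        · split_ifs with h
          · rw [h.neg_one_pow]; norm_num
          · rw [(Nat.not_odd_iff_even.1 h).neg_one_pow]; norm_num
    _ = ∑ U ∈ T.powerset, ((1 / 4 : ℝ) ^ U.card * (3 / 4) ^ (T \ U).card) *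
          avg (fun s : ι → Ω => ∏ j ∈ U, ((-1 : ℝ) ^ (b j + ∑ a, n a (s a) j))) := by
        simp_rw [Finset.prod_add, avg_sum, Finset.prod_mul_distrib, Finset.prod_const,
          ← avg_const_mul]
        exact Finset.sum_congr rfl fun U _ => congrArg avg (funext fun s => by ring)
    _ ≤ ∑ U ∈ T.powerset, ((1 / 4 : ℝ) ^ U.card * (3 / 4) ^ (T \ U).card) *
          ∏ j ∈ U, Real.exp (-V j / 48) := by
        gcongr with U hU; exact hterm U hU
    _ = ∏ j ∈ T, (1 / 4 * Real.exp (-V j / 48) + 3 / 4) := by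
        simp_rw [Finset.prod_add, Finset.prod_mul_distrib, Finset.prod_const]
        exact Finset.sum_congr rfl fun U _ => by ring
    -- 1/384 = 1/4 · 1/2 · 1/48, the middle factor coming from exp(-x) ≤ 1 - x/2 on [0, 1]. The
    -- quarter lost in choosing T then gives 1536.
    _ ≤ ∏ j ∈ T, Real.exp (-min (V j) 1 / 384) := by
        refine Finset.prod_le_prod (fun j _ => by positivity) fun j _ => ?_
        have h1 : Real.exp (-V j / 48) ≤ Real.exp (-(min (V j) 1 / 48)) := by
          rw [Real.exp_le_exp]; linarith [min_le_left (V j) 1]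
        have h2 := exp_neg_le_one_sub_half (x := min (V j) 1 / 48)
          (div_nonneg (le_min (hV0 j) zero_le_one) (by norm_num))
          (by linarith [min_le_right (V j) 1])
        have h3 := Real.add_one_le_exp (-min (V j) 1 / 384)
        linarith
    _ ≤ _ := by
        rw [← Real.exp_sum, Real.exp_le_exp, ← Finset.sum_div, Finset.sum_neg_distrib]
        linarith

end Parity

/-! ### Selecting many dense members of a family -/

section Selection

/-- A family of weights in `[0,1]` with a large sum contains a large subfamily of large weights. -/
theorem exists_subset_card_rpow_le {κ : Type*} [DecidableEq κ] (A : Finset κ) (d : κ → ℝ)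
    (h1 : ∀ x ∈ A, d x ≤ 1) {μ : ℝ}
    (hsum : μ + 2 * (A.card : ℝ) ^ (3 / 4 : ℝ) < ∑ x ∈ A, d x) :
    ∃ B ⊆ A, μ ≤ B.card ∧ ∀ x ∈ B, 1 / (B.card : ℝ) ^ (0.25 : ℝ) ≤ d x := by
  induction hn : A.card using Nat.strong_induction_on generalizing A with
  | _ n ih =>
    by_cases hall : ∀ x ∈ A, 1 / (A.card : ℝ) ^ (0.25 : ℝ) ≤ d x
    · refine ⟨A, subset_rfl, ?_, hall⟩
      have h2 : ∑ x ∈ A, d x ≤ A.card := by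
        simpa using Finset.sum_le_sum h1
      have : 0 ≤ (A.card : ℝ) ^ (3 / 4 : ℝ) := by positivity
      linarith
    -- Discard one member of weight below |A|^(-1/4) and recurse. The discarded weights are paid for
    -- by the decrease of 2|A|^(3/4).
    · push Not at hall
      obtain ⟨x, hx, hdx⟩ := hall
      have hpos : 0 < A.card := Finset.card_pos.2 ⟨x, hx⟩
      have hcard : (A.erase x).card + 1 = A.card := Finset.card_erase_add_one hx
      obtain ⟨B, hB, hB'⟩ := ih (A.erase x).card (by omega) (A.erase x)
        (fun y hy => h1 y (Finset.mem_of_mem_erase hy)) (by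
          have hs := Finset.sum_erase_add A d hx
          have hr : ((A.erase x).card : ℝ) = A.card - 1 := by
            rw [← hcard]; push_cast; ring
          rw [hr]
          have hA1 : (1 : ℝ) ≤ A.card := by exact_mod_cast hpos
          have key : 2 * ((A.card : ℝ) - 1) ^ (3 / 4 : ℝ) + 1 / (A.card : ℝ) ^ (0.25 : ℝ) ≤
              2 * (A.card : ℝ) ^ (3 / 4 : ℝ) := by
            set r : ℝ := (A.card : ℝ)
            have hr0 : 0 < r := by linarith
            have e1 : r - 1 = r * (1 + -(1 / r)) := by field_simp; ring
            -- Bernoulli's inequality: the decrease of 2r^(3/4) from r to r - 1 is at least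
            -- (3/2)r^(-1/4).
            have hb := rpow_one_add_le_one_add_mul_self (s := -(1 / r)) (p := 3 / 4)
              (by rw [neg_le_neg_iff, div_le_one hr0]; exact hA1) (by norm_num) (by norm_num)
            have hnn : 0 ≤ 1 + -(1 / r) := by
              have : 1 / r ≤ 1 := by rw [div_le_one hr0]; exact hA1
              linarith
            have e2 : 1 / r ^ (0.25 : ℝ) = r ^ (3 / 4 : ℝ) * (1 / r) := by
              rw [one_div, one_div, ← Real.rpow_neg hr0.le, ← Real.rpow_neg_one r,
                ← Real.rpow_add hr0]
              norm_num
            rw [e2, e1, Real.mul_rpow hr0.le hnn]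
            have hp : 0 ≤ r ^ (3 / 4 : ℝ) := by positivity
            have hq : 0 ≤ r ^ (3 / 4 : ℝ) * (1 / r) := by positivity
            nlinarith [mul_le_mul_of_nonneg_left hb hp]
          linarith) rfl
      exact ⟨B, hB.trans (Finset.erase_subset _ _), hB'⟩

end Selection

end DepthHierarchy

namespace DepthHierarchy

/-! ### Clones, segments and the restriction of a single segment -/

section Clones

variable {m : ℕ}

theorem Leaf.at_injective {Δ : ℕ} (ω : Addr m) :
    Function.Injective (fun l : Leaf m Δ => l.at ω) := by
  rintro ⟨v, p, q⟩ ⟨v', p', q'⟩ h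
  simp only [Leaf.at, XVar.mk.injEq, List.append_cancel_left_eq] at h
  obtain ⟨h1, h2, h3⟩ := h
  rw [Subtype.ext h1, h2, h3]

theorem card_cloneX (Δ : ℕ) (ω : Addr m) : (cloneX Δ ω).card = Fintype.card (Leaf m Δ) := by
  rw [cloneX, Finset.card_image_of_injective _ (Leaf.at_injective ω), Finset.card_univ]

theorem mem_cloneX {Δ : ℕ} {ω : Addr m} {v : XVar m} :
    v ∈ cloneX Δ ω ↔ ∃ r : Addr m, r.length = Δ ∧ v.addr = ω ++ r := by
  rw [cloneX, Finset.mem_image]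
  constructor
  · rintro ⟨l, -, rfl⟩
    exact ⟨l.1.toList, l.1.toList_length, rfl⟩
  · rintro ⟨r, hr, hv⟩
    refine ⟨(⟨r, hr⟩, v.path, v.pos), Finset.mem_univ _, ?_⟩
    cases v
    simp only at hv
    subst hv
    rfl

theorem fin_two_cases {P : Fin 2 → Prop} : (∃ h, P h) ↔ P 0 ∨ P 1 := by
  constructor
  · rintro ⟨h, hh⟩
    fin_cases h
    · exact Or.inl hh
    · exact Or.inr hh
  · rintro (h | h)
    · exact ⟨0, h⟩
    · exact ⟨1, h⟩

theorem mem_segX {Δ : ℕ} {ω : Addr m} {i : Fin m} {v : XVar m} :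
    v ∈ segX Δ ω i ↔ ∃ h : Fin 2, v ∈ cloneX Δ (ω ++ [(i, h)]) := by
  rw [segX, Finset.mem_union, fin_two_cases]

theorem mem_cloneX_succ {Δ : ℕ} {ω : Addr m} {v : XVar m} :
    v ∈ cloneX (Δ + 1) ω ↔ ∃ b, v ∈ segX Δ ω b := by
  simp only [mem_segX, mem_cloneX]
  constructor
  · rintro ⟨r, hr, hv⟩
    cases r with
    | nil => simp at hr
    | cons x r => exact ⟨x.1, x.2, r, by simpa using hr, by simp [hv]⟩
  · rintro ⟨b, h, r, hr, hv⟩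
    exact ⟨(b, h) :: r, by simp [hr], by simp [hv]⟩

theorem addr_eq_of_mem_cloneX {Δ : ℕ} {ω ω' : Addr m} (hl : ω.length = ω'.length) {v : XVar m}
    (h : v ∈ cloneX Δ ω) (h' : v ∈ cloneX Δ ω') : ω = ω' := by
  obtain ⟨r, -, hr⟩ := mem_cloneX.1 h
  obtain ⟨r', -, hr'⟩ := mem_cloneX.1 h'
  exact (List.append_inj (hr.symm.trans hr') hl).1

theorem half_eq_of_mem {Δ : ℕ} {ω ω' : Addr m} (hl : ω.length = ω'.length) {i i' : Fin m}
    {h h' : Fin 2} {v : XVar m} (hv : v ∈ cloneX Δ (ω ++ [(i, h)]))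
    (hv' : v ∈ cloneX Δ (ω' ++ [(i', h')])) : ω = ω' ∧ i = i' ∧ h = h' := by
  have := addr_eq_of_mem_cloneX (by simp [hl]) hv hv'
  have h2 := List.append_inj this hl
  simpa using h2

theorem seg_eq_of_mem {Δ : ℕ} {ω ω' : Addr m} (hl : ω.length = ω'.length) {i i' : Fin m}
    {v : XVar m} (hv : v ∈ segX Δ ω i) (hv' : v ∈ segX Δ ω' i') : ω = ω' ∧ i = i' := by
  obtain ⟨h, hv⟩ := mem_segX.1 hv
  obtain ⟨h', hv'⟩ := mem_segX.1 hv'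
  have := half_eq_of_mem hl hv hv'
  exact ⟨this.1, this.2.1⟩

theorem card_segX (Δ : ℕ) (ω : Addr m) (i : Fin m) :
    (segX Δ ω i).card = 2 * Fintype.card (Leaf m Δ) := by
  rw [segX, Finset.card_union_of_disjoint, card_cloneX, card_cloneX, two_mul]
  refine Finset.disjoint_left.2 fun v h1 h2 => ?_
  exact absurd (half_eq_of_mem rfl h1 h2).2.2 (by decide)

theorem disjoint_segX {Δ : ℕ} {ω : Addr m} {b b' : Fin m} (h : b ≠ b') :
    Disjoint (segX Δ ω b) (segX Δ ω b') :=
  Finset.disjoint_left.2 fun _ h1 h2 => h (seg_eq_of_mem rfl h1 h2).2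

theorem cloneX_succ (Δ : ℕ) (ω : Addr m) :
    cloneX (Δ + 1) ω = Finset.univ.biUnion fun b => segX Δ ω b := by
  ext v; simp [mem_cloneX_succ]

theorem card_leaf_succ (m Δ : ℕ) :
    Fintype.card (Leaf m (Δ + 1)) = m * (2 * Fintype.card (Leaf m Δ)) := by
  rw [← card_cloneX (Δ + 1) [], cloneX_succ, Finset.card_biUnion]
  · simp [card_segX]
  · exact fun b _ b' _ h => disjoint_segX h

theorem card_filter_mem_cloneX_succ {Δ : ℕ} {ω : Addr m} (U : Finset (XVar m)) :
    (U.filter fun v => v ∈ cloneX (Δ + 1) ω).card =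
      ∑ b, (U.filter fun v => v ∈ segX Δ ω b).card := by
  rw [← Finset.card_biUnion]
  · congr 1; ext v; simp [mem_cloneX_succ]
  · intro b _ b' _ h
    refine Finset.disjoint_left.2 fun v h1 h2 => ?_
    exact Finset.disjoint_left.1 (disjoint_segX h) (Finset.mem_filter.1 h1).2
      (Finset.mem_filter.1 h2).2

theorem card_filter_mem_segX {Δ : ℕ} {ω : Addr m} {i : Fin m} (U : Finset (XVar m)) :
    (U.filter fun v => v ∈ segX Δ ω i).card =
      (U.filter fun v => v ∈ cloneX Δ (ω ++ [(i, 0)])).card +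
      (U.filter fun v => v ∈ cloneX Δ (ω ++ [(i, 1)])).card := by
  rw [← Finset.card_union_of_disjoint]
  · congr 1; ext v; simp [segX]; tauto
  · refine Finset.disjoint_left.2 fun v h1 h2 => ?_
    exact absurd (half_eq_of_mem rfl (Finset.mem_filter.1 h1).2 (Finset.mem_filter.1 h2).2).2.2
      (by decide)

theorem compose_apply {ι : Type} {S : ι → Finset (XVar m)} (ρ : ι → Restriction m)
    (hS : ∀ a a' v, v ∈ S a → v ∈ S a' → a = a') {a : ι} {v : XVar m} (hv : v ∈ S a) :
    compose S ρ v = ρ a v := by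
  unfold compose
  have h : ∃ a, v ∈ S a := ⟨a, hv⟩
  rw [dif_pos h, hS _ _ v h.choose_spec hv]

instance CloneSeed.instNonempty [NeZero m] : (Δ : ℕ) → Nonempty (CloneSeed m Δ)
  | 0 => inferInstanceAs (Nonempty Unit)
  | Δ + 1 =>
      haveI := CloneSeed.instNonempty Δ
      haveI : Nonempty (Leaf m Δ) :=
        ⟨(List.Vector.replicate Δ (0, 0), 0, 0)⟩
      inferInstanceAs (Nonempty (Fin m → Fin 3 × CloneSeed m Δ × Leaf m Δ × Leaf m Δ))

instance Leaf.instNonempty [NeZero m] (Δ : ℕ) : Nonempty (Leaf m Δ) :=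
  ⟨(List.Vector.replicate Δ (0, 0), 0, 0)⟩

/-- The variable drawn for option `E₃` in the half `h`. -/
def SegSeed.leaf {Δ : ℕ} (s : SegSeed m Δ) (h : Fin 2) : Leaf m Δ :=
  if h = 0 then s.2.2.1 else s.2.2.2

theorem segRestr_of_selected {Δ : ℕ} {s : SegSeed m Δ} {h : Fin 2} (hs : s.1 = h.castSucc)
    {ω : Addr m} {i : Fin m} {v : XVar m} (hv : v ∈ cloneX Δ (ω ++ [(i, h)])) :
    segRestr Δ s ω i v = cloneRestr Δ s.2.1 (ω ++ [(i, h)]) v := by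
  obtain ⟨o, c, l₁, l₂⟩ := s
  simp only at hs
  subst hs
  unfold segRestr
  fin_cases h
  · exact if_pos hv
  · exact if_pos hv

theorem segRestr_of_not_selected {Δ : ℕ} {s : SegSeed m Δ} {h : Fin 2} (hs : s.1 = h.castSucc)
    {ω : Addr m} {i : Fin m} {v : XVar m} (hv : v ∉ cloneX Δ (ω ++ [(i, h)])) :
    segRestr Δ s ω i v = .zero := by
  obtain ⟨o, c, l₁, l₂⟩ := s
  simp only at hs
  subst hs
  unfold segRestr
  fin_cases h
  · exact if_neg hv
  · exact if_neg hv

theorem segRestr_two {Δ : ℕ} (c : CloneSeed m Δ) (l₁ l₂ : Leaf m Δ) (ω : Addr m) (i : Fin m)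
    (v : XVar m) : segRestr Δ (2, c, l₁, l₂) ω i v =
      open Classical in
      if v = l₁.at (ω ++ [(i, 0)]) then .y (.seg ω i)
      else if v = l₂.at (ω ++ [(i, 1)]) then .z (.seg ω i)
      else if OnLeastPath Δ (ω ++ [(i, 0)]) (l₁.at (ω ++ [(i, 0)])) v ∨
        OnLeastPath Δ (ω ++ [(i, 1)]) (l₂.at (ω ++ [(i, 1)])) v then .one
      else .zero := rfl

theorem alive_segRestr_two {Δ : ℕ} {c : CloneSeed m Δ} {l₁ l₂ : Leaf m Δ} {ω : Addr m}
    {i : Fin m} {v : XVar m} : (segRestr Δ (2, c, l₁, l₂) ω i v).col.Alive ↔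
      v = l₁.at (ω ++ [(i, 0)]) ∨ v = l₂.at (ω ++ [(i, 1)]) := by
  rw [segRestr_two]
  split_ifs with h1 h2 h3
  · simp [h1, Value.col, Col.Alive]
  · simp [h2, Value.col, Col.Alive]
  · simp [h1, h2, Value.col, Col.Alive]
  · simp [h1, h2, Value.col, Col.Alive]

theorem cloneRestr_succ {Δ : ℕ} (c : Fin m → SegSeed m Δ) {ω : Addr m} {b : Fin m} {v : XVar m}
    (hv : v ∈ segX Δ ω b) :
    cloneRestr (Δ + 1) c ω v = segRestr Δ (c b) ω b v :=
  compose_apply _ (fun _ _ _ h h' => (seg_eq_of_mem rfl h h').2) hv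

theorem leaf_at_mem_cloneX {Δ : ℕ} (l : Leaf m Δ) (ω : Addr m) : l.at ω ∈ cloneX Δ ω :=
  Finset.mem_image.2 ⟨l, Finset.mem_univ _, rfl⟩

/-- The fraction of the clone at `ω` that lies in `U`. -/
noncomputable def density (Δ : ℕ) (ω : Addr m) (U : Finset (XVar m)) : ℝ :=
  ((U.filter fun v => v ∈ cloneX Δ ω).card : ℝ) / Fintype.card (Leaf m Δ)

theorem density_nonneg (Δ : ℕ) (ω : Addr m) (U : Finset (XVar m)) : 0 ≤ density Δ ω U := by
  unfold density; positivity

theorem density_le_one (Δ : ℕ) (ω : Addr m) (U : Finset (XVar m)) : density Δ ω U ≤ 1 := by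
  unfold density
  refine div_le_one_of_le₀ ?_ (by positivity)
  rw [← card_cloneX Δ ω]
  exact_mod_cast Finset.card_le_card fun v hv => (Finset.mem_filter.1 hv).2

/-- A uniformly random variable of the clone lies in U with probability `density Δ ω U`. -/
theorem avg_leaf_mem [NeZero m] (Δ : ℕ) (ω : Addr m) (U : Finset (XVar m)) (x y : ℝ) :
    avg (fun l : Leaf m Δ => if l.at ω ∈ U then x else y) = y + (x - y) * density Δ ω U := by
  have e : (U.filter fun v => v ∈ cloneX Δ ω).card =
      (Finset.univ.filter fun l : Leaf m Δ => l.at ω ∈ U).card := by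
    rw [← Finset.card_image_of_injective _ (Leaf.at_injective (Δ := Δ) ω)]
    congr 1
    ext v
    simp only [Finset.mem_filter, Finset.mem_image, Finset.mem_univ, true_and, cloneX]
    constructor
    · rintro ⟨h, l, rfl⟩; exact ⟨l, h, rfl⟩
    · rintro ⟨l, h, rfl⟩; exact ⟨h, l, rfl⟩
  have e2 : (fun l : Leaf m Δ => if l.at ω ∈ U then x else y) =
      fun l => y + (x - y) * (if l.at ω ∈ U then (1 : ℝ) else 0) := by
    funext l; split_ifs <;> ring
  rw [e2, avg_add, avg_const, avg_const_mul, density, e]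
  simp [avg]

theorem avg_fin_three (f : Fin 3 → ℝ) : avg f = (f 0 + f 1 + f 2) / 3 := by
  simp [avg, Fin.sum_univ_three]

theorem avg_segSeed {Δ : ℕ} (f : SegSeed m Δ → ℝ) :
    avg f = (avg (fun r => f (0, r)) + avg (fun r => f (1, r)) + avg (fun r => f (2, r))) / 3 := by
  rw [avg_prod_type, avg_fin_three]

theorem avg_selected [NeZero m] {Δ : ℕ} (h : Fin 2) (x y : ℝ) :
    avg (fun s : SegSeed m Δ => if s.1 = h.castSucc then x else y) = (x + 2 * y) / 3 := by
  rw [avg_segSeed]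
  fin_cases h
  · simp [avg_const]; ring
  · simp [avg_const]; ring

/-- Under E₃ exactly one variable survives in each half, independently, so the character is a
product of two factors 1 - 2d with d the density of U in the half. Each factor is at most 1 in
absolute value, so either half may be singled out. E₁ and E₂ are bounded trivially. -/
theorem abs_avg_parity_le [NeZero m] {Δ : ℕ} (ω : Addr m) (i : Fin m) (U : Finset (XVar m))
    (h : Fin 2) :
    |avg fun s : SegSeed m Δ =>
      (-1 : ℝ) ^ (U.filter fun v => (segRestr Δ s ω i v).col.Alive).card| ≤
      1 - (1 - |1 - 2 * density Δ (ω ++ [(i, h)]) U|) / 3 := by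
  set f : SegSeed m Δ → ℝ := fun s =>
    (-1 : ℝ) ^ (U.filter fun v => (segRestr Δ s ω i v).col.Alive).card with hf
  have hab : ∀ o, |avg (fun r => f (o, r))| ≤ 1 := fun o => by
    refine (abs_avg_le _).trans (le_of_eq ?_)
    simp [hf, avg_const]
  have h2 : avg (fun r => f (2, r)) =
      (1 - 2 * density Δ (ω ++ [(i, 0)]) U) * (1 - 2 * density Δ (ω ++ [(i, 1)]) U) := by
    have e : ∀ c l₁ l₂, f (2, c, l₁, l₂) = (if l₁.at (ω ++ [(i, 0)]) ∈ U then (-1 : ℝ) else 1) *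
        (if l₂.at (ω ++ [(i, 1)]) ∈ U then (-1 : ℝ) else 1) := by
      intro c l₁ l₂
      have hne : l₁.at (ω ++ [(i, 0)]) ≠ l₂.at (ω ++ [(i, 1)]) := fun he => by
        have := (half_eq_of_mem rfl (leaf_at_mem_cloneX l₁ (ω ++ [(i, 0)]))
          (he ▸ leaf_at_mem_cloneX l₂ (ω ++ [(i, 1)]))).2.2
        exact absurd this (by decide)
      simp only [hf, alive_segRestr_two]
      rw [Finset.filter_or, Finset.card_union_of_disjoint, pow_add, Finset.filter_eq',
        Finset.filter_eq']
      · split_ifs <;> simp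
      · refine Finset.disjoint_left.2 fun v h1 h2 => hne ?_
        rw [← (Finset.mem_filter.1 h1).2, ← (Finset.mem_filter.1 h2).2]
    have e0 : avg (fun r => f (2, r)) =
        avg fun _c : CloneSeed m Δ => avg fun l₁ : Leaf m Δ => avg fun l₂ : Leaf m Δ =>
          (if l₁.at (ω ++ [(i, 0)]) ∈ U then (-1 : ℝ) else 1) *
          (if l₂.at (ω ++ [(i, 1)]) ∈ U then (-1 : ℝ) else 1) := by
      rw [avg_prod_type]
      simp_rw [avg_prod_type, e]
    rw [e0]
    simp_rw [avg_const_mul, avg_leaf_mem, mul_comm _ (1 + (-1 - 1) * density Δ (ω ++ [(i, 1)]) U),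
      avg_const_mul, avg_leaf_mem]
    rw [avg_const]
    ring
  have hle : ∀ h', |1 - 2 * density Δ (ω ++ [(i, h')]) U| ≤ 1 := fun h' => by
    have := density_nonneg Δ (ω ++ [(i, h')]) U
    have := density_le_one Δ (ω ++ [(i, h')]) U
    exact abs_le.2 ⟨by linarith, by linarith⟩
  have h3 : |avg (fun r => f (2, r))| ≤ |1 - 2 * density Δ (ω ++ [(i, h)]) U| := by
    rw [h2, abs_mul]
    fin_cases h
    · exact mul_le_of_le_one_right (abs_nonneg _) (hle 1)
    · exact mul_le_of_le_one_left (abs_nonneg _) (hle 0)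
  rw [avg_segSeed, abs_div, abs_of_pos (by norm_num : (0 : ℝ) < 3)]
  have := abs_add_three (avg fun r => f (0, r)) (avg fun r => f (1, r)) (avg fun r => f (2, r))
  have := hab 0
  have := hab 1
  rw [div_le_iff₀ (by norm_num)]
  linarith

/-- For c in [0, 1] the random quantity dominates c to the number of survivors in U, since E₃ makes
the drawn variable survive. The identity itself only uses that E₃ has probability 1/3. -/
theorem avg_leaf_hit_le [NeZero m] {Δ : ℕ} (ω : Addr m) (i : Fin m) (U : Finset (XVar m))
    (h : Fin 2) {c : ℝ} :
    avg (fun s : SegSeed m Δ => if s.1 = 2 ∧ (s.leaf h).at (ω ++ [(i, h)]) ∈ U then c else 1) =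
      1 - (1 - c) * density Δ (ω ++ [(i, h)]) U / 3 := by
  rw [avg_segSeed]
  have h02 : (0 : Fin 3) ≠ 2 := by decide
  have h12 : (1 : Fin 3) ≠ 2 := by decide
  have e : avg (fun r : CloneSeed m Δ × Leaf m Δ × Leaf m Δ =>
      if (SegSeed.leaf ((2, r) : SegSeed m Δ) h).at (ω ++ [(i, h)]) ∈ U then c else 1) =
      1 + (c - 1) * density Δ (ω ++ [(i, h)]) U := by
    rw [avg_prod_type]
    fin_cases h
    · trans avg fun _ : CloneSeed m Δ => avg fun l₁ : Leaf m Δ => avg fun _ : Leaf m Δ =>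
        if l₁.at (ω ++ [(i, 0)]) ∈ U then c else 1
      · exact congrArg avg (funext fun _ => avg_prod_type _)
      · simp only [avg_const]
        exact avg_leaf_mem Δ _ U c 1
    · trans avg fun _ : CloneSeed m Δ => avg fun _ : Leaf m Δ => avg fun l₂ : Leaf m Δ =>
        if l₂.at (ω ++ [(i, 1)]) ∈ U then c else 1
      · exact congrArg avg (funext fun _ => avg_prod_type _)
      · simp only [avg_const]
        exact avg_leaf_mem Δ _ U c 1
  simp only [h02, h12, false_and, if_false, true_and, avg_const, e]
  ring

end Clones

end DepthHierarchy

namespace DepthHierarchy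

/-! ### Families of segments and colourings driven by their restrictions -/

section Families

variable {m N : ℕ} {ι : Type}

/-- Distinct segments of `X^{(N+1)}`-clones at addresses of one length, with a subset of each. -/
structure SegFamily (m N : ℕ) (ι : Type) where
  ω : ι → Addr m
  i : ι → Fin m
  A : ι → Finset (XVar m)
  length_eq : ∀ a a', (ω a).length = (ω a').length
  injective : Function.Injective fun a => (ω a, i a)
  subset : ∀ a, A a ⊆ segX N (ω a) (i a)

namespace SegFamily

variable (P : SegFamily m N ι)

/-- The colouring `θ` of the variables in `S` is random on the sets `P.A a`, where it is given by
the restrictions of the segments, and constant elsewhere. -/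
structure Admissible (S : Finset (Var m)) (θ : (ι → SegSeed m N) → Var m → Col) : Prop where
  mem : ∀ a, ∀ v ∈ P.A a, Var.x v ∈ S
  apply : ∀ s a, ∀ v ∈ P.A a, θ s (.x v) = (segRestr N (s a) (P.ω a) (P.i a) v).col
  const : ∀ s s', ∀ e ∈ S, (∀ a, ∀ v ∈ P.A a, e ≠ .x v) → θ s e = θ s' e

/-- The variables of `P.A a` that lie in `S`. -/
def part (a : ι) (S : Finset (Var m)) : Finset (XVar m) := (P.A a).filter fun v => Var.x v ∈ S

/-- The address of the half `h` of a segment. -/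
def half (a : ι) (h : Fin 2) : Addr m := P.ω a ++ [(P.i a, h)]

variable {P}

theorem eq_of_mem {a a' : ι} {v : XVar m} (h : v ∈ P.A a) (h' : v ∈ P.A a') : a = a' := by
  have := seg_eq_of_mem (P.length_eq a a') (P.subset a h) (P.subset a' h')
  exact P.injective (Prod.ext this.1 this.2)

theorem part_biUnion {J : Type*} [DecidableEq J] (a : ι) (T : Finset J) (S : J → Finset (Var m)) :
    P.part a (T.biUnion S) = T.biUnion fun j => P.part a (S j) := by
  ext v; simp [part]; tauto

theorem disjoint_part {a : ι} {S S' : Finset (Var m)} (h : Disjoint S S') :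
    Disjoint (P.part a S) (P.part a S') :=
  Finset.disjoint_left.2 fun _ h1 h2 =>
    Finset.disjoint_left.1 h (Finset.mem_filter.1 h1).2 (Finset.mem_filter.1 h2).2

/-- The number of surviving variables of `S` in the segment `a`. -/
noncomputable def alivePart (P : SegFamily m N ι) (S : Finset (Var m)) (a : ι)
    (s : SegSeed m N) : ℕ :=
  ((P.part a S).filter fun v => (segRestr N s (P.ω a) (P.i a) v).col.Alive).card

theorem alivePart_biUnion {J : Type*} [DecidableEq J] (a : ι) (T : Finset J)
    {S : J → Finset (Var m)} (hS : ∀ j j', j ≠ j' → Disjoint (S j) (S j')) (s : SegSeed m N) :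
    P.alivePart (T.biUnion S) a s = ∑ j ∈ T, P.alivePart (S j) a s := by
  unfold alivePart
  rw [part_biUnion, Finset.filter_biUnion, Finset.card_biUnion]
  exact fun j _ j' _ h => Finset.disjoint_filter_filter (disjoint_part (hS j j' h))

theorem density_part_biUnion {J : Type*} [DecidableEq J] (a : ι) (T : Finset J)
    {S : J → Finset (Var m)} (hS : ∀ j j', j ≠ j' → Disjoint (S j) (S j')) (Δ : ℕ) (ω : Addr m) :
    density Δ ω (P.part a (T.biUnion S)) = ∑ j ∈ T, density Δ ω (P.part a (S j)) := by
  unfold density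
  rw [part_biUnion, Finset.filter_biUnion, Finset.card_biUnion, Nat.cast_sum, Finset.sum_div]
  exact fun j _ j' _ h => Finset.disjoint_filter_filter (disjoint_part (hS j j' h))

/-- The number of survivors is a constant plus a sum of independent contributions, one per segment,
which is the form needed for the parity and moment bounds. -/
theorem Admissible.aliveCard_eq [Fintype ι] {S S' : Finset (Var m)}
    {θ : (ι → SegSeed m N) → Var m → Col} (hθ : P.Admissible S θ) (hS' : S' ⊆ S) :
    ∃ b : ℕ, ∀ s, aliveCard (θ s) S' = b + ∑ a, P.alivePart S' a (s a) := by
  classical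
  -- The constant is read off at one sample s₀, hence the split.
  by_cases hne : Nonempty (ι → SegSeed m N)
  swap
  · exact ⟨0, fun s => (hne ⟨s⟩).elim⟩
  obtain ⟨s₀⟩ := hne
  refine ⟨((S'.filter fun e => ∀ a, ∀ v ∈ P.A a, e ≠ .x v).filter
    fun e => (θ s₀ e).Alive).card, fun s => ?_⟩
  have e : (S'.filter fun e => (θ s e).Alive) =
      ((S'.filter fun e => ∀ a, ∀ v ∈ P.A a, e ≠ .x v).filter fun e => (θ s₀ e).Alive) ∪
      Finset.univ.biUnion fun a => ((P.part a S').filter fun v =>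
        (segRestr N (s a) (P.ω a) (P.i a) v).col.Alive).image Var.x := by
    ext e
    simp only [Finset.mem_filter, Finset.mem_union, Finset.mem_biUnion, Finset.mem_univ, true_and,
      Finset.mem_image, part]
    by_cases he : ∀ a, ∀ v ∈ P.A a, e ≠ .x v
    · constructor
      · rintro ⟨h1, h2⟩
        exact Or.inl ⟨⟨h1, he⟩, hθ.const s s₀ e (hS' h1) he ▸ h2⟩
      · rintro (⟨⟨h1, -⟩, h2⟩ | ⟨a, v, ⟨⟨h1, -⟩, -⟩, rfl⟩)
        · exact ⟨h1, hθ.const s₀ s e (hS' h1) he ▸ h2⟩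
        · exact absurd rfl (he a v h1)
    · constructor
      · rintro ⟨h1, h2⟩
        push Not at he
        obtain ⟨a, v, hv, rfl⟩ := he
        exact Or.inr ⟨a, v, ⟨⟨hv, h1⟩, hθ.apply s a v hv ▸ h2⟩, rfl⟩
      · rintro (⟨⟨h1, h3⟩, h2⟩ | ⟨a, v, ⟨⟨h1, h2⟩, h3⟩, rfl⟩)
        · exact absurd h3 he
        · exact ⟨h2, (hθ.apply s a v h1).symm ▸ h3⟩
  unfold aliveCard
  rw [e, Finset.card_union_of_disjoint, Finset.card_biUnion]
  · congr 1
    refine Finset.sum_congr rfl fun a _ => ?_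
    rw [Finset.card_image_of_injective _ (fun v v' h => by simpa using h)]
    rfl
  · intro a _ a' _ h
    refine Finset.disjoint_left.2 fun e h1 h2 => h ?_
    simp only [Finset.mem_image, Finset.mem_filter, part] at h1 h2
    obtain ⟨v, ⟨⟨h1, -⟩, -⟩, rfl⟩ := h1
    obtain ⟨v', ⟨⟨h2, -⟩, -⟩, h3⟩ := h2
    rw [Var.x.injEq] at h3
    exact eq_of_mem h1 (h3 ▸ h2)
  · refine Finset.disjoint_left.2 fun e h1 h2 => ?_
    simp only [Finset.mem_biUnion, Finset.mem_image, Finset.mem_filter, part] at h1 h2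
    obtain ⟨a, -, v, ⟨⟨h2, -⟩, -⟩, rfl⟩ := h2
    exact h1.1.2 a v h2 rfl

theorem exists_half_density [NeZero m] {ε : ℝ} {a : ι}
    (h : ε * ((segX N (P.ω a) (P.i a)).card : ℝ) ≤ (P.A a).card) :
    ∃ h : Fin 2, ε ≤ density N (P.half a h) (P.A a) := by
  have h1 := card_filter_mem_segX (Δ := N) (ω := P.ω a) (i := P.i a) (P.A a)
  rw [Finset.filter_true_of_mem fun v hv => P.subset a hv] at h1
  rw [card_segX, h1] at h
  have hK : (0 : ℝ) < Fintype.card (Leaf m N) := by exact_mod_cast Fintype.card_pos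
  push_cast at h
  unfold density half
  simp only [le_div_iff₀ hK]
  rw [fin_two_cases]
  by_contra hc
  push Not at hc
  linarith [hc.1, hc.2]

/-- The spread case: Markov's inequality for the squared product, in which every factor with an odd
number of survivors is at most 1/2. -/
theorem Admissible.uniformProb_prod_le_of_parity [NeZero m] [Fintype ι] [DecidableEq ι]
    {𝔽 : Type*} [Field 𝔽] {S : Finset (Var m)} {θ : (ι → SegSeed m N) → Var m → Col}
    (hθ : P.Admissible S θ) {t : ℕ} {S' : Fin t → Finset (Var m)}
    (hdis : ∀ j j', j ≠ j' → Disjoint (S' j) (S' j')) (hS' : ∀ j, S' j ⊆ S)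
    (g : Fin t → MvPolynomial (Var m) 𝔽) (h : ι → Fin 2) (D : Finset ι)
    (hD : ∀ a ∈ D, ∀ j, density N (P.half a (h a)) (P.part a (S' j)) ≤ 15 / 16)
    {η : ℝ} (hη : 0 < η) :
    uniformProb {s | η ≤ ∏ j, colRelrk (θ s) (S' j) (g j)} ≤
      Real.exp (-(∑ j, min (∑ a ∈ D, density N (P.half a (h a)) (P.part a (S' j))) 1) / 1536) /
        η ^ 2 := by
  choose b hb using fun j => hθ.aliveCard_eq (hS' j)
  have hmain := avg_prod_odd_le (fun a s j => P.alivePart (S' j) a s) b D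
    (fun a j => density N (P.half a (h a)) (P.part a (S' j)))
    (fun a j => density_nonneg _ _ _)
    (fun a _ => by
      rw [← density_part_biUnion a Finset.univ hdis]
      exact density_le_one _ _ _) hD
    (fun a _ T => by
      rw [← density_part_biUnion a T hdis]
      have := abs_avg_parity_le (P.ω a) (P.i a) (P.part a (T.biUnion S')) (h a) (Δ := N)
      refine le_trans (le_of_eq ?_) this
      congr 2
      funext s
      rw [Finset.prod_pow_eq_pow_sum, ← alivePart_biUnion a T hdis s]
      rfl)
  refine le_trans ?_ (div_le_div_of_nonneg_right hmain (by positivity))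
  refine (uniformProb_mono ?_).trans (uniformProb_ge_le_avg_div (fun s => ?_) (by positivity))
  · intro s hs
    rw [Set.mem_ofPred_eq] at hs ⊢
    refine (pow_le_pow_left₀ hη.le hs 2).trans ?_
    rw [← Finset.prod_pow]
    refine Finset.prod_le_prod (fun j _ => sq_nonneg _) fun j _ => ?_
    split_ifs with ho
    · rw [← hb j s] at ho
      exact colRelrk_sq_le_of_odd _ ho
    · exact pow_le_one₀ (colRelrk_nonneg _ _ _) (colRelrk_le_one _ _ _)
  · exact Finset.prod_nonneg fun j _ => by split_ifs <;> norm_num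

end SegFamily

end Families

end DepthHierarchy

/-! ### Affine linear factors: the base of the induction -/

namespace DepthHierarchy

namespace SegFamily

variable {m N : ℕ} {ι : Type}

theorem two_rpow_neg_half_le : (2 : ℝ) ^ (-(1 / 2) : ℝ) ≤ 4 / 5 := by
  have h : ((2 : ℝ) ^ (-(1 / 2) : ℝ)) ^ 2 = 1 / 2 := by
    rw [← Real.rpow_natCast, ← Real.rpow_mul (by norm_num)]; norm_num [Real.rpow_neg_one]
  nlinarith [Real.rpow_pos_of_pos (show (0 : ℝ) < 2 by norm_num) (-(1 / 2))]

theorem two_rpow_neg_div_two (n : ℕ) :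
    (2 : ℝ) ^ (-(n : ℝ) / 2) = ((2 : ℝ) ^ (-(1 / 2) : ℝ)) ^ n := by
  rw [← Real.rpow_natCast, ← Real.rpow_mul (by norm_num)]
  congr 1; ring

/-- A linear factor with many survivors has relative rank at most 2c^(number of survivors) with c =
2^(-1/2). Each segment independently offers a survivor through E₃, so the mean decays exponentially
in the total density. The rate 1/15 is (1/3)(1 - 4/5), using c ≤ 4/5. -/
theorem Admissible.uniformProb_linear_le [Fintype ι] [DecidableEq ι] {P : SegFamily m N ι}
    [NeZero m]
    {𝔽 : Type*} [Field 𝔽] {S S' : Finset (Var m)} {θ : (ι → SegSeed m N) → Var m → Col}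
    (hθ : P.Admissible S θ) (hS' : S' ⊆ S)
    {g : MvPolynomial (Var m) 𝔽} (hg : g.totalDegree ≤ 1) (h : ι → Fin 2) (D : Finset ι)
    {W η : ℝ} (hη : 0 < η) (hW : W ≤ ∑ a ∈ D, density N (P.half a (h a)) (P.part a S')) :
    uniformProb {s | η ≤ colRelrk (θ s) S' g} ≤ 2 * Real.exp (-W / 15) / η := by
  obtain ⟨b, hb⟩ := hθ.aliveCard_eq hS'
  set c : ℝ := (2 : ℝ) ^ (-(1 / 2) : ℝ) with hc
  have hc0 : 0 < c := Real.rpow_pos_of_pos (by norm_num) _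
  have hc1 : c ≤ 4 / 5 := two_rpow_neg_half_le
  let f : ι → SegSeed m N → ℝ := fun a s =>
    if s.1 = 2 ∧ (s.leaf (h a)).at (P.half a (h a)) ∈ (if a ∈ D then P.part a S' else ∅)
    then c else 1
  have hf : ∀ a s, c ^ P.alivePart S' a s ≤ f a s := by
    intro a s
    simp only [f]
    split_ifs with h1 h2 h2
    · obtain ⟨o, cl, l₁, l₂⟩ := s
      obtain ⟨h2, h3⟩ := h2
      simp only at h2
      subst h2
      have h1' : 1 ≤ P.alivePart S' a (2, cl, l₁, l₂) := ?_
      · exact (pow_le_pow_of_le_one hc0.le (by linarith) h1').trans (pow_one c).le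
      refine Finset.card_pos.2 ⟨_, Finset.mem_filter.2 ⟨h3, ?_⟩⟩
      rw [alive_segRestr_two]
      generalize h a = k
      fin_cases k
      · exact Or.inl rfl
      · exact Or.inr rfl
    · exact pow_le_one₀ hc0.le (by linarith)
    · simp at h2
    · exact pow_le_one₀ hc0.le (by linarith)
  have hle : ∀ s, colRelrk (θ s) S' g ≤ 2 * ∏ a, f a (s a) := by
    intro s
    refine (colRelrk_le_of_totalDegree_le_one _ _ hg).trans ?_
    rw [two_rpow_neg_div_two, hb, pow_add, ← Finset.prod_pow_eq_pow_sum]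
    gcongr
    refine (mul_le_of_le_one_left (Finset.prod_nonneg fun a _ => by positivity)
      (pow_le_one₀ hc0.le (by linarith))).trans ?_
    exact Finset.prod_le_prod (fun a _ => by positivity) fun a _ => hf a (s a)
  refine (uniformProb_ge_le_avg_div (fun s => colRelrk_nonneg _ _ _) hη).trans ?_
  gcongr
  refine (avg_mono hle).trans ?_
  rw [avg_const_mul, avg_pi_prod f]
  gcongr
  have hav : ∀ a, avg (f a) ≤
      if a ∈ D then Real.exp (-density N (P.half a (h a)) (P.part a S') / 15) else 1 := by
    intro a
    simp only [f]
    have := avg_leaf_hit_le (P.ω a) (P.i a) (if a ∈ D then P.part a S' else ∅) (h a) (c := c)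
      (Δ := N)
    rw [half, this]
    have hd := density_nonneg N (P.ω a ++ [(P.i a, h a)]) (P.part a S')
    split_ifs with ha
    · have := Real.add_one_le_exp (-density N (P.ω a ++ [(P.i a, h a)]) (P.part a S') / 15)
      nlinarith
    · have := density_nonneg N (P.ω a ++ [(P.i a, h a)]) ∅
      nlinarith
  refine (Finset.prod_le_prod (fun a _ => ?_) fun a _ => hav a).trans ?_
  · exact div_nonneg (Finset.sum_nonneg fun x _ => by simp only [f]; split_ifs <;> positivity)
      (by positivity)
  rw [← Finset.prod_filter, Finset.filter_mem_eq_inter, Finset.univ_inter, ← Real.exp_sum,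
    Real.exp_le_exp, ← Finset.sum_div, Finset.sum_neg_distrib]
  linarith

/-- An `X^{(0)}`-clone has 8 variables and 15/16 > 7/8, so nothing can be missing. -/
theorem cloneX_zero_subset_of_density {ω : Addr m} {U : Finset (XVar m)}
    (h : 15 / 16 ≤ density 0 ω U) : cloneX 0 ω ⊆ U := by
  have hK : Fintype.card (Leaf m 0) = 8 := by simp [Leaf]
  have hsub : (U.filter fun v => v ∈ cloneX 0 ω) ⊆ cloneX 0 ω := fun v hv =>
    (Finset.mem_filter.1 hv).2
  have := Finset.eq_of_subset_of_card_le hsub (by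
    rw [card_cloneX, hK]
    unfold density at h
    rw [hK] at h
    have h7 : (7 : ℝ) < (U.filter fun v => v ∈ cloneX 0 ω).card := by
      push_cast at h; linarith
    exact_mod_cast h7)
  rw [← this]
  exact Finset.filter_subset _ _

theorem four_le_alivePart {P : SegFamily m 0 ι} {S : Finset (Var m)} {a : ι} {s : SegSeed m 0}
    {h : Fin 2} (hs : s.1 = h.castSucc) (hd : 15 / 16 ≤ density 0 (P.half a h) (P.part a S)) :
    4 ≤ P.alivePart S a s := by
  have hsub := cloneX_zero_subset_of_density hd
  let f : Fin 4 → XVar m := fun p => ⟨P.half a h, p, 0⟩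
  have hf : Function.Injective f := fun p q hpq => by simpa [f] using hpq
  have hcard : (Finset.univ.image f).card = 4 := by
    rw [Finset.card_image_of_injective _ hf, Finset.card_univ, Fintype.card_fin]
  rw [← hcard]
  refine Finset.card_le_card fun v hv => ?_
  obtain ⟨p, -, rfl⟩ := Finset.mem_image.1 hv
  have hm : f p ∈ cloneX 0 (P.half a h) := mem_cloneX.2 ⟨[], rfl, by simp [f]⟩
  refine Finset.mem_filter.2 ⟨hsub hm, ?_⟩
  rw [segRestr_of_selected hs hm]
  have : ∀ p : Fin 4, (baseRestr (P.half a h) (f p)).col.Alive := by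
    intro p
    fin_cases p <;> simp [f, baseRestr, Value.col, Col.Alive]
  exact this p

/-- Each segment of D whose chosen half is kept gives four survivors to the factor owning that half.
The saving must be counted across factors, since different segments may have different owners. -/
theorem Admissible.uniformProb_prod_le_of_full [Fintype ι] [DecidableEq ι]
    {P : SegFamily m 0 ι} [NeZero m]
    {𝔽 : Type*} [Field 𝔽] {S : Finset (Var m)} {θ : (ι → SegSeed m 0) → Var m → Col}
    (hθ : P.Admissible S θ) {t : ℕ} {S' : Fin t → Finset (Var m)} (hS' : ∀ j, S' j ⊆ S)
    {g : Fin t → MvPolynomial (Var m) 𝔽} (hg : ∀ j, (g j).totalDegree ≤ 1)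
    (h : ι → Fin 2) (D : Finset ι) (j : ι → Fin t)
    (hD : ∀ a ∈ D, 15 / 16 ≤ density 0 (P.half a (h a)) (P.part a (S' (j a))))
    {η : ℝ} (hη : 0 < η) :
    uniformProb {s | η ≤ ∏ j, colRelrk (θ s) (S' j) (g j)} ≤
      Real.exp (-(D.card : ℝ) / 6) / η := by
  choose b hb using fun j => hθ.aliveCard_eq (hS' j)
  let f : ι → SegSeed m 0 → ℝ := fun a s => if a ∈ D then
    (if s.1 = (h a).castSucc then 1 / 2 else 1) else 1
  have hle : ∀ s, ∏ j, colRelrk (θ s) (S' j) (g j) ≤ ∏ a, f a (s a) := by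
    intro s
    set Q := D.filter fun a => (s a).1 = (h a).castSucc with hQ
    have hr : ∏ a, f a (s a) = ∏ k, (1 / 2 : ℝ) ^ (Q.filter fun a => j a = k).card := by
      rw [Finset.prod_pow_eq_pow_sum, ← Finset.card_eq_sum_card_fiberwise fun a _ =>
        Finset.mem_coe.2 (Finset.mem_univ (j a))]
      simp only [f]
      rw [← Finset.prod_filter, Finset.filter_mem_eq_inter, Finset.univ_inter,
        ← Finset.prod_filter, Finset.prod_const]
    rw [hr]
    refine Finset.prod_le_prod (fun k _ => colRelrk_nonneg _ _ _) fun k _ => ?_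
    -- With q ≥ 1 kept segments the bound is 2 · 2^(-2q) ≤ 2^(-q). For q = 0 the constant 2 would be
    -- too large, and the trivial bound 1 is used.
    rcases Nat.eq_zero_or_pos (Q.filter fun a => j a = k).card with h0 | hpos
    · rw [h0, pow_zero]; exact colRelrk_le_one _ _ _
    refine (colRelrk_le_of_totalDegree_le_one _ _ (hg k)).trans ?_
    have h4 : 4 * (Q.filter fun a => j a = k).card ≤ aliveCard (θ s) (S' k) := by
      rw [hb]
      refine le_trans ?_ (Nat.le_add_left _ _)
      rw [mul_comm, ← smul_eq_mul, ← Finset.sum_const]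
      refine le_trans (Finset.sum_le_sum fun a ha => ?_)
        (Finset.sum_le_sum_of_subset (Finset.subset_univ (Q.filter fun a => j a = k)))
      obtain ⟨h1, rfl⟩ := Finset.mem_filter.1 ha
      obtain ⟨h1, h2⟩ := Finset.mem_filter.1 h1
      exact four_le_alivePart h2 (hD a h1)
    set q := (Q.filter fun a => j a = k).card
    have h4' : (4 : ℝ) * q ≤ aliveCard (θ s) (S' k) := by exact_mod_cast h4
    have hq1 : (1 : ℝ) ≤ q := by exact_mod_cast hpos
    calc 2 * (2 : ℝ) ^ (-(aliveCard (θ s) (S' k) : ℝ) / 2)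
        = (2 : ℝ) ^ (1 + -(aliveCard (θ s) (S' k) : ℝ) / 2) := by
          rw [Real.rpow_add (by norm_num), Real.rpow_one]
      _ ≤ (2 : ℝ) ^ (-(q : ℝ)) :=
          Real.rpow_le_rpow_of_exponent_le (by norm_num) (by linarith)
      _ = (1 / 2) ^ q := by
          rw [Real.rpow_neg (by norm_num), Real.rpow_natCast, one_div, inv_pow]
  refine (uniformProb_ge_le_avg_div (fun s => Finset.prod_nonneg fun j _ =>
    colRelrk_nonneg _ _ _) hη).trans ?_
  gcongr
  refine (avg_mono hle).trans ?_
  rw [avg_pi_prod f]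
  have hav : ∀ a, avg (f a) ≤ if a ∈ D then Real.exp (-1 / 6) else 1 := by
    intro a
    by_cases ha : a ∈ D
    · simp only [f, ha, if_true]
      rw [avg_selected]
      -- The mean is (1/3)(1/2) + 2/3 = 5/6.
      have := Real.add_one_le_exp (-1 / 6 : ℝ)
      linarith
    · simp [f, ha, avg_const]
  refine (Finset.prod_le_prod (fun a _ => ?_) fun a _ => hav a).trans ?_
  · exact div_nonneg (Finset.sum_nonneg fun x _ => by simp only [f]; split_ifs <;> positivity)
      (by positivity)
  rw [← Finset.prod_filter, Finset.filter_mem_eq_inter, Finset.univ_inter, Finset.prod_const,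
    ← Real.exp_nat_mul]
  refine le_of_eq (congrArg _ ?_)
  ring

end SegFamily

/-! ### Conditioning on part of the random choices -/

section Conditioning

variable {Ω Ω' : Type*} [Fintype Ω] [Fintype Ω']

theorem uniformProb_empty : uniformProb (∅ : Set Ω) = 0 := by
  simp [uniformProb]

theorem uniformProb_preimage_equiv (e : Ω ≃ Ω') (E : Set Ω') :
    uniformProb (e ⁻¹' E) = uniformProb E := by
  rw [uniformProb_eq_avg, uniformProb_eq_avg, ← avg_equiv e]
  rfl

theorem uniformProb_prod_le (E : Set (Ω × Ω')) {δ : ℝ} (hδ : 0 ≤ δ)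
    (h : ∀ x, uniformProb {y | (x, y) ∈ E} ≤ δ) : uniformProb E ≤ δ := by
  rcases isEmpty_or_nonempty Ω with hΩ | hΩ
  · rwa [Set.eq_empty_of_isEmpty E, uniformProb_empty]
  rw [uniformProb_eq_avg, avg_prod_type, ← avg_const (Ω := Ω) δ]
  refine avg_mono fun x => ?_
  have e : (fun y => E.indicator (fun _ => (1 : ℝ)) (x, y)) =
      Set.indicator {y | (x, y) ∈ E} (fun _ => (1 : ℝ)) := by
    classical
    funext y
    rw [Set.indicator_apply, Set.indicator_apply]
    rfl
  rw [e, ← uniformProb_eq_avg]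
  exact h x

/-- A bound that holds for every fixed value of the coordinates outside q holds without
conditioning. -/
theorem uniformProb_le_of_resample {K : Type*} [Fintype K] [DecidableEq K] (q : K → Prop)
    [DecidablePred q] [Fintype {k // q k}] (E : Set (K → Ω)) {δ : ℝ} (hδ : 0 ≤ δ)
    (h : ∀ u₀ : K → Ω, uniformProb {w : {k // q k} → Ω |
      (fun k => if hk : q k then w ⟨k, hk⟩ else u₀ k) ∈ E} ≤ δ) : uniformProb E ≤ δ := by
  rcases isEmpty_or_nonempty (K → Ω) with hΩ | ⟨⟨u₁⟩⟩
  · rwa [Set.eq_empty_of_isEmpty E, uniformProb_empty]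
  let e := (Equiv.piEquivPiSubtypeProd q fun _ => Ω).trans (Equiv.prodComm _ _)
  rw [← uniformProb_preimage_equiv e.symm]
  refine uniformProb_prod_le _ hδ fun v => ?_
  refine le_trans (le_of_eq ?_) (h fun k => if hk : q k then u₁ k else v ⟨k, hk⟩)
  congr 1
  ext w
  rw [Set.mem_ofPred_eq, Set.mem_ofPred_eq, Set.mem_preimage]
  apply iff_of_eq
  congr 1
  funext k
  by_cases hk : q k
  · simp [e, Equiv.piEquivPiSubtypeProd, hk]
  · simp [e, Equiv.piEquivPiSubtypeProd, hk]

end Conditioning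

end DepthHierarchy

/-! ### The inductive statement and the passage from segments to subsegments -/

namespace DepthHierarchy

/-- The bound on the probability of a large relative rank of `(ΣΠ)^(N+1) Σ` formulas under the
restriction of dense subsets of segments. -/
def RankBound (𝔽 : Type*) [Field 𝔽] (m N : ℕ) (κ : ℝ) : Prop :=
  ∀ (ι : Type) [Fintype ι] [DecidableEq ι] (P : SegFamily m N ι) (F : LFormula 𝔽 (Var m))
    (θ : (ι → SegSeed m N) → Var m → Col) (ε : ℝ),
    (m : ℝ) / 10 ≤ Fintype.card ι → 1 / (Fintype.card ι : ℝ) ^ (0.25 : ℝ) ≤ ε →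
    (∀ a, ε * ((segX N (P.ω a) (P.i a)).card : ℝ) ≤ (P.A a).card) →
    F.IsSigmaPiSigma (N + 1) → F.VariableLabelled → P.Admissible F.vars θ →
    (F.size : ℝ) ≤ Real.exp (κ / ((N : ℝ) + 1) ^ 2) →
    uniformProb {s | Real.exp (-(κ / ((N : ℝ) + 1))) ≤ colRelrk (θ s) F.vars F.eval} ≤
      ((N : ℝ) + 1) * Real.exp (-(κ / ((N : ℝ) + 1)))

namespace SegFamily

variable {m N : ℕ} {ι : Type}

/-- Assemble the choices made for a family of segments from the choices of the options and of the
variables for option `E₃`, and the choices made for the subsegments. -/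
def assemble (r : ι → Fin 3 × Leaf m (N + 1) × Leaf m (N + 1)) (u : ι × Fin m → SegSeed m N) :
    ι → SegSeed m (N + 1) :=
  fun a => ((r a).1, (fun b => u (a, b) : Fin m → SegSeed m N), (r a).2)

theorem segRestr_assemble_of_selected {r : ι → Fin 3 × Leaf m (N + 1) × Leaf m (N + 1)}
    (u : ι × Fin m → SegSeed m N) {a : ι} {h : Fin 2} (hr : (r a).1 = h.castSucc) {ω : Addr m}
    {i b : Fin m} {v : XVar m} (hv : v ∈ segX N (ω ++ [(i, h)]) b) :
    segRestr (N + 1) (assemble r u a) ω i v = segRestr N (u (a, b)) (ω ++ [(i, h)]) b v :=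
  (segRestr_of_selected (s := assemble r u a) hr (mem_cloneX_succ.2 ⟨_, hv⟩)).trans
    (cloneRestr_succ (fun b => u (a, b)) hv)

theorem segRestr_assemble_of_two {r : ι → Fin 3 × Leaf m (N + 1) × Leaf m (N + 1)}
    (u u' : ι × Fin m → SegSeed m N) {a : ι} (hr : (r a).1 = 2) (ω : Addr m) (i : Fin m)
    (v : XVar m) :
    segRestr (N + 1) (assemble r u a) ω i v = segRestr (N + 1) (assemble r u' a) ω i v := by
  unfold assemble
  generalize r a = q at hr
  obtain ⟨o, l⟩ := q
  simp only at hr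
  subst hr
  rfl

/-- `assemble` as an equivalence. -/
def assembleEquiv : (ι → Fin 3 × Leaf m (N + 1) × Leaf m (N + 1)) × (ι × Fin m → SegSeed m N) ≃
    (ι → SegSeed m (N + 1)) where
  toFun x := assemble x.1 x.2
  invFun s := (fun a => ((s a).1, (s a).2.2),
    fun k => ((s k.1).2.1 : Fin m → SegSeed m N) k.2)
  left_inv _ := rfl
  right_inv _ := rfl

/-- The parts in `S` of the subsegments `k ∈ B` of the halves `h`. -/
def sub (P : SegFamily m (N + 1) ι) (h : ι → Fin 2) (S : Finset (Var m))
    (B : Finset (ι × Fin m)) : SegFamily m N {k // k ∈ B} where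
  ω k := P.half k.1.1 (h k.1.1)
  i k := k.1.2
  A k := (P.part k.1.1 S).filter fun v => v ∈ segX N (P.half k.1.1 (h k.1.1)) k.1.2
  length_eq k k' := by simp [half, P.length_eq k.1.1 k'.1.1]
  injective := by
    intro k k' hk
    simp only [Prod.mk.injEq, half] at hk
    obtain ⟨h1, h2⟩ := hk
    have h3 := List.append_inj h1 (P.length_eq _ _)
    simp only [List.cons.injEq, Prod.mk.injEq, and_true] at h3
    exact Subtype.ext (Prod.ext (P.injective (Prod.ext h3.1 h3.2.1)) h2)
  subset k := fun v hv => (Finset.mem_filter.1 hv).2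

/-- With the options, the drawn variables and the seeds outside B fixed, the colouring depends only
on the seeds of the subsegments in B, and on these it is given by the sampling algorithm one level
down. -/
theorem Admissible.sub [DecidableEq ι] {P : SegFamily m (N + 1) ι} {S S' : Finset (Var m)}
    {θ : (ι → SegSeed m (N + 1)) → Var m → Col} (hθ : P.Admissible S θ) (hS' : S' ⊆ S)
    (h : ι → Fin 2) (B : Finset (ι × Fin m))
    (r : ι → Fin 3 × Leaf m (N + 1) × Leaf m (N + 1))
    (hr : ∀ k ∈ B, (r k.1).1 = (h k.1).castSucc) (u₀ : ι × Fin m → SegSeed m N) :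
    (P.sub h S' B).Admissible S' fun w =>
      θ (assemble r fun k => if hk : k ∈ B then w ⟨k, hk⟩ else u₀ k) where
  mem k v hv := (Finset.mem_filter.1 (Finset.mem_filter.1 hv).1).2
  apply w k v hv := by
    obtain ⟨hv1, hv2⟩ := Finset.mem_filter.1 hv
    obtain ⟨hv3, -⟩ := Finset.mem_filter.1 hv1
    rw [hθ.apply _ _ v hv3, segRestr_assemble_of_selected _ (hr k.1 k.2) hv2]
    exact congrArg (fun s => (segRestr N s _ _ v).col) (dif_pos k.2)
  const w w' e he hne := by
    by_cases hA : ∀ a, ∀ v ∈ P.A a, e ≠ .x v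
    · exact hθ.const _ _ e (hS' he) hA
    push Not at hA
    obtain ⟨a, v, hv, rfl⟩ := hA
    rw [hθ.apply _ a v hv, hθ.apply _ a v hv]
    congr 1
    by_cases ho : (r a).1 = 2
    · exact segRestr_assemble_of_two _ _ ho _ _ _
    obtain ⟨h', hh'⟩ : ∃ h' : Fin 2, (r a).1 = h'.castSucc := by
      generalize (r a).1 = o at ho ⊢
      fin_cases o
      · exact ⟨0, rfl⟩
      · exact ⟨1, rfl⟩
      · exact absurd rfl ho
    by_cases hc : v ∈ cloneX (N + 1) (P.half a h')
    · obtain ⟨b, hb⟩ := mem_cloneX_succ.1 hc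
      rw [segRestr_assemble_of_selected _ hh' hb, segRestr_assemble_of_selected _ hh' hb]
      -- A subsegment in B lies in the kept half h a, so v would belong to the random part and not
      -- to the constant one. Outside B the seed is the fixed u₀.
      have hkB : (a, b) ∉ B := by
        intro hk
        have : h' = h a := Fin.castSucc_injective _ (hh'.symm.trans (hr _ hk))
        subst this
        exact hne ⟨(a, b), hk⟩ v
          (Finset.mem_filter.2 ⟨Finset.mem_filter.2 ⟨hv, he⟩, hb⟩) rfl
      rw [dif_neg hkB, dif_neg hkB]
    · rw [segRestr_of_not_selected (h := h') hh' hc, segRestr_of_not_selected (h := h') hh' hc]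

/-- The fraction of a segment that lies in `U`. -/
noncomputable def segDensity (N : ℕ) (ω : Addr m) (b : Fin m) (U : Finset (XVar m)) : ℝ :=
  ((U.filter fun v => v ∈ segX N ω b).card : ℝ) / (segX N ω b).card

theorem segDensity_le_one (ω : Addr m) (b : Fin m) (U : Finset (XVar m)) :
    segDensity N ω b U ≤ 1 := by
  refine div_le_one_of_le₀ ?_ (by positivity)
  exact_mod_cast Finset.card_le_card fun v hv => (Finset.mem_filter.1 hv).2

/-- The density of a clone is the average of the densities of its m segments, which have equal size.
-/
theorem sum_segDensity [NeZero m] (ω : Addr m) (U : Finset (XVar m)) :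
    ∑ b, segDensity N ω b U = m * density (N + 1) ω U := by
  have hm : (m : ℝ) ≠ 0 := by exact_mod_cast NeZero.ne m
  simp only [segDensity, card_segX]
  rw [← Finset.sum_div, density, card_filter_mem_cloneX_succ, card_leaf_succ, ← Nat.cast_sum]
  generalize Fintype.card (Leaf m N) = K
  generalize (∑ b, (U.filter fun v => v ∈ segX N ω b).card) = A
  rw [Nat.cast_mul, Nat.cast_mul, Nat.cast_ofNat, mul_div_assoc', mul_div_mul_left _ _ hm]
  push_cast; rfl

/-- How the induction hypothesis is applied. O collects the good outcomes of the options: for these,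
a factor Ψ that must have large relative rank on E is dense in the kept halves Q. Given such an
outcome, enough subsegments of these halves are dense in Ψ, and `RankBound` one level down bounds
the conditional probability. Bad outcomes are charged separately. -/
theorem uniformProb_le_of_rankBound [NeZero m] [Fintype ι] [DecidableEq ι]
    {𝔽 : Type*} [Field 𝔽] {κ : ℝ} (hIH : RankBound 𝔽 m N κ)
    {P : SegFamily m (N + 1) ι} {S : Finset (Var m)}
    {θ : (ι → SegSeed m (N + 1)) → Var m → Col} (hθ : P.Admissible S θ)
    (h : ι → Fin 2) (E : Set (ι → SegSeed m (N + 1))) (O : Set (ι → Fin 3))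
    (hO : ∀ o ∈ O, ∃ (Ψ : LFormula 𝔽 (Var m)) (Q : Finset ι), Ψ.IsSigmaPiSigma (N + 1) ∧
      Ψ.VariableLabelled ∧ (Ψ.size : ℝ) ≤ Real.exp (κ / ((N : ℝ) + 1) ^ 2) ∧ Ψ.vars ⊆ S ∧
      (∀ a ∈ Q, o a = (h a).castSucc) ∧
      (m : ℝ) / 10 + 2 * ((Q.card : ℝ) * m) ^ (3 / 4 : ℝ) <
        m * ∑ a ∈ Q, density (N + 1) (P.half a (h a)) (P.part a Ψ.vars) ∧
      ∀ s ∈ E, Real.exp (-(κ / ((N : ℝ) + 1))) ≤ colRelrk (θ s) Ψ.vars Ψ.eval) :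
    uniformProb E ≤ ((N : ℝ) + 1) * Real.exp (-(κ / ((N : ℝ) + 1))) +
      uniformProb {s : ι → SegSeed m (N + 1) | (fun a => (s a).1) ∉ O} := by
  set δ : ℝ := ((N : ℝ) + 1) * Real.exp (-(κ / ((N : ℝ) + 1))) with hδ
  have hδ0 : 0 ≤ δ := by positivity
  set G : Set (ι → SegSeed m (N + 1)) := {s | (fun a => (s a).1) ∉ O} with hG
  have hsub : E ⊆ (E ∩ Gᶜ) ∪ G := fun s hs => by
    by_cases hg : s ∈ G
    · exact Or.inr hg
    · exact Or.inl ⟨hs, hg⟩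
  refine (uniformProb_mono hsub).trans ((uniformProb_union_le _ _).trans ?_)
  gcongr
  rw [← uniformProb_preimage_equiv assembleEquiv]
  refine uniformProb_prod_le _ hδ0 fun r => ?_
  by_cases ho : (fun a => (r a).1) ∈ O
  swap
  · refine le_of_eq_of_le ?_ hδ0
    have : {u | (r, u) ∈ assembleEquiv ⁻¹' (E ∩ Gᶜ)} = (∅ : Set (ι × Fin m → SegSeed m N)) :=
      Set.eq_empty_of_forall_notMem fun u hu => hu.2 ho
    rw [this, uniformProb_empty]
  obtain ⟨Ψ, Q, hΨ, hlab, hsize, hvars, hQ, hsum, hE⟩ := hO _ ho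
  have hdsum : ∑ k ∈ Q ×ˢ (Finset.univ : Finset (Fin m)),
      segDensity N (P.half k.1 (h k.1)) k.2 (P.part k.1 Ψ.vars) =
      m * ∑ a ∈ Q, density (N + 1) (P.half a (h a)) (P.part a Ψ.vars) := by
    rw [Finset.sum_product, Finset.mul_sum]
    exact Finset.sum_congr rfl fun a _ => sum_segDensity (P.half a (h a)) (P.part a Ψ.vars)
  -- B depends on the options only, so it may be chosen before the seeds of the subsegments are
  -- drawn. Its members have density at least |B|^(-1/4), which is the ε of the hypothesis.
  obtain ⟨B, hBQ, hBcard, hBd⟩ := exists_subset_card_rpow_le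
    (Q ×ˢ (Finset.univ : Finset (Fin m))) _ (fun k _ => segDensity_le_one _ _ _) (μ := (m : ℝ) / 10) (by
      rw [hdsum, Finset.card_product, Finset.card_univ, Fintype.card_fin]
      exact_mod_cast hsum)
  refine uniformProb_le_of_resample (fun k => k ∈ B) _ hδ0 fun u₀ => ?_
  have hr : ∀ k ∈ B, (r k.1).1 = (h k.1).castSucc := fun k hk =>
    hQ k.1 (Finset.mem_product.1 (hBQ hk)).1
  refine le_trans (uniformProb_mono ?_) (hIH {k // k ∈ B} (P.sub h Ψ.vars B) Ψ _
    (1 / (B.card : ℝ) ^ (0.25 : ℝ)) (by rwa [Fintype.card_coe])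
    (by rw [Fintype.card_coe]) (fun k => ?_) hΨ hlab (hθ.sub hvars h B r hr u₀) hsize)
  · intro w hw
    exact hE _ hw.1
  · have hd := hBd k.1 k.2
    have hpos : (0 : ℝ) < (segX N (P.half k.1.1 (h k.1.1)) k.1.2).card := by
      rw [card_segX]
      exact_mod_cast Nat.mul_pos two_pos Fintype.card_pos
    exact (le_div_iff₀ hpos).1 hd

end SegFamily

end DepthHierarchy

/-! ### A product gate: dominated, spread and heavy cases -/

namespace DepthHierarchy

/-- The numerical conditions on `m`, with `κ = m^0.005` and `L = m^0.01` in mind. -/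
structure Large (m : ℕ) (κ L : ℝ) : Prop where
  pos : 0 < m
  κ_nonneg : 0 ≤ κ
  one_le_L : 1 ≤ L
  κ_le_L : 9216 * κ ≤ L
  single : (m : ℝ) / 10 + 2 * (m : ℝ) ^ (3 / 4 : ℝ) < m * (15 / 16)
  κ_le : ∀ M : ℕ, (m : ℝ) / 10 ≤ M → 60 * κ ≤ M
  L_le : ∀ M : ℕ, (m : ℝ) / 10 ≤ M → 4 * L ≤ (M : ℝ) ^ (3 / 4 : ℝ)
  κ_le_div : ∀ M : ℕ, (m : ℝ) / 10 ≤ M → 15 * (4 * κ + 1) ≤ (M : ℝ) ^ (3 / 4 : ℝ) / (4 * L)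
  many : ∀ M : ℕ, (m : ℝ) / 10 ≤ M → (m : ℝ) / 10 + 2 * ((M : ℝ) * m) ^ (3 / 4 : ℝ) <
    m * ((M : ℝ) ^ (3 / 4 : ℝ) / (4 * L) / 10)

theorem rpow_three_quarters_le_mul {M : ℕ} (hM : 0 < M) {ε : ℝ}
    (h : 1 / (M : ℝ) ^ (0.25 : ℝ) ≤ ε) : (M : ℝ) ^ (3 / 4 : ℝ) ≤ M * ε := by
  have hM' : (0 : ℝ) < M := by exact_mod_cast hM
  calc (M : ℝ) ^ (3 / 4 : ℝ) = M * (1 / (M : ℝ) ^ (0.25 : ℝ)) := by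
        rw [one_div, ← Real.rpow_neg hM'.le]
        nth_rewrite 2 [← Real.rpow_one (M : ℝ)]
        rw [← Real.rpow_add hM']; norm_num
    _ ≤ M * ε := by gcongr

/-- If the truncations of `V j` at `1` have a small sum, then some `V j` is large. -/
theorem exists_le_of_sum_min_lt {J : Type*} [Fintype J] (V : J → ℝ) (hV : ∀ j, 0 ≤ V j)
    {L W : ℝ} (hW : 1 ≤ W) (hmin : ∑ j, min (V j) 1 < L) (hsum : W * L ≤ ∑ j, V j) :
    ∃ j, W ≤ V j := by
  by_contra! h
  have : ∑ j, V j ≤ ∑ j, W * min (V j) 1 := by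
    refine Finset.sum_le_sum fun j _ => ?_
    rcases le_total (V j) 1 with h1 | h1
    -- If every V j were below W, then V j ≤ W · min(V j, 1) termwise, and the sum would stay below
    -- W · L.
    · rw [min_eq_left h1]; exact le_mul_of_one_le_left (hV j) hW
    · rw [min_eq_right h1, mul_one]; exact (h j).le
  rw [← Finset.mul_sum] at this
  nlinarith

namespace SegFamily

variable {m N : ℕ} {ι : Type} [Fintype ι] [DecidableEq ι]

theorem uniformProb_selected_density_le [NeZero m] (h : ι → Fin 2) (D : Finset ι) (w : ι → ℝ)
    (h0 : ∀ a, 0 ≤ w a) (h1 : ∀ a, w a ≤ 1) {W : ℝ} (hW : W ≤ ∑ a ∈ D, w a) :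
    uniformProb {s : ι → SegSeed m N |
      ∑ a ∈ D with (s a).1 = (h a).castSucc, w a < W / 10} ≤ Real.exp (-W / 15) :=
  uniformProb_selected_lt_le (fun a (s : SegSeed m N) => s.1 = (h a).castSucc)
    (fun a => by rw [avg_selected]; norm_num) D w h0 h1 hW

variable {𝔽 : Type*} [Field 𝔽] {κ L : ℝ} {P : SegFamily m N ι} {S : Finset (Var m)}
  {θ : (ι → SegSeed m N) → Var m → Col} {t : ℕ} {Ψ : Fin t → LFormula 𝔽 (Var m)} {η : ℝ}

theorem prod_colRelrk_le (θ : Var m → Col) (Ψ : Fin t → LFormula 𝔽 (Var m)) (j : Fin t) :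
    ∏ j, colRelrk θ (Ψ j).vars (Ψ j).eval ≤ colRelrk θ (Ψ j).vars (Ψ j).eval := by
  rw [← Finset.mul_prod_erase _ _ (Finset.mem_univ j)]
  exact mul_le_of_le_one_right (colRelrk_nonneg _ _ _)
    (Finset.prod_le_one (fun _ _ => colRelrk_nonneg _ _ _) fun _ _ => colRelrk_le_one _ _ _)

/-- One kept half that is owned by a factor suffices for the induction hypothesis, since its m
subsegments already exceed the required m/10; the chance that none is kept is exponentially small in
|D|. For N = 0 the survivors in all owned halves are counted instead. -/
theorem Admissible.uniformProb_prod_le_of_dominated [NeZero m] (hL : Large m κ L)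
    (hθ : P.Admissible S θ)
    (hΨ : ∀ j, (Ψ j).IsSigmaPiSigma N) (hlab : ∀ j, (Ψ j).VariableLabelled)
    (hvars : ∀ j, (Ψ j).vars ⊆ S) (hη : Real.exp (-(2 * κ)) ≤ η)
    (hIH : ∀ N', N = N' + 1 → RankBound 𝔽 m N' κ ∧
      (∀ j, ((Ψ j).size : ℝ) ≤ Real.exp (κ / ((N' : ℝ) + 1) ^ 2)) ∧
      Real.exp (-(κ / ((N' : ℝ) + 1))) ≤ η)
    (hM : (m : ℝ) / 10 ≤ Fintype.card ι) (h : ι → Fin 2) (D : Finset ι)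
    (hD : ∀ a ∈ D, ∃ j, 15 / 16 ≤ density N (P.half a (h a)) (P.part a (Ψ j).vars))
    (hcard : (Fintype.card ι : ℝ) ≤ 2 * D.card) :
    uniformProb {s | η ≤ ∏ j, colRelrk (θ s) (Ψ j).vars (Ψ j).eval} ≤
      N * Real.exp (-(κ / N)) + Real.exp (-(2 * κ)) := by
  have hη0 : 0 < η := (Real.exp_pos _).trans_le hη
  have hκM := hL.κ_le _ hM
  cases N with
  | zero =>
    have hDne : D.Nonempty := by
      rw [← Finset.card_pos]
      have : (0 : ℝ) < m := by exact_mod_cast hL.pos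
      have : (0 : ℝ) < D.card := by linarith
      exact_mod_cast this
    obtain ⟨a₀, ha₀⟩ := hDne
    have hj : ∀ a, ∃ j, a ∈ D →
        15 / 16 ≤ density 0 (P.half a (h a)) (P.part a (Ψ j).vars) := fun a => by
      by_cases ha : a ∈ D
      · obtain ⟨j, hj⟩ := hD a ha
        exact ⟨j, fun _ => hj⟩
      · exact ⟨(hD a₀ ha₀).choose, fun h => absurd h ha⟩
    choose j hj using hj
    refine (hθ.uniformProb_prod_le_of_full hvars (fun j => (hΨ j).totalDegree_eval_le_one) h D j hj
      hη0).trans ?_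
    rw [Nat.cast_zero, zero_mul, zero_add, div_le_iff₀ hη0]
    -- Here |D| ≥ M/2 ≥ 30κ, so the left side is at most exp(-5κ); one factor exp(-2κ) pays for η.
    calc Real.exp (-(D.card : ℝ) / 6) ≤ Real.exp (-(2 * κ)) * Real.exp (-(2 * κ)) := by
          rw [← Real.exp_add, Real.exp_le_exp]; linarith [hL.κ_nonneg]
      _ ≤ _ := by gcongr
  | succ N =>
    obtain ⟨hRB, hsize, hηN⟩ := hIH N rfl
    refine (uniformProb_le_of_rankBound hRB hθ h _
      {o | ∃ a ∈ D, o a = (h a).castSucc} ?_).trans ?_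
    · rintro o ⟨a, ha, hoa⟩
      obtain ⟨j, hj⟩ := hD a ha
      refine ⟨Ψ j, {a}, hΨ j, hlab j, hsize j, hvars j, by simpa using hoa, ?_, fun s hs => ?_⟩
      · rw [Finset.card_singleton, Finset.sum_singleton, Nat.cast_one, one_mul]
        refine hL.single.trans_le ?_
        gcongr
      · exact (hηN.trans hs).trans (prod_colRelrk_le (θ s) Ψ j)
    · push_cast
      gcongr
      -- With unit weights, having no kept half means that the selected weight 0 is below |D|/10.
      have := uniformProb_selected_density_le (m := m) (N := N + 1) h D (fun _ => 1)
        (fun _ => zero_le_one) (fun _ => le_rfl) (W := D.card) (by simp)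
      refine (uniformProb_mono fun s hs => ?_).trans (this.trans ?_)
      · rw [Set.mem_ofPred_eq] at hs ⊢
        have hemp : (D.filter fun a => (s a).1 = (h a).castSucc) = ∅ :=
          Finset.filter_eq_empty_iff.2 fun a ha hsa => hs ⟨a, ha, hsa⟩
        rw [hemp, Finset.sum_empty]
        have : (0 : ℝ) < m := by exact_mod_cast hL.pos
        linarith
      · rw [Real.exp_le_exp]; linarith [hL.κ_nonneg]

/-- Here the density of one factor may be spread thinly over many segments. A tenth of it is kept
with high probability, and m times this amount exceeds what is lost in selecting dense subsegments.
-/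
theorem Admissible.uniformProb_prod_le_of_heavy [NeZero m] (hL : Large m κ L)
    (hθ : P.Admissible S θ)
    (hΨ : ∀ j, (Ψ j).IsSigmaPiSigma N) (hlab : ∀ j, (Ψ j).VariableLabelled)
    (hvars : ∀ j, (Ψ j).vars ⊆ S) (hη : Real.exp (-(2 * κ)) ≤ η)
    (hIH : ∀ N', N = N' + 1 → RankBound 𝔽 m N' κ ∧
      (∀ j, ((Ψ j).size : ℝ) ≤ Real.exp (κ / ((N' : ℝ) + 1) ^ 2)) ∧
      Real.exp (-(κ / ((N' : ℝ) + 1))) ≤ η)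
    (hM : (m : ℝ) / 10 ≤ Fintype.card ι) (h : ι → Fin 2) (D : Finset ι) (j : Fin t)
    (hD : (Fintype.card ι : ℝ) ^ (3 / 4 : ℝ) / (4 * L) ≤
      ∑ a ∈ D, density N (P.half a (h a)) (P.part a (Ψ j).vars)) :
    uniformProb {s | η ≤ ∏ j, colRelrk (θ s) (Ψ j).vars (Ψ j).eval} ≤
      N * Real.exp (-(κ / N)) + Real.exp (-(2 * κ)) := by
  have hη0 : 0 < η := (Real.exp_pos _).trans_le hη
  set W : ℝ := (Fintype.card ι : ℝ) ^ (3 / 4 : ℝ) / (4 * L) with hW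
  have hκW : 15 * (4 * κ + 1) ≤ W := hL.κ_le_div _ hM
  cases N with
  | zero =>
    have hsub : {s | η ≤ ∏ j, colRelrk (θ s) (Ψ j).vars (Ψ j).eval} ⊆
        {s | η ≤ colRelrk (θ s) (Ψ j).vars (Ψ j).eval} := fun s hs => by
      rw [Set.mem_ofPred_eq] at hs ⊢
      exact hs.trans (prod_colRelrk_le (θ s) Ψ j)
    refine (uniformProb_mono hsub).trans ((hθ.uniformProb_linear_le (hvars j)
      (hΨ j).totalDegree_eval_le_one h D hη0 hD).trans ?_)
    rw [Nat.cast_zero, zero_mul, zero_add, div_le_iff₀ hη0]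
    have h2 : (2 : ℝ) ≤ Real.exp 1 := by linarith [Real.add_one_le_exp (1 : ℝ)]
    calc 2 * Real.exp (-W / 15) ≤ Real.exp 1 * Real.exp (-(4 * κ + 1)) := by
          gcongr
          linarith
      _ = Real.exp (-(2 * κ)) * Real.exp (-(2 * κ)) := by
          rw [← Real.exp_add, ← Real.exp_add]; congr 1; ring
      _ ≤ _ := by gcongr
  | succ N =>
    obtain ⟨hRB, hsize, hηN⟩ := hIH N rfl
    set p : ι → ℝ := fun a => density (N + 1) (P.half a (h a)) (P.part a (Ψ j).vars) with hp
    refine (uniformProb_le_of_rankBound hRB hθ h _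
      {o | W / 10 ≤ ∑ a ∈ D with o a = (h a).castSucc, p a} ?_).trans ?_
    · intro o ho
      refine ⟨Ψ j, D.filter fun a => o a = (h a).castSucc, hΨ j, hlab j, hsize j, hvars j,
        fun a ha => (Finset.mem_filter.1 ha).2, ?_, fun s hs => ?_⟩
      · have hcard : ((D.filter fun a => o a = (h a).castSucc).card : ℝ) ≤ Fintype.card ι := by
          exact_mod_cast Finset.card_le_univ _
        calc (m : ℝ) / 10 + 2 * (((D.filter fun a => o a = (h a).castSucc).card : ℝ) * m) ^
              (3 / 4 : ℝ) ≤ (m : ℝ) / 10 + 2 * ((Fintype.card ι : ℝ) * m) ^ (3 / 4 : ℝ) := by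
              gcongr
          _ < m * (W / 10) := hL.many _ hM
          _ ≤ _ := by
              gcongr
              exact ho
      · exact (hηN.trans hs).trans (prod_colRelrk_le (θ s) Ψ j)
    · push_cast
      gcongr
      have := uniformProb_selected_density_le (m := m) (N := N + 1) h D p
        (fun _ => density_nonneg _ _ _) (fun _ => density_le_one _ _ _) hD
      refine (uniformProb_mono fun s hs => ?_).trans (this.trans ?_)
      · rw [Set.mem_ofPred_eq] at hs ⊢
        exact not_le.1 hs
      · rw [Real.exp_le_exp]; linarith [hL.κ_nonneg]

/-- The three cases of the argument for a single product gate. The summand exp(-2κ) pays for the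
failure events of the current level, and the other summand comes from the induction hypothesis; it
vanishes for N = 0. -/
theorem Admissible.uniformProb_prod_le [NeZero m] (hL : Large m κ L)
    (hθ : P.Admissible S θ)
    (hΨ : ∀ j, (Ψ j).IsSigmaPiSigma N) (hlab : ∀ j, (Ψ j).VariableLabelled)
    (hdis : ∀ j j', j ≠ j' → Disjoint (Ψ j).vars (Ψ j').vars)
    (hS : S = Finset.univ.biUnion fun j => (Ψ j).vars) (hη : Real.exp (-(2 * κ)) ≤ η)
    (hIH : ∀ N', N = N' + 1 → RankBound 𝔽 m N' κ ∧
      (∀ j, ((Ψ j).size : ℝ) ≤ Real.exp (κ / ((N' : ℝ) + 1) ^ 2)) ∧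
      Real.exp (-(κ / ((N' : ℝ) + 1))) ≤ η)
    (hM : (m : ℝ) / 10 ≤ Fintype.card ι) {ε : ℝ}
    (hε : 1 / (Fintype.card ι : ℝ) ^ (0.25 : ℝ) ≤ ε)
    (hdens : ∀ a, ε * ((segX N (P.ω a) (P.i a)).card : ℝ) ≤ (P.A a).card) :
    uniformProb {s | η ≤ ∏ j, colRelrk (θ s) (Ψ j).vars (Ψ j).eval} ≤
      N * Real.exp (-(κ / N)) + Real.exp (-(2 * κ)) := by
  have hη0 : 0 < η := (Real.exp_pos _).trans_le hη
  have hvars : ∀ j, (Ψ j).vars ⊆ S := fun j => by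
    rw [hS]; exact Finset.subset_biUnion_of_mem (fun j => (Ψ j).vars) (Finset.mem_univ j)
  choose h hh using fun a => exists_half_density (hdens a)
  set D := Finset.univ.filter fun a =>
    ∃ j, 15 / 16 ≤ density N (P.half a (h a)) (P.part a (Ψ j).vars) with hD
  by_cases hcard : (Fintype.card ι : ℝ) ≤ 2 * D.card
  · exact hθ.uniformProb_prod_le_of_dominated hL hΨ hlab hvars hη hIH hM h D
      (fun a ha => (Finset.mem_filter.1 ha).2) hcard
  set V : Fin t → ℝ := fun j =>
    ∑ a ∈ Dᶜ, density N (P.half a (h a)) (P.part a (Ψ j).vars) with hV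
  have hV0 : ∀ j, 0 ≤ V j := fun j => Finset.sum_nonneg fun a _ => density_nonneg _ _ _
  rcases le_or_gt L (∑ j, min (V j) 1) with hB | hB
  · refine (hθ.uniformProb_prod_le_of_parity hdis hvars (fun j => (Ψ j).eval) h Dᶜ
      (fun a ha j => ?_) hη0).trans ?_
    · by_contra hc
      exact Finset.mem_compl.1 ha (Finset.mem_filter.2 ⟨Finset.mem_univ a, j, (not_le.1 hc).le⟩)
    · have hκL := hL.κ_le_L
      rw [div_le_iff₀ (by positivity)]
      -- The square of η costs exp(-4κ), so the exponent must reach 6κ; this explains 9216 = 6 ·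
      -- 1536 in `Large`.
      calc Real.exp (-(∑ j, min (V j) 1) / 1536)
          ≤ Real.exp (-(2 * κ)) * Real.exp (-(2 * κ)) ^ 2 := by
            rw [← Real.exp_nat_mul, ← Real.exp_add, Real.exp_le_exp]; push_cast; linarith
        _ ≤ (N * Real.exp (-(κ / N)) + Real.exp (-(2 * κ))) * η ^ 2 := by
            gcongr
            exact le_add_of_nonneg_left (by positivity)
  · have hm0 : (0 : ℝ) < m := by exact_mod_cast hL.pos
    have hMpos : 0 < Fintype.card ι := by
      have : (0 : ℝ) < Fintype.card ι := by linarith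
      exact_mod_cast this
    have hL0 : 0 < L := by linarith [hL.one_le_L]
    have hMε := rpow_three_quarters_le_mul hMpos hε
    have hLM := hL.L_le _ hM
    -- More than half of the segments are undominated. In each of them the factors together cover
    -- density at least ε of the chosen half, because their labels partition S, and Mε ≥ M^(3/4).
    have hsum : (Fintype.card ι : ℝ) ^ (3 / 4 : ℝ) / (4 * L) * L ≤ ∑ j, V j := by
      have h1 : (Dᶜ.card : ℝ) * ε ≤ ∑ j, V j := by
        simp only [hV]
        rw [Finset.sum_comm, ← nsmul_eq_mul, ← Finset.sum_const]
        refine Finset.sum_le_sum fun a _ => ?_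
        rw [← density_part_biUnion a Finset.univ hdis, ← hS]
        refine (hh a).trans (le_of_eq ?_)
        rw [part, Finset.filter_true_of_mem fun v hv => hθ.mem a v hv]
      have h2 : (D.card : ℝ) + Dᶜ.card = Fintype.card ι := by
        exact_mod_cast Finset.card_add_card_compl D
      have hε0 : 0 ≤ ε := le_trans (by positivity) hε
      have h3 : (Fintype.card ι : ℝ) ^ (3 / 4 : ℝ) / (4 * L) * L =
          (Fintype.card ι : ℝ) ^ (3 / 4 : ℝ) / 4 := by field_simp
      rw [h3]
      have h4 : (Fintype.card ι : ℝ) * ε ≤ 2 * ((Dᶜ.card : ℝ) * ε) := by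
        rw [← mul_assoc]
        gcongr
        linarith
      have : (0 : ℝ) ≤ (Fintype.card ι : ℝ) ^ (3 / 4 : ℝ) := by positivity
      linarith
    obtain ⟨j, hj⟩ := exists_le_of_sum_min_lt V hV0
      ((one_le_div (by linarith)).2 hLM) hB hsum
    exact hθ.uniformProb_prod_le_of_heavy hL hΨ hlab hvars hη hIH hM h Dᶜ j hj

end SegFamily

/-- The union bound over the children of the output gate. Their number is at most exp(κ/Δ²), which
is exactly the gap between the threshold η for one child and the threshold exp(-κ/Δ) for the sum.
The same factor turns the probability bound Δ · η into Δ · exp(-κ/Δ). -/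
theorem rankBound_of_pred {𝔽 : Type*} [Field 𝔽] {m N : ℕ} {κ L : ℝ} (hL : Large m κ L)
    (hIH : ∀ N', N = N' + 1 → RankBound 𝔽 m N' κ) : RankBound 𝔽 m N κ := by
  have : NeZero m := ⟨hL.pos.ne'⟩
  intro ι _ _ P F θ ε hM hε hdens hF hlab hθ hsize
  obtain ⟨S, n, c, Φ, rfl, hΦ⟩ := hF
  obtain ⟨-, hΦS, hΦlab⟩ := hlab
  simp only [LFormula.vars, LFormula.eval, LFormula.size] at hθ hsize ⊢
  have hκ := hL.κ_nonneg
  have hN0 : (0 : ℝ) ≤ N := Nat.cast_nonneg N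
  set Δ : ℝ := (N : ℝ) + 1 with hΔ
  have hΔ1 : 1 ≤ Δ := by linarith
  have hΔ0 : 0 < Δ := by linarith
  set η : ℝ := Real.exp (-(κ / Δ) - κ / Δ ^ 2) with hη
  have hη0 : 0 < η := Real.exp_pos _
  have h1 : κ / Δ ≤ κ := div_le_self hκ hΔ1
  have h2 : κ / Δ ^ 2 ≤ κ := div_le_self hκ (one_le_pow₀ hΔ1)
  have hη2 : Real.exp (-(2 * κ)) ≤ η := by
    rw [hη, Real.exp_le_exp]; linarith
  -- With x = Δ - 1 this reads 1/Δ + 1/Δ² ≤ 1/(Δ - 1), so the threshold of the induction hypothesis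
  -- lies below η.
  have hpred : ∀ x : ℝ, 0 < x → x + 1 = Δ → κ / Δ + κ / Δ ^ 2 ≤ κ / x := by
    intro x hx hxΔ
    have e : κ / Δ + κ / Δ ^ 2 = κ * ((Δ + 1) / Δ ^ 2) := by field_simp
    rw [e, div_eq_mul_one_div κ x]
    refine mul_le_mul_of_nonneg_left ?_ hκ
    rw [div_le_div_iff₀ (by positivity) hx, ← hxΔ]
    nlinarith
  have hn : (n : ℝ) ≤ Real.exp (κ / Δ ^ 2) := by
    refine le_trans ?_ hsize
    have h0 : n ≤ ∑ i, (Φ i).size := by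
      calc n = ∑ _i : Fin n, 1 := by simp
        _ ≤ _ := Finset.sum_le_sum fun i _ => by
          cases Φ i <;> simp [LFormula.size]
    exact_mod_cast h0.trans (Nat.le_add_left _ _)
  have hΦsize : ∀ i, ((Φ i).size : ℝ) ≤ Real.exp (κ / Δ ^ 2) := fun i => by
    refine le_trans ?_ hsize
    have : (Φ i).size ≤ ∑ i, (Φ i).size :=
      Finset.single_le_sum (f := fun i => (Φ i).size) (fun _ _ => Nat.zero_le _) (Finset.mem_univ i)
    exact_mod_cast this.trans (Nat.le_add_left _ _)
  have hprod : ∀ i, uniformProb {s | η ≤ colRelrk (θ s) S (Φ i).eval} ≤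
      N * Real.exp (-(κ / N)) + Real.exp (-(2 * κ)) := by
    intro i
    obtain ⟨S', t, Ψ, hΨ, hΨN⟩ := hΦ i
    have hi := hΦlab i
    have hs := hΦsize i
    have hv := hΦS i
    rw [hΨ] at hi hs hv ⊢
    obtain ⟨-, hunion, hdis, hΨlab⟩ := hi
    simp only [LFormula.vars, LFormula.size] at hv hs
    subst hv
    have hΨsize : ∀ j, ((Ψ j).size : ℝ) ≤ Real.exp (κ / Δ ^ 2) := fun j => by
      refine le_trans ?_ hs
      have : (Ψ j).size ≤ ∑ j, (Ψ j).size := Finset.single_le_sum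
        (f := fun j => (Ψ j).size) (fun _ _ => Nat.zero_le _) (Finset.mem_univ j)
      exact_mod_cast this.trans (Nat.le_add_left _ _)
    refine (uniformProb_mono fun s hs => ?_).trans
      (hθ.uniformProb_prod_le hL hΨN hΨlab hdis hunion hη2 (fun N' hN' => ?_) hM hε hdens)
    · rw [Set.mem_ofPred_eq] at hs ⊢
      refine hs.trans ?_
      rw [LFormula.eval, hunion]
      exact colRelrk_prod_le (θ s) Finset.univ hdis fun j => (hΨlab j).vars_eval_subset
    · have hx : ((N' : ℝ) + 1) + 1 = Δ := by rw [hΔ, hN']; push_cast; ring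
      have hx0 : (0 : ℝ) < (N' : ℝ) + 1 := by positivity
      refine ⟨hIH N' hN', fun j => (hΨsize j).trans ?_, ?_⟩
      · rw [Real.exp_le_exp]
        gcongr
        linarith
      · rw [hη, Real.exp_le_exp]
        linarith [hpred _ hx0 hx]
  have hsub : {s | Real.exp (-(κ / Δ)) ≤
      colRelrk (θ s) S (∑ i, MvPolynomial.C (c i) * (Φ i).eval)} ⊆
      ⋃ i, {s | η ≤ colRelrk (θ s) S (Φ i).eval} := by
    intro s hs
    rw [Set.mem_ofPred_eq] at hs
    by_contra hc
    simp only [Set.mem_iUnion, Set.mem_ofPred_eq, not_exists, not_le] at hc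
    have h3 := hs.trans (colRelrk_sum_le (θ s) S c fun i => (Φ i).eval)
    rcases Nat.eq_zero_or_pos n with h0 | hpos
    · subst h0
      rw [Finset.univ_eq_empty, Finset.sum_empty] at h3
      exact absurd h3 (not_le.2 (Real.exp_pos _))
    · have : Nonempty (Fin n) := ⟨⟨0, hpos⟩⟩
      have h4 : ∑ i, colRelrk (θ s) S (Φ i).eval < ∑ _i : Fin n, η :=
        Finset.sum_lt_sum_of_nonempty Finset.univ_nonempty fun i _ => hc i
      rw [Finset.sum_const, Finset.card_univ, Fintype.card_fin, nsmul_eq_mul] at h4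
      have h5 : n * η ≤ Real.exp (-(κ / Δ)) := by
        calc n * η ≤ Real.exp (κ / Δ ^ 2) * η := by gcongr
          _ = Real.exp (-(κ / Δ)) := by rw [hη, ← Real.exp_add]; congr 1; ring
      linarith
  have hbound : N * Real.exp (-(κ / N)) + Real.exp (-(2 * κ)) ≤ Δ * η := by
    have h3 : (N : ℝ) * Real.exp (-(κ / N)) ≤ N * η := by
      rcases Nat.eq_zero_or_pos N with h0 | hpos
      · simp [h0]
      · have hpos' : (0 : ℝ) < N := by exact_mod_cast hpos
        refine mul_le_mul_of_nonneg_left ?_ hN0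
        rw [hη, Real.exp_le_exp]
        linarith [hpred N hpos' rfl]
    rw [hΔ, add_mul, one_mul]
    linarith
  calc uniformProb _ ≤ ∑ i, uniformProb {s | η ≤ colRelrk (θ s) S (Φ i).eval} :=
        (uniformProb_mono hsub).trans (uniformProb_iUnion_le _)
    _ ≤ ∑ _i : Fin n, Δ * η := Finset.sum_le_sum fun i _ => (hprod i).trans hbound
    _ = n * (Δ * η) := by simp
    _ ≤ Real.exp (κ / Δ ^ 2) * (Δ * η) := by gcongr
    _ = Δ * Real.exp (-(κ / Δ)) := by
        rw [mul_left_comm, hη, ← Real.exp_add]; congr 2; ring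

theorem rankBound (𝔽 : Type*) [Field 𝔽] {m : ℕ} {κ L : ℝ} (hL : Large m κ L) (N : ℕ) :
    RankBound 𝔽 m N κ := by
  induction N with
  | zero => exact rankBound_of_pred hL fun N' h => absurd h (Nat.succ_ne_zero N').symm
  | succ N ih => exact rankBound_of_pred hL fun N' h => Nat.succ_injective h ▸ ih

end DepthHierarchy

namespace DepthHierarchy

/-! ### The numerical conditions for large m -/

section Numerics

/-- With x = m^0.005 every power of m that occurs is an integer power of x, and the conditions
compare monomials in x. The powers of 10 from M ≥ m/10 are absorbed by x ≥ 100000. -/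
theorem large_of_le {m : ℕ} {x : ℝ} (hm : (m : ℝ) = x ^ 200) (hx : 100000 ≤ x) :
    Large m x (x ^ 2) := by
  have hx0 : 0 < x := by linarith
  have hx1 : 1 ≤ x := by linarith
  have hpow : ∀ {a b : ℕ}, a ≤ b → x ^ a ≤ x ^ b := fun h => pow_le_pow_right₀ hx1 h
  have hm34 : (m : ℝ) ^ (3 / 4 : ℝ) = x ^ 150 := by
    rw [hm, ← Real.rpow_natCast, ← Real.rpow_mul hx0.le, ← Real.rpow_natCast]; norm_num
  have hm0 : (0 : ℝ) < m := by rw [hm]; positivity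
  have h23 : x ^ 2 * 100000 ≤ x ^ 3 := by
    rw [pow_succ x 2]; gcongr
  have h34 : x ^ 3 * 100000 ≤ x ^ 4 := by
    rw [pow_succ x 3]; gcongr
  have h12 : x * 100000 ≤ x ^ 2 := by
    rw [pow_two]; gcongr
  have hM34 : ∀ M : ℕ, (m : ℝ) / 10 ≤ M → x ^ 150 / 10 ≤ (M : ℝ) ^ (3 / 4 : ℝ) := by
    intro M hM
    calc x ^ 150 / 10 = (m : ℝ) ^ (3 / 4 : ℝ) / 10 ^ (1 : ℝ) := by rw [hm34, Real.rpow_one]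
      _ ≤ (m : ℝ) ^ (3 / 4 : ℝ) / 10 ^ (3 / 4 : ℝ) := by
          gcongr <;> norm_num
      _ = ((m : ℝ) / 10) ^ (3 / 4 : ℝ) := by rw [Real.div_rpow hm0.le (by norm_num)]
      _ ≤ _ := by gcongr
  refine ⟨by exact_mod_cast hm0, hx0.le, one_le_pow₀ hx1, by linarith, ?_, fun M hM => ?_,
    fun M hM => ?_, fun M hM => ?_, fun M hM => ?_⟩
  · rw [hm34, hm, show (200 : ℕ) = 150 + 50 from rfl, pow_add]
    have : x ^ 1 ≤ x ^ 50 := hpow (by norm_num)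
    have : 0 < x ^ 150 := by positivity
    nlinarith
  · have : x ^ 2 ≤ x ^ 200 := hpow (by norm_num)
    rw [hm] at hM
    linarith
  · have : x ^ 3 ≤ x ^ 150 := hpow (by norm_num)
    linarith [hM34 M hM]
  · have : x ^ 4 ≤ x ^ 150 := hpow (by norm_num)
    rw [le_div_iff₀ (by positivity)]
    have h3 := hM34 M hM
    have e : 15 * (4 * x + 1) * (4 * x ^ 2) = 240 * x ^ 3 + 60 * x ^ 2 := by ring
    rw [e]
    linarith [pow_pos hx0 3]
  · set T := (M : ℝ) ^ (3 / 4 : ℝ) with hT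
    have h3 := hM34 M hM
    have e1 : ((M : ℝ) * m) ^ (3 / 4 : ℝ) = T * x ^ 150 := by
      rw [Real.mul_rpow (by positivity) hm0.le, hm34]
    have e2 : (m : ℝ) * (T / (4 * x ^ 2) / 10) = x ^ 150 * (T * (x ^ 48 / 40)) := by
      rw [hm]; field_simp; ring
    have e3 : (m : ℝ) / 10 = x ^ 150 * (x ^ 50 / 10) := by rw [hm]; ring
    rw [e1, e2, e3]
    have hT4 : x ^ 4 / 10 ≤ T := by
      have : x ^ 4 ≤ x ^ 150 := hpow (by norm_num)
      linarith
    have h48 : x ^ 1 ≤ x ^ 48 := hpow (by norm_num)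
    have h50 : x ^ 50 = x ^ 2 * x ^ 48 := by ring
    have hT0 : 0 < T := lt_of_lt_of_le (by positivity) hT4
    have key : x ^ 50 / 10 + 2 * T < T * (x ^ 48 / 40) := by
      have k1 : 2 * T ≤ T * (x ^ 48 / 80) := by nlinarith
      have k2 : x ^ 50 / 10 < T * (x ^ 48 / 80) := by
        rw [h50]
        have hp : (0 : ℝ) < x ^ 48 := by positivity
        have h5 : 8 * x ^ 2 < T := by linarith [pow_pos hx0 2, pow_pos hx0 3]
        nlinarith
      linarith
    have := mul_lt_mul_of_pos_left key (pow_pos hx0 150)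
    linarith

theorem exists_large : ∃ m₀ : ℕ, ∀ m : ℕ, m₀ ≤ m →
    ∃ L, Large m ((m : ℝ) ^ (0.005 : ℝ)) L := by
  have h := ((tendsto_rpow_atTop (show (0 : ℝ) < 0.005 by norm_num)).comp
    tendsto_natCast_atTop_atTop).eventually_ge_atTop 100000
  obtain ⟨m₀, hm₀⟩ := Filter.eventually_atTop.1 h
  refine ⟨m₀, fun m hm => ⟨_, large_of_le ?_ (hm₀ m hm)⟩⟩
  rw [← Real.rpow_natCast, ← Real.rpow_mul (Nat.cast_nonneg m)]
  norm_num

end Numerics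

/-! ### Restrictions name each surviving variable differently -/

section Names

variable {m : ℕ}

/-- The variable which is the value of a restriction, if any. -/
def Value.toVar? : Value m → Option (Var m)
  | .zero => none
  | .one => none
  | .y u => some (.y u)
  | .z u => some (.z u)

/-- A list of which the addresses of all clones that contain the variable are prefixes. -/
def AVar.key : AVar m → Addr m
  | .leaf ω _ => ω
  | .seg ω i => ω ++ [(i, 0)]

theorem prefix_key_of_mem_cloneA {Δ : ℕ} {ω : Addr m} {u : AVar m} (hu : u ∈ cloneA Δ ω) :
    ω <+: u.key := by
  induction Δ generalizing ω with
  | zero =>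
    simp only [cloneA, Finset.mem_insert, Finset.mem_singleton] at hu
    rcases hu with rfl | rfl <;> exact List.prefix_refl _
  | succ Δ ih =>
    simp only [cloneA, Finset.mem_biUnion, Finset.mem_union, Finset.mem_singleton] at hu
    obtain ⟨i, -, (hu | hu) | rfl⟩ := hu
    · exact (List.prefix_append _ _).trans (ih hu)
    · exact (List.prefix_append _ _).trans (ih hu)
    · exact List.prefix_append _ _

theorem prefix_key_of_mem_segA {Δ : ℕ} {ω : Addr m} {i : Fin m} {u : AVar m}
    (hu : u ∈ segA Δ ω i) : ∃ h, ω ++ [(i, h)] <+: u.key := by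
  simp only [segA, Finset.mem_union, Finset.mem_singleton] at hu
  obtain (hu | hu) | rfl := hu
  · exact ⟨_, prefix_key_of_mem_cloneA hu⟩
  · exact ⟨_, prefix_key_of_mem_cloneA hu⟩
  · exact ⟨_, List.prefix_refl _⟩

/-- Two addresses of equal length that are prefixes of the same key coincide. -/
theorem segA_eq_of_mem {Δ : ℕ} {ω ω' : Addr m} (hl : ω.length = ω'.length) {i i' : Fin m}
    {u : AVar m} (hu : u ∈ segA Δ ω i) (hu' : u ∈ segA Δ ω' i') : ω = ω' ∧ i = i' := by
  obtain ⟨h, hh⟩ := prefix_key_of_mem_segA hu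
  obtain ⟨h', hh'⟩ := prefix_key_of_mem_segA hu'
  have e := (List.prefix_of_prefix_length_le hh hh' (by simp [hl])).eq_of_length (by simp [hl])
  have := List.append_inj e hl
  simp only [List.cons.injEq, Prod.mk.injEq, and_true] at this
  exact ⟨this.1, this.2.1⟩

/-- The `y`- and `z`-variables with names in `B`. -/
def Named (B : Finset (AVar m)) (w : Var m) : Prop := ∃ u ∈ B, w = .y u ∨ w = .z u

theorem Named.mono {B B' : Finset (AVar m)} (h : B ⊆ B') {w : Var m} (hw : Named B w) :
    Named B' w := by
  obtain ⟨u, hu, hw⟩ := hw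
  exact ⟨u, h hu, hw⟩

theorem Named.inter {B B' : Finset (AVar m)} {w : Var m} (h : Named B w) (h' : Named B' w) :
    ∃ u, u ∈ B ∧ u ∈ B' := by
  obtain ⟨u, hu, hw⟩ := h
  obtain ⟨u', hu', hw'⟩ := h'
  refine ⟨u, hu, ?_⟩
  have : u = u' := by
    rcases hw with rfl | rfl <;> rcases hw' with h | h
    · exact Var.y.inj h
    · exact absurd h (by simp)
    · exact absurd h (by simp)
    · exact Var.z.inj h
  exact this ▸ hu'

/-- On `D`, the restriction takes variables named in `B` as values, each at most once. -/
structure Faithful (ρ : Restriction m) (D : Finset (XVar m)) (B : Finset (AVar m)) : Prop where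
  named : ∀ v ∈ D, ∀ w, (ρ v).toVar? = some w → Named B w
  inj : ∀ v ∈ D, ∀ v' ∈ D, ∀ w, (ρ v).toVar? = some w → (ρ v').toVar? = some w → v = v'

theorem faithful_baseRestr (ω : Addr m) : Faithful (baseRestr ω) (cloneX 0 ω) (cloneA 0 ω) := by
  have hv : ∀ v ∈ cloneX 0 ω, ∃ p q, v = ⟨ω, p, q⟩ := by
    intro v hv
    obtain ⟨r, hr, ha⟩ := mem_cloneX.1 hv
    rw [List.length_eq_zero_iff] at hr
    subst hr
    obtain ⟨a, p, q⟩ := v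
    exact ⟨p, q, by simpa using ha⟩
  constructor
  · intro v hvm w hw
    obtain ⟨p, q, rfl⟩ := hv v hvm
    by_cases hq : q = 0
    · subst hq
      fin_cases p <;> simp [baseRestr, Value.toVar?] at hw <;> subst hw <;>
        simp [Named, cloneA]
    · simp [baseRestr, hq, Value.toVar?] at hw
  · intro v hvm v' hvm' w hw hw'
    obtain ⟨p, q, rfl⟩ := hv v hvm
    obtain ⟨p', q', rfl⟩ := hv v' hvm'
    by_cases hq : q = 0
    · by_cases hq' : q' = 0
      · subst hq hq'
        rw [← hw'] at hw
        fin_cases p <;> fin_cases p' <;> first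
          | rfl
          | (simp [baseRestr, Value.toVar?] at hw)
      · simp [baseRestr, hq', Value.toVar?] at hw'
    · simp [baseRestr, hq, Value.toVar?] at hw

theorem faithful_segRestr {Δ : ℕ}
    (hc : ∀ (c : CloneSeed m Δ) (ω : Addr m),
      Faithful (cloneRestr Δ c ω) (cloneX Δ ω) (cloneA Δ ω))
    (s : SegSeed m Δ) (ω : Addr m) (i : Fin m) :
    Faithful (segRestr Δ s ω i) (segX Δ ω i) (segA Δ ω i) := by
  have hsub : ∀ h : Fin 2, cloneA Δ (ω ++ [(i, h)]) ⊆ segA Δ ω i := fun h u hu => by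
    rw [segA, Finset.mem_union, Finset.mem_union]
    fin_cases h
    · exact Or.inl (Or.inl hu)
    · exact Or.inl (Or.inr hu)
  by_cases ho : s.1 = 2
  · obtain ⟨o, c, l₁, l₂⟩ := s
    simp only at ho
    subst ho
    have key : ∀ v w, (segRestr Δ (2, c, l₁, l₂) ω i v).toVar? = some w →
        (v = l₁.at (ω ++ [(i, 0)]) ∧ w = .y (.seg ω i)) ∨
        (v = l₂.at (ω ++ [(i, 1)]) ∧ w = .z (.seg ω i)) := by
      intro v w hw
      rw [segRestr_two] at hw
      split_ifs at hw with h1 h2 h3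
      · exact Or.inl ⟨h1, by simpa [Value.toVar?] using hw.symm⟩
      · exact Or.inr ⟨h2, by simpa [Value.toVar?] using hw.symm⟩
      · simp [Value.toVar?] at hw
      · simp [Value.toVar?] at hw
    constructor
    · intro v _ w hw
      refine ⟨.seg ω i, by simp [segA], ?_⟩
      rcases key v w hw with h | h
      · exact Or.inl h.2
      · exact Or.inr h.2
    · intro v _ v' _ w hw hw'
      rcases key v w hw with ⟨h1, h2⟩ | ⟨h1, h2⟩ <;> rcases key v' w hw' with ⟨h3, h4⟩ | ⟨h3, h4⟩
      · rw [h1, h3]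
      · rw [h2] at h4; simp at h4
      · rw [h2] at h4; simp at h4
      · rw [h1, h3]
  · obtain ⟨h, hh⟩ : ∃ h : Fin 2, s.1 = h.castSucc := by
      generalize s.1 = o at ho ⊢
      fin_cases o
      · exact ⟨0, rfl⟩
      · exact ⟨1, rfl⟩
      · exact absurd rfl ho
    have key : ∀ v w, (segRestr Δ s ω i v).toVar? = some w → v ∈ cloneX Δ (ω ++ [(i, h)]) ∧
        (cloneRestr Δ s.2.1 (ω ++ [(i, h)]) v).toVar? = some w := by
      intro v w hw
      by_cases hv : v ∈ cloneX Δ (ω ++ [(i, h)])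
      · rw [segRestr_of_selected hh hv] at hw
        exact ⟨hv, hw⟩
      · rw [segRestr_of_not_selected hh hv] at hw
        simp [Value.toVar?] at hw
    constructor
    · intro v _ w hw
      obtain ⟨h1, h2⟩ := key v w hw
      exact ((hc _ _).named v h1 w h2).mono (hsub h)
    · intro v _ v' _ w hw hw'
      obtain ⟨h1, h2⟩ := key v w hw
      obtain ⟨h3, h4⟩ := key v' w hw'
      exact (hc _ _).inj v h1 v' h3 w h2 h4

/-- Faithful restrictions of distinct segments can be combined. -/
theorem faithful_of_segments {ι : Type} {Δ : ℕ} {ω : ι → Addr m} {i : ι → Fin m}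
    (hlen : ∀ a a', (ω a).length = (ω a').length)
    (hinj : Function.Injective fun a => (ω a, i a)) {D : Finset (XVar m)}
    (hD : ∀ v ∈ D, ∃ a, v ∈ segX Δ (ω a) (i a)) {B : Finset (AVar m)}
    (hB : ∀ a, segA Δ (ω a) (i a) ⊆ B) {ρ : Restriction m} {ρ' : ι → Restriction m}
    (hρ : ∀ a, ∀ v ∈ segX Δ (ω a) (i a), ρ v = ρ' a v)
    (hf : ∀ a, Faithful (ρ' a) (segX Δ (ω a) (i a)) (segA Δ (ω a) (i a))) :
    Faithful ρ D B := by
  constructor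
  · intro v hv w hw
    obtain ⟨a, ha⟩ := hD v hv
    rw [hρ a v ha] at hw
    exact ((hf a).named v ha w hw).mono (hB a)
  · intro v hv v' hv' w hw hw'
    obtain ⟨a, ha⟩ := hD v hv
    obtain ⟨a', ha'⟩ := hD v' hv'
    rw [hρ a v ha] at hw
    rw [hρ a' v' ha'] at hw'
    obtain ⟨u, hu, hu'⟩ := ((hf a).named v ha w hw).inter ((hf a').named v' ha' w hw')
    have e := segA_eq_of_mem (hlen a a') hu hu'
    have : a = a' := hinj (Prod.ext e.1 e.2)
    subst this
    exact (hf a).inj v ha v' ha' w hw hw'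

theorem faithful_cloneRestr : ∀ (Δ : ℕ) (c : CloneSeed m Δ) (ω : Addr m),
    Faithful (cloneRestr Δ c ω) (cloneX Δ ω) (cloneA Δ ω)
  | 0, _, ω => faithful_baseRestr ω
  | Δ + 1, c, ω =>
    faithful_of_segments (ι := Fin m) (ω := fun _ => ω) (i := fun b => b)
      (ρ' := fun b => segRestr Δ ((c : Fin m → SegSeed m Δ) b) ω b)
      (fun _ _ => rfl) (fun _ _ h => (Prod.mk.inj h).2)
      (fun _ hv => mem_cloneX_succ.1 hv)
      (fun b => Finset.subset_biUnion_of_mem (fun b => segA Δ ω b) (Finset.mem_univ b))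
      (fun _ _ hv => cloneRestr_succ c hv)
      (fun b => faithful_segRestr (faithful_cloneRestr Δ) _ ω b)

theorem jointRestr_apply {M : ℕ} {N : ℕ} {ω : Fin M → Addr m} {i : Fin M → Fin m}
    (hlen : ∀ a a', (ω a).length = (ω a').length)
    (hinj : Function.Injective fun a => (ω a, i a)) (s : Fin M → SegSeed m N) {a : Fin M}
    {v : XVar m} (hv : v ∈ segX N (ω a) (i a)) :
    jointRestr N ω i s v = segRestr N (s a) (ω a) (i a) v :=
  compose_apply _ (fun a a' v h h' => by
    have := seg_eq_of_mem (hlen a a') h h'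
    exact hinj (Prod.ext this.1 this.2)) hv

end Names

end DepthHierarchy

namespace DepthHierarchy

/-! ### Invariance of relative rank under renaming -/

section Renaming

variable {𝔽 V W : Type*} [Field 𝔽]

/-- Only the variables in T matter. Sending the others to a disjoint copy extends the renaming to a
globally injective one, to which `relrk_rename` applies. -/
theorem relrk_rename_of_injOn [DecidableEq V] [DecidableEq W] {φ : V → W} {T : Finset V}
    (hφ : Set.InjOn φ T) {Y Z : Finset V} (hY : Y ⊆ T) (hZ : Z ⊆ T) {g : MvPolynomial V 𝔽}
    (hg : g.vars ⊆ T) :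
    relrk (Y.image φ) (Z.image φ) (MvPolynomial.rename φ g) = relrk Y Z g := by
  let ψ : V → W ⊕ V := fun v => if v ∈ T then .inl (φ v) else .inr v
  have hψT : ∀ v ∈ T, ψ v = .inl (φ v) := fun v hv => if_pos hv
  have hψ : Function.Injective ψ := by
    intro v v' h
    by_cases hv : v ∈ T <;> by_cases hv' : v' ∈ T <;> simp [ψ, hv, hv'] at h
    · exact hφ hv hv' h
    · exact h
  have himg : ∀ U ⊆ T, (U.image φ).image (Sum.inl : W → W ⊕ V) = U.image ψ := fun U hU => by
    rw [Finset.image_image]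
    exact Finset.image_congr fun v hv => (hψT v (hU hv)).symm
  have hren : MvPolynomial.rename (Sum.inl : W → W ⊕ V) (MvPolynomial.rename φ g) =
      MvPolynomial.rename ψ g := by
    rw [MvPolynomial.rename_rename, MvPolynomial.rename_eq_aeval, MvPolynomial.rename_eq_aeval]
    exact MvPolynomial.eval₂Hom_congr' rfl
      (fun v hv _ => congrArg (MvPolynomial.X : W ⊕ V → MvPolynomial (W ⊕ V) 𝔽)
        (hψT v (hg hv)).symm) rfl
  rw [← relrk_rename (Sum.inl_injective : Function.Injective (Sum.inl : W → W ⊕ V)), himg Y hY,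
    himg Z hZ, hren, relrk_rename hψ]

theorem vars_substCol_subset_alive [DecidableEq V] (θ : V → Col) (g : MvPolynomial V 𝔽) :
    (substCol 𝔽 θ g).vars ⊆ g.vars.filter fun e => (θ e).Alive := by
  intro v hv
  obtain ⟨e, he, hv'⟩ := MvPolynomial.mem_vars_bind₁ _ _ hv
  cases hθ : θ e <;> simp [hθ] at hv' <;> subst hv' <;>
    exact Finset.mem_filter.2 ⟨he, by simp [hθ, Col.Alive]⟩

end Renaming

/-! ### From restrictions to colourings, and the theorem -/

section Translation

variable {m : ℕ}

open Classical in
/-- The kinds of values of the variables: `ρ` on `D`, and the given colours on `Y'` and `Z'`. -/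
noncomputable def colouring (D : Finset (XVar m)) (ρ : Restriction m) (Y' Z' : Finset (Var m))
    (w : Var m) : Col :=
  if h : ∃ v ∈ D, w = .x v then (ρ h.choose).col
  else if w ∈ Y' then .y else if w ∈ Z' then .z else .zero

open Classical in
/-- The names that the surviving variables have after the restriction `ρ` of `D`. -/
noncomputable def naming (D : Finset (XVar m)) (ρ : Restriction m) (w : Var m) : Var m :=
  if h : ∃ v ∈ D, w = .x v then (ρ h.choose).toVar?.getD w else w

variable {D : Finset (XVar m)} {ρ : Restriction m} {Y' Z' : Finset (Var m)}

theorem colouring_x {v : XVar m} (hv : v ∈ D) : colouring D ρ Y' Z' (.x v) = (ρ v).col := by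
  have h : ∃ v' ∈ D, Var.x v = .x v' := ⟨v, hv, rfl⟩
  rw [colouring, dif_pos h, ← Var.x.inj h.choose_spec.2]

theorem naming_x {v : XVar m} (hv : v ∈ D) : naming D ρ (.x v) = (ρ v).toVar?.getD (.x v) := by
  have h : ∃ v' ∈ D, Var.x v = .x v' := ⟨v, hv, rfl⟩
  rw [naming, dif_pos h, ← Var.x.inj h.choose_spec.2]

theorem colouring_of_forall_ne {w : Var m} (hw : ∀ v ∈ D, w ≠ .x v) :
    colouring D ρ Y' Z' w = if w ∈ Y' then .y else if w ∈ Z' then .z else .zero := by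
  rw [colouring, dif_neg]
  rintro ⟨v, hv, h⟩
  exact hw v hv h

theorem naming_of_forall_ne {w : Var m} (hw : ∀ v ∈ D, w ≠ .x v) : naming D ρ w = w := by
  rw [naming, dif_neg]
  rintro ⟨v, hv, h⟩
  exact hw v hv h

/-- Restricting is the same as substituting 0 and 1 first and renaming the survivors afterwards. The
renaming is injective on survivors, and it carries the colour classes to the two sets of variables
on the left. -/
theorem relrk_restrictPoly_eq {𝔽 : Type*} [Field 𝔽] {B : Finset (AVar m)}
    (hρ : Faithful ρ D B) (hYZ : Disjoint Y' Z')
    (hdis : Disjoint (Y' ∪ Z') (D.image Var.x ∪ B.image Var.y ∪ B.image Var.z))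
    {f : MvPolynomial (Var m) 𝔽} (hf : f.vars ⊆ D.image Var.x ∪ Y' ∪ Z') :
    relrk (Y' ∪ imageY ρ D B) (Z' ∪ imageZ ρ D B) (restrictPoly D ρ f) =
      colRelrk (colouring D ρ Y' Z') (D.image Var.x ∪ Y' ∪ Z') f := by
  set θ := colouring D ρ Y' Z' with hθ
  set φ := naming D ρ with hφ
  set S := D.image Var.x ∪ Y' ∪ Z' with hS
  have hne : ∀ w ∈ Y' ∪ Z', ∀ v ∈ D, w ≠ .x v := by
    rintro w hw v hv rfl
    exact Finset.disjoint_left.1 hdis hw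
      (Finset.mem_union_left _ (Finset.mem_union_left _ (Finset.mem_image_of_mem _ hv)))
  have hnamed : ∀ w ∈ Y' ∪ Z', ¬ Named B w := by
    rintro w hw ⟨u, hu, rfl | rfl⟩
    · exact Finset.disjoint_left.1 hdis hw
        (Finset.mem_union_left _ (Finset.mem_union_right _ (Finset.mem_image_of_mem _ hu)))
    · exact Finset.disjoint_left.1 hdis hw
        (Finset.mem_union_right _ (Finset.mem_image_of_mem _ hu))
  have hcases : ∀ w ∈ S, (∃ v ∈ D, w = .x v) ∨ w ∈ Y' ∪ Z' := by
    intro w hw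
    rw [hS, Finset.union_assoc, Finset.mem_union, Finset.mem_image] at hw
    rcases hw with ⟨v, hv, rfl⟩ | hw
    · exact Or.inl ⟨v, hv, rfl⟩
    · exact Or.inr hw
  have hθY : ∀ w ∈ Y', θ w = .y := fun w hw => by
    rw [hθ, colouring_of_forall_ne (hne w (Finset.mem_union_left _ hw)), if_pos hw]
  have hθZ : ∀ w ∈ Z', θ w = .z := fun w hw => by
    rw [hθ, colouring_of_forall_ne (hne w (Finset.mem_union_right _ hw)),
      if_neg (fun h => Finset.disjoint_left.1 hYZ h hw), if_pos hw]
  have hφ' : ∀ w ∈ Y' ∪ Z', φ w = w := fun w hw => naming_of_forall_ne (hne w hw)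
  have halive : ∀ v ∈ D, (θ (.x v)).Alive → (ρ v).toVar? = some (φ (.x v)) := by
    intro v hv ha
    rw [hθ, colouring_x hv] at ha
    rw [hφ, naming_x hv]
    cases h : ρ v <;> simp [h, Value.col, Col.Alive] at ha <;> simp [Value.toVar?]
  have hYimg : (S.filter fun e => θ e = .y).image φ = Y' ∪ imageY ρ D B := by
    ext w
    simp only [Finset.mem_image, Finset.mem_filter, Finset.mem_union, imageY]
    constructor
    · rintro ⟨e, ⟨he, hey⟩, rfl⟩
      rcases hcases e he with ⟨v, hv, rfl⟩ | he'
      · right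
        have h1 := halive v hv (Or.inl hey)
        rw [hθ, colouring_x hv] at hey
        cases h : ρ v with
        | y u =>
          rw [h] at h1
          have h2 : Var.y u = φ (.x v) := Option.some.inj h1
          obtain ⟨u', hu', h3⟩ := hρ.named v hv (.y u) (by rw [h]; rfl)
          rcases h3 with h3 | h3
          · exact ⟨u, ⟨Var.y.inj h3 ▸ hu', v, hv, h⟩, h2⟩
          · exact absurd h3 (by simp)
        | _ => rw [h] at hey; exact absurd hey (by simp [Value.col])
      · left
        rw [hφ' e he']
        rcases Finset.mem_union.1 he' with h | h
        · exact h
        · rw [hθZ e h] at hey; exact absurd hey (by decide)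
    · rintro (hw | ⟨u, ⟨hu, v, hv, h⟩, rfl⟩)
      · exact ⟨w, ⟨Finset.mem_union_left _ (Finset.mem_union_right _ hw), hθY w hw⟩,
          hφ' w (Finset.mem_union_left _ hw)⟩
      · refine ⟨.x v, ⟨Finset.mem_union_left _ (Finset.mem_union_left _
          (Finset.mem_image_of_mem _ hv)), ?_⟩, ?_⟩
        · rw [hθ, colouring_x hv, h]; rfl
        · rw [hφ, naming_x hv, h]; rfl
  have hZimg : (S.filter fun e => θ e = .z).image φ = Z' ∪ imageZ ρ D B := by
    ext w
    simp only [Finset.mem_image, Finset.mem_filter, Finset.mem_union, imageZ]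
    constructor
    · rintro ⟨e, ⟨he, hez⟩, rfl⟩
      rcases hcases e he with ⟨v, hv, rfl⟩ | he'
      · right
        have h1 := halive v hv (Or.inr hez)
        rw [hθ, colouring_x hv] at hez
        cases h : ρ v with
        | z u =>
          rw [h] at h1
          have h2 : Var.z u = φ (.x v) := Option.some.inj h1
          obtain ⟨u', hu', h3⟩ := hρ.named v hv (.z u) (by rw [h]; rfl)
          rcases h3 with h3 | h3
          · exact absurd h3 (by simp)
          · exact ⟨u, ⟨Var.z.inj h3 ▸ hu', v, hv, h⟩, h2⟩
        | _ => rw [h] at hez; exact absurd hez (by simp [Value.col])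
      · left
        rw [hφ' e he']
        rcases Finset.mem_union.1 he' with h | h
        · rw [hθY e h] at hez; exact absurd hez (by decide)
        · exact h
    · rintro (hw | ⟨u, ⟨hu, v, hv, h⟩, rfl⟩)
      · exact ⟨w, ⟨Finset.mem_union_right _ hw, hθZ w hw⟩,
          hφ' w (Finset.mem_union_right _ hw)⟩
      · refine ⟨.x v, ⟨Finset.mem_union_left _ (Finset.mem_union_left _
          (Finset.mem_image_of_mem _ hv)), ?_⟩, ?_⟩
        · rw [hθ, colouring_x hv, h]; rfl
        · rw [hφ, naming_x hv, h]; rfl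
  have hX : ∀ w : Var m, (∀ v ∈ D, w ≠ .x v) → (match w with
      | .x e => if e ∈ D then (ρ e).toPoly 𝔽 else MvPolynomial.X (.x e)
      | w => MvPolynomial.X w) = (MvPolynomial.X w : MvPolynomial (Var m) 𝔽) := by
    intro w hw
    cases w with
    | x e => exact if_neg fun he => hw e he rfl
    | _ => rfl
  have hpoly : restrictPoly D ρ f = MvPolynomial.rename φ (substCol 𝔽 θ f) := by
    unfold restrictPoly substCol
    rw [MvPolynomial.rename_bind₁]
    refine MvPolynomial.eval₂Hom_congr' rfl (fun w hw _ => ?_) rfl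
    rcases hcases w (hf hw) with ⟨v, hv, rfl⟩ | hw'
    · simp only [if_pos hv]
      rw [hθ, colouring_x hv]
      have h3 := naming_x (ρ := ρ) hv
      rw [← hφ] at h3
      cases h : ρ v <;> rw [h] at h3 <;> simp [Value.col, Value.toPoly, h3, Value.toVar?]
    · refine (hX w (hne w hw')).trans ?_
      rcases Finset.mem_union.1 hw' with h | h
      · rw [hθY w h]; simp [hφ' w hw']
      · rw [hθZ w h]; simp [hφ' w hw']
  set T := S.filter fun e => (θ e).Alive with hT
  have hinj : Set.InjOn φ T := by
    -- A survivor of D receives a name from B, and B is disjoint from Y' and Z'.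
    have hx : ∀ v ∈ D, ∀ w ∈ Y' ∪ Z', (θ (.x v)).Alive → φ (.x v) ≠ φ w := by
      intro v hv w hw ha h
      rw [hφ' w hw] at h
      exact hnamed w hw (h ▸ hρ.named v hv _ (halive v hv ha))
    intro w hw w' hw' h
    obtain ⟨hw, ha⟩ := Finset.mem_filter.1 (Finset.mem_coe.1 hw)
    obtain ⟨hw', ha'⟩ := Finset.mem_filter.1 (Finset.mem_coe.1 hw')
    rcases hcases w hw with ⟨v, hv, rfl⟩ | h1 <;> rcases hcases w' hw' with ⟨v', hv', rfl⟩ | h2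
    · rw [hρ.inj v hv v' hv' _ (halive v hv ha) (h ▸ halive v' hv' ha')]
    · exact absurd h (hx v hv w' h2 ha)
    · exact absurd h.symm (hx v' hv' w h1 ha')
    · rwa [hφ' w h1, hφ' w' h2] at h
  rw [← hYimg, ← hZimg, hpoly, relrk_rename_of_injOn hinj]
  · rfl
  · exact fun e he => Finset.mem_filter.2 ⟨(Finset.mem_filter.1 he).1,
      Or.inl (Finset.mem_filter.1 he).2⟩
  · exact fun e he => Finset.mem_filter.2 ⟨(Finset.mem_filter.1 he).1,
      Or.inr (Finset.mem_filter.1 he).2⟩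
  · exact (vars_substCol_subset_alive θ f).trans (Finset.filter_subset_filter _ hf)

end Translation

end DepthHierarchy

/-- The `M` given segments are the `i a`-th segments of the `X^{(Δ)}`-clones at the addresses
`ω a` inside `X^{(Δ')}`; their half-segments are `X^{(Δ-1)}`-clones. -/
theorem mainTheorem2 :
    ∃ m₀ : ℕ, ∀ (𝔽 : Type*) [Field 𝔽] (m Δ Δ' M : ℕ) (k ε : ℝ),
      m₀ ≤ m → k = (m : ℝ) ^ (0.05 : ℝ) → (m : ℝ) / 10 ≤ (M : ℝ) →
      0 < ε → 1 / (M : ℝ) ^ (0.25 : ℝ) ≤ ε →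
      1 ≤ Δ → Δ ≤ Δ' → (Δ' : ℝ) ≤ (m : ℝ) ^ (0.001 : ℝ) →
      ∀ (ω : Fin M → Addr m) (i : Fin M → Fin m),
      (∀ a, (ω a).length + Δ = Δ') →
      (Function.Injective fun a => (ω a, i a)) →
      ∀ (X'seg : Fin M → Finset (XVar m)),
      (∀ a, X'seg a ⊆ segX (Δ - 1) (ω a) (i a)) →
      (∀ a, ε * ((segX (Δ - 1) (ω a) (i a)).card : ℝ) ≤ ((X'seg a).card : ℝ)) →
      ∀ (X' : Finset (XVar m)) (YZ : Finset (AVar m)) (Y' Z' : Finset (Var m)),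
      X' = Finset.univ.biUnion X'seg →
      YZ = Finset.univ.biUnion (fun a => segA (Δ - 1) (ω a) (i a)) →
      Disjoint Y' Z' →
      Disjoint (Y' ∪ Z') (X'.image Var.x ∪ YZ.image Var.y ∪ YZ.image Var.z) →
      ∀ F : LFormula 𝔽 (Var m),
      F.IsSigmaPiSigma Δ → F.SyntacticMultilinear → F.VariableLabelled →
      F.vars = X'.image Var.x ∪ Y' ∪ Z' →
      (F.size : ℝ) ≤ Real.exp (k ^ (0.1 : ℝ) / (Δ : ℝ) ^ 2) →
      ∀ ρ : (Fin M → SegSeed m (Δ - 1)) → Restriction m,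
      ρ = jointRestr (Δ - 1) ω i →
      uniformProb {s | Real.exp (-(k ^ (0.1 : ℝ) / (Δ : ℝ))) ≤
          relrk (Y' ∪ imageY (ρ s) X' YZ) (Z' ∪ imageZ (ρ s) X' YZ)
            (restrictPoly X' (ρ s) F.eval)} ≤
        (Δ : ℝ) * Real.exp (-(k ^ (0.1 : ℝ) / (Δ : ℝ))) := by
  obtain ⟨m₀, hm₀⟩ := exists_large
  refine ⟨m₀, ?_⟩
  intro 𝔽 _ m Δ Δ' M k ε hm hk hM _ hε hΔ _ _ ω i hlen hinj A hA hdens X' YZ Y' Z' hX' hYZ hYZ'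
    hdis F hF _ hlab hvars hsize ρ hρ
  obtain ⟨L, hL⟩ := hm₀ m hm
  -- 0.05 · 0.1 = 0.005.
  have hκ : k ^ (0.1 : ℝ) = (m : ℝ) ^ (0.005 : ℝ) := by
    rw [hk, ← Real.rpow_mul (Nat.cast_nonneg m)]; norm_num
  rw [hκ] at hsize ⊢
  obtain ⟨N, rfl⟩ : ∃ N, Δ = N + 1 := ⟨Δ - 1, by omega⟩
  change (Fin M → SegSeed m N) → Restriction m at ρ
  change ρ = jointRestr N ω i at hρ
  change ∀ a, A a ⊆ segX N (ω a) (i a) at hA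
  have hlen' : ∀ a a', (ω a).length = (ω a').length := fun a a' => by
    have := hlen a
    have := hlen a'
    omega
  let P : SegFamily m N (Fin M) := ⟨ω, i, A, hlen', hinj, hA⟩
  have hmem : ∀ a, ∀ v ∈ A a, v ∈ X' := fun a v hv => by
    rw [hX']; exact Finset.mem_biUnion.2 ⟨a, Finset.mem_univ a, hv⟩
  have hmem' : ∀ v ∈ X', ∃ a, v ∈ A a := fun v hv => by
    rw [hX'] at hv
    obtain ⟨a, -, ha⟩ := Finset.mem_biUnion.1 hv
    exact ⟨a, ha⟩
  have happ : ∀ s a, ∀ v ∈ segX N (ω a) (i a), ρ s v = segRestr N (s a) (ω a) (i a) v := by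
    intro s a v hv
    rw [hρ]
    exact jointRestr_apply hlen' hinj s hv
  have hfaith : ∀ s, Faithful (ρ s) X' YZ := fun s =>
    faithful_of_segments (ρ' := fun a => segRestr N (s a) (ω a) (i a)) hlen' hinj
      (fun v hv => (hmem' v hv).imp fun a ha => hA a ha)
      (fun a => by
        rw [hYZ]
        exact Finset.subset_biUnion_of_mem (fun a => segA N (ω a) (i a)) (Finset.mem_univ a))
      (happ s) (fun a => faithful_segRestr (faithful_cloneRestr N) _ _ _)
  -- Initially the constant part consists of Y' and Z' with their given colours.
  have hadm : P.Admissible F.vars fun s => colouring X' (ρ s) Y' Z' := by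
    refine ⟨fun a v hv => ?_, fun s a v hv => ?_, fun s s' e _ hne => ?_⟩
    · rw [hvars]
      exact Finset.mem_union_left _ (Finset.mem_union_left _
        (Finset.mem_image_of_mem _ (hmem a v hv)))
    · rw [colouring_x (hmem a v hv), happ s a v (hA a hv)]
    · have hne' : ∀ v ∈ X', e ≠ .x v := fun v hv => by
        obtain ⟨a, ha⟩ := hmem' v hv
        exact hne a v ha
      rw [colouring_of_forall_ne hne', colouring_of_forall_ne hne']
  have h := rankBound 𝔽 hL N (Fin M) P F _ ε (by rwa [Fintype.card_fin])
    (by rwa [Fintype.card_fin]) hdens hF hlab hadm (by exact_mod_cast hsize)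
  push_cast
  refine le_trans (le_of_eq ?_) h
  congr 1
  ext s
  refine iff_of_eq (congrArg (Real.exp (-((m : ℝ) ^ (0.005 : ℝ) / ((N : ℝ) + 1))) ≤ ·) ?_)
  rw [hvars]
  exact relrk_restrictPoly_eq (hfaith s) hYZ' hdis (hvars ▸ hlab.vars_eval_subset)
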